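/- Let $L>0$. For $T>0$ consider the controlled Schr\"odinger equation $$i y_t+y_{xx}=0 \ \text{ in }(0,T)\times(0,L),\qquad y(0,\cdot)=y^0,\qquad y(\cdot,0)=u,\qquad y(\cdot,L)=0,$$ with complex-valued initial state $y^0\in H^{-1}(0,L)$ and control $u\in L^2(0,T)$. Here $H^1_0(0,L)$ carries the norm $\|\varphi\|=\|\varphi'\|_{L^2(0,L)}$ and $H^{-1}(0,L)$ is its dual with the dual norm. The solution is the function $y\in C([0,T];H^{-1}(0,L))$ with $y(0)=y^0$ such that, for all $t\in[0,T]$ and all $\eta\in C^3([0,L])$ with $\eta(0)=\eta(L)=\eta''(0)=\eta''(L)=0$, $$\langle y(t),\eta\rangle=\langle y^0,\eta\rangle+i\int_0^t\langle y(s),\eta''\rangle\,ds+i\,\eta'(0)\int_0^t u(s)\,ds .$$ Let $C_S(T,L)\in[0,\infty]$ be the null control cost, i.e. the smallest constant $C$ such that for every $y^0\in H^{-1}(0,L)$ there is a control $u\in L^2(0,T)$ with $\|u\|_{L^2(0,T)}\le C\|y^0\|_{H^{-1}(0,L)}$ whose solution satisfies $y(T,\cdot)=0$ (with $C_S(T,L)=\infty$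 if there is no such constant), and let $$\beta_+=\limsup_{T\to0^+}T\log C_S(T,L)\in[-\infty,\infty].$$ Then $$\beta_+\le\frac{\sqrt[4]{27}}{4}L^2<0.56987677\,L^2 .$$ -/

import Mathlib

open MeasureTheory Set Filter Topology
open scoped ENNReal NNReal

noncomputable section

namespace SchrodingerControl

/-- The complex space `L²(0, a)`. -/
abbrev L2 (a : ℝ) : Type := Lp ℂ 2 (volume.restrict (Ioo (0 : ℝ) a))

theorem ae_Ioc_of_ae_Ioo {a x : ℝ} (hx : x ≤ a) {p : ℝ → Prop}
    (h : ∀ᵐ t ∂(volume.restrict (Ioo (0 : ℝ) a)), p t) :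
    ∀ᵐ t ∂(volume.restrict (Ioc (0 : ℝ) x)), p t := by
  rw [Measure.restrict_congr_set (Ioo_ae_eq_Ioc (μ := volume) (a := (0 : ℝ)) (b := a))] at h
  exact ae_restrict_of_ae_restrict_of_subset (Ioc_subset_Ioc_right hx) h

theorem L2.intervalIntegrable {a x : ℝ} (h0 : 0 ≤ x) (hx : x ≤ a) (g : L2 a) :
    IntervalIntegrable g volume 0 x := by
  rw [intervalIntegrable_iff_integrableOn_Ioc_of_le h0]
  have h1 : IntegrableOn g (Ioo (0 : ℝ) a) volume :=
    (Lp.memLp g).integrable (by norm_num)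
  have h2 : IntegrableOn g (Ioc (0 : ℝ) a) volume :=
    h1.congr_set_ae (Ioo_ae_eq_Ioc (μ := volume)).symm
  exact h2.mono_set (Ioc_subset_Ioc_right hx)

/-- The pairs `(f, f')` where `f` belongs to the Sobolev space `H¹₀(0, L)`: `f` is absolutely
continuous on `[0, L]`, i.e. the primitive of a function `g = f'`, which is required to be in
`L²(0, L)`, and `f` vanishes at both ends.  The representative `f` is extended by `0` outside
`[0, L]`, so that it is determined by its class. -/
def H10Submodule (L : ℝ) : Submodule ℂ ((ℝ → ℂ) × L2 L) where
  carrier := {p | (∀ x ∈ Icc (0 : ℝ) L, p.1 x = ∫ t in (0 : ℝ)..x, p.2 t) ∧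
    p.1 L = 0 ∧ ∀ x, x ∉ Icc (0 : ℝ) L → p.1 x = 0}
  zero_mem' := by
    refine ⟨fun x hx => ?_, rfl, fun x _ => rfl⟩
    have e : (∫ t in (0 : ℝ)..x, (0 : L2 L) t) = 0 := by
      rw [intervalIntegral.integral_of_le hx.1, integral_congr_ae
        (ae_Ioc_of_ae_Ioo hx.2 (Lp.coeFn_zero ℂ 2 (volume.restrict (Ioo (0 : ℝ) L))))]
      simp
    exact e.symm
  add_mem' := by
    rintro ⟨f, g⟩ ⟨f', g'⟩ ⟨h1, h2, h3⟩ ⟨h1', h2', h3'⟩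
    refine ⟨fun x hx => ?_, by simp_all, fun x hx => ?_⟩
    · have e : (∫ t in (0 : ℝ)..x, (g + g' : L2 L) t)
          = ∫ t in (0 : ℝ)..x, (g t + g' t) := by
        rw [intervalIntegral.integral_of_le hx.1, intervalIntegral.integral_of_le hx.1]
        exact integral_congr_ae (ae_Ioc_of_ae_Ioo hx.2 (Lp.coeFn_add g g'))
      change f x + f' x = ∫ t in (0 : ℝ)..x, (g + g' : L2 L) t
      rw [e, intervalIntegral.integral_add (L2.intervalIntegrable hx.1 hx.2 g)
        (L2.intervalIntegrable hx.1 hx.2 g')]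
      exact congrArg₂ (· + ·) (h1 x hx) (h1' x hx)
    · change f x + f' x = 0
      rw [show f x = 0 from h3 x hx, show f' x = 0 from h3' x hx, add_zero]
  smul_mem' := by
    rintro c ⟨f, g⟩ ⟨h1, h2, h3⟩
    refine ⟨fun x hx => ?_, by simp_all, fun x hx => ?_⟩
    · have e : (∫ t in (0 : ℝ)..x, (c • g : L2 L) t) = ∫ t in (0 : ℝ)..x, c • g t := by
        rw [intervalIntegral.integral_of_le hx.1, intervalIntegral.integral_of_le hx.1]
        exact integral_congr_ae (ae_Ioc_of_ae_Ioo hx.2 (Lp.coeFn_smul c g))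
      change c • f x = ∫ t in (0 : ℝ)..x, (c • g : L2 L) t
      rw [e, intervalIntegral.integral_smul]
      exact congrArg (c • ·) (h1 x hx)
    · change c • f x = 0
      rw [show f x = 0 from h3 x hx, smul_zero]

/-- The complex Sobolev space `H¹₀(0, L)`. -/
def H10 (L : ℝ) : Type := H10Submodule L

instance (L : ℝ) : AddCommGroup (H10 L) := inferInstanceAs (AddCommGroup (H10Submodule L))

instance (L : ℝ) : Module ℂ (H10 L) := inferInstanceAs (Module ℂ (H10Submodule L))

/-- An element of `H¹₀(0, L)` as a function. -/
instance (L : ℝ) : CoeFun (H10 L) (fun _ => ℝ → ℂ) := ⟨fun φ => φ.1.1⟩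

/-- The derivative `φ ↦ φ'`, from `H¹₀(0, L)` to `L²(0, L)`. -/
def H10.grad (L : ℝ) : H10 L →ₗ[ℂ] L2 L :=
  (LinearMap.snd ℂ (ℝ → ℂ) (L2 L)).comp (H10Submodule L).subtype

theorem H10.grad_injective (L : ℝ) : Function.Injective (H10.grad L) := by
  rintro ⟨⟨f, g⟩, h1, h2, h3⟩ ⟨⟨f', g'⟩, h1', h2', h3'⟩ h
  have hg : g = g' := h
  subst hg
  have hf : f = f' := by
    funext x
    by_cases hx : x ∈ Icc (0 : ℝ) L
    · exact (h1 x hx).trans (h1' x hx).symm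
    · exact (h3 x hx).trans (h3' x hx).symm
  subst hf
  rfl

/-- `H¹₀(0, L)` carries the norm `‖φ‖ = ‖φ'‖_{L²(0, L)}`. -/
instance (L : ℝ) : NormedAddCommGroup (H10 L) :=
  NormedAddCommGroup.induced (H10 L) (L2 L) (H10.grad L) (H10.grad_injective L)

instance (L : ℝ) : NormedSpace ℂ (H10 L) :=
  NormedSpace.induced ℂ (H10 L) (L2 L) (H10.grad L)

/-- `H⁻¹(0, L)`, the dual of `H¹₀(0, L)` with the dual norm; the duality bracket is linear in both
arguments, so that a function `f` is the functional `φ ↦ ∫ f φ`. -/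
abbrev HNegOne (L : ℝ) : Type := StrongDual ℂ (H10 L)

/-- `y` is the (weak) solution on `[0, T] × [0, L]` of `i y_t + y_xx = 0`, `y(0, ·) = y⁰`,
`y(·, 0) = u`, `y(·, L) = 0`: a continuous function from `[0, T]` to `H⁻¹(0, L)` such that
`⟨y(t), η⟩ = ⟨y⁰, η⟩ + i ∫₀ᵗ ⟨y(s), η''⟩ ds + i η'(0) ∫₀ᵗ u(s) ds` for every `t` in `[0, T]` and
every `η` of class `C³` on `[0, L]` with `η(0) = η(L) = η''(0) = η''(L) = 0`.  Here `φ` and `ψ` are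
`η` and `η''` as elements of `H¹₀(0, L)`, whence the boundary conditions. -/
structure IsSolution (T L : ℝ) (y₀ : HNegOne L) (u : L2 T) (y : ℝ → HNegOne L) : Prop where
  continuousOn : ContinuousOn y (Icc 0 T)
  initial : y 0 = y₀
  weak : ∀ η : ℝ → ℂ, ContDiff ℝ 3 η → ∀ φ ψ : H10 L,
    (∀ x ∈ Icc (0 : ℝ) L, φ x = η x) →
    (∀ x ∈ Icc (0 : ℝ) L, ψ x = deriv (deriv η) x) →
    ∀ t ∈ Icc (0 : ℝ) T,
      y t φ = y₀ φ + Complex.I * (∫ s in (0 : ℝ)..t, y s ψ)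
        + Complex.I * deriv η 0 * (∫ s in (0 : ℝ)..t, u s)

/-- The control `u` drives the initial state `y₀` to `0` at time `T`. -/
def DrivesToZero (T L : ℝ) (y₀ : HNegOne L) (u : L2 T) : Prop :=
  ∃ y : ℝ → HNegOne L, IsSolution T L y₀ u y ∧ y T = 0

/-- The null control cost `C_S(T, L)`: the smallest constant `C` such that every `y₀` in
`H⁻¹(0, L)` is driven to `0` at time `T` by some `u` with `‖u‖ ≤ C ‖y₀‖`; it is `∞` if there is no
such constant. -/
def controlCost (T L : ℝ) : ℝ≥0∞ :=
  ⨅ (C : ℝ≥0) (_ : ∀ y₀ : HNegOne L, ∃ u : L2 T, DrivesToZero T L y₀ u ∧ ‖u‖ ≤ C * ‖y₀‖),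
    (C : ℝ≥0∞)

/-- `β₊ = limsup_{T → 0⁺} T log C_S(T, L)`, in `[-∞, ∞]`. -/
def betaPlus (L : ℝ) : EReal :=
  limsup (fun T : ℝ => (T : EReal) * ENNReal.log (controlCost T L)) (𝓝[>] 0)

end SchrodingerControl

end

/-! The gradient embeds H¹₀ isometrically in L², where the cosines diagonalise the equation. Each
mode of the solution is given by Duhamel's formula, so steering to zero is a moment problem for the
exponentials of frequencies μₘ = (mπ/L)². By Hahn–Banach and Riesz it is solvable, at cost C √(L/2),
as soon as Σ|aₘ|² ≤ C² ∫₀ᵀ |Σ aₘ exp(-iμₘt)|² dt (`exists_drivesToZero`). A change of time scale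
makes the frequencies m², observed on a window (-T/2, T/2).

The exponent comes from the bound on one coefficient, `norm_coeff_le`. The function
sin(y√(z+n²))/√(z+n²) equals sin(my)/m at z = m²-n², so integrating it against sin(ny) over (0, π)
isolates the mode n. It grows like exp(π√|s|) on the negative axis, so it is multiplied by an entire
function of type r < T/2 decaying there like exp(-2√(cr|s|)), with cr = π²/4. By Paley–Wiener the
product, with two sinc factors, comes from a test function supported in the window.

The multiplier is the Fourier transform on [-1, 1] of a kernel oscillating like exp(ic(1/(1-t) -
1/(1+t))). Its decay follows by moving the contour into the upper half plane
(`norm_multiplier_le_of_re_nonpos`). Its value at 0 is exactly (π/4)(1+c)exp(-c), by the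
substitution w = 2t/(1-t²) (`multiplier_zero`). The total loss is exp((1 + 27/500)c) with c =
π²/(4r), that is at most exp(0.5548 π²/T) for r = 0.475 T.

Ingham's inequality controls the modes beyond 6/T and the coefficient bound the others. This costs
only powers of 1/T, absorbed by a slightly larger exponent. After scaling back, the control cost is
at most K exp(0.56 L²/T), and 0.56 < 27^(1/4)/4. -/

noncomputable section
namespace SchrodingerControl
-- The oscillating kernel in the upper half plane
open Complex in
/-- The oscillating weight on `[-1, 1]` whose Fourier transform is the multiplier. -/
def mulKernel (c : ℝ) (t : ℂ) : ℂ :=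
  (1 - t ^ 2) ^ 2 / (1 + t ^ 2) ^ 3 * exp (I * c * ((1 - t)⁻¹ - (1 + t)⁻¹))

/-- The imaginary parts of 1/(1-t) and -1/(1+t) both have the sign of `t.im`. The exponential
therefore decays in the upper half plane, where the contour will go. -/
theorem norm_mulKernel (c : ℝ) (t : ℂ) :
    ‖mulKernel c t‖ = ‖1 - t ^ 2‖ ^ 2 / ‖1 + t ^ 2‖ ^ 3 *
      Real.exp (-(c * (t.im * (1 / Complex.normSq (1 - t) + 1 / Complex.normSq (1 + t))))) := by
  rw [mulKernel, norm_mul, norm_div, norm_pow, norm_pow, Complex.norm_exp]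
  congr 2
  simp only [Complex.mul_re, Complex.mul_im, Complex.I_re, Complex.I_im, Complex.ofReal_re,
    Complex.ofReal_im, Complex.sub_re, Complex.sub_im, Complex.inv_re, Complex.inv_im,
    Complex.add_im, Complex.one_im]
  ring

theorem re_one_add_sq (t : ℂ) : (1 + t ^ 2).re = 1 + t.re ^ 2 - t.im ^ 2 := by
  simp [sq]; ring

/-- The contour stops at height 19/20 in order to stay below the pole t = i. -/
theorem le_norm_one_add_sq {t : ℂ} (h0 : 0 ≤ t.im) (h1 : t.im ≤ 19 / 20) :
    1 / 20 ≤ ‖1 + t ^ 2‖ := by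
  refine le_trans ?_ (Complex.re_le_norm _)
  rw [re_one_add_sq]
  nlinarith [sq_nonneg t.re]

theorem one_add_sq_ne_zero {t : ℂ} (h0 : 0 ≤ t.im) (h1 : t.im ≤ 19 / 20) : 1 + t ^ 2 ≠ 0 := by
  have := le_norm_one_add_sq h0 h1
  intro h
  rw [h, norm_zero] at this
  norm_num at this

theorem norm_one_sub_sq_le {t : ℂ} (hx : t.re ∈ Icc (-1 : ℝ) 1) (h0 : 0 ≤ t.im)
    (h1 : t.im ≤ 19 / 20) : ‖1 - t ^ 2‖ ≤ 3 := by
  have h : ‖t‖ ^ 2 ≤ 2 := by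
    rw [Complex.sq_norm, Complex.normSq_apply]
    nlinarith [hx.1, hx.2]
  calc ‖1 - t ^ 2‖ ≤ ‖(1 : ℂ)‖ + ‖t ^ 2‖ := norm_sub_le _ _
    _ ≤ 3 := by rw [norm_pow, norm_one]; linarith

theorem norm_mulKernel_le {c : ℝ} {t : ℂ} (hx : t.re ∈ Icc (-1 : ℝ) 1)
    (h0 : 0 ≤ t.im) (h1 : t.im ≤ 19 / 20) :
    ‖mulKernel c t‖ ≤ 72000 *
      Real.exp (-(c * (t.im * (1 / Complex.normSq (1 - t) + 1 / Complex.normSq (1 + t))))) := by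
  rw [norm_mulKernel]
  gcongr
  have h2 := le_norm_one_add_sq h0 h1
  have h3 := norm_one_sub_sq_le hx h0 h1
  calc ‖1 - t ^ 2‖ ^ 2 / ‖1 + t ^ 2‖ ^ 3 ≤ 3 ^ 2 / (1 / 20) ^ 3 := by gcongr
    _ = 72000 := by norm_num

theorem norm_mulKernel_ofReal_le (c x : ℝ) (hx : x ∈ Icc (-1 : ℝ) 1) :
    ‖mulKernel c x‖ ≤ 1 := by
  rw [norm_mulKernel]
  have e1 : ‖(1 : ℂ) - (x : ℂ) ^ 2‖ = 1 - x ^ 2 := by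
    rw [← Complex.ofReal_one, ← Complex.ofReal_pow, ← Complex.ofReal_sub, Complex.norm_real,
      Real.norm_of_nonneg]
    nlinarith [hx.1, hx.2]
  have e2 : ‖(1 : ℂ) + (x : ℂ) ^ 2‖ = 1 + x ^ 2 := by
    rw [← Complex.ofReal_one, ← Complex.ofReal_pow, ← Complex.ofReal_add, Complex.norm_real,
      Real.norm_of_nonneg]
    positivity
  rw [e1, e2]
  simp only [Complex.ofReal_im, zero_mul, mul_zero, neg_zero, Real.exp_zero, mul_one]
  rw [div_le_one (by positivity)]
  have hx2 : x ^ 2 ≤ 1 := by nlinarith [hx.1, hx.2]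
  calc (1 - x ^ 2) ^ 2 ≤ 1 := by
        apply pow_le_one₀ <;> nlinarith [sq_nonneg x]
    _ ≤ (1 + x ^ 2) ^ 3 := by
        apply one_le_pow₀; nlinarith [sq_nonneg x]

theorem differentiableAt_mulKernel (c : ℝ) {t : ℂ} (h1 : 1 - t ≠ 0) (h2 : 1 + t ≠ 0)
    (h3 : 1 + t ^ 2 ≠ 0) : DifferentiableAt ℂ (mulKernel c) t := by
  unfold mulKernel
  have h4 : (1 + t ^ 2) ^ 3 ≠ 0 := pow_ne_zero _ h3
  fun_prop (disch := assumption)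

/-- The phase is singular at ±1, but for Im t ≥ 0 the exponential has modulus at most one and the
factor (1-t²)² makes the kernel tend to its value 0 there. Cauchy's theorem can thus be applied up
to these two corners. -/
theorem continuousOn_mulKernel {c : ℝ} (hc : 0 ≤ c) :
    ContinuousOn (mulKernel c) (Icc (-1 : ℝ) 1 ×ℂ Icc (0 : ℝ) (19 / 20)) := by
  intro t ht
  rw [Complex.mem_reProdIm] at ht
  obtain ⟨hx, h0, h1⟩ := ht
  have h3 := one_add_sq_ne_zero h0 h1
  by_cases h : 1 - t ^ 2 = 0
  · have hz : mulKernel c t = 0 := by simp [mulKernel, h]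
    rw [ContinuousWithinAt, hz, tendsto_zero_iff_norm_tendsto_zero]
    have hlim : Tendsto (fun s : ℂ => ‖1 - s ^ 2‖ ^ 2 / ‖1 + s ^ 2‖ ^ 3)
        (𝓝[Icc (-1 : ℝ) 1 ×ℂ Icc (0 : ℝ) (19 / 20)] t) (𝓝 0) := by
      have : ContinuousAt (fun s : ℂ => ‖1 - s ^ 2‖ ^ 2 / ‖1 + s ^ 2‖ ^ 3) t := by
        refine ContinuousAt.div (by fun_prop) (by fun_prop) (by simpa using h3)
      have h' := this.tendsto
      simp only [h, norm_zero] at h'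
      norm_num at h'
      exact h'.mono_left nhdsWithin_le_nhds
    refine squeeze_zero' (Eventually.of_forall fun _ => norm_nonneg _) ?_ hlim
    filter_upwards [self_mem_nhdsWithin] with s hs
    rw [Complex.mem_reProdIm] at hs
    rw [norm_mulKernel]
    refine mul_le_of_le_one_right (by positivity) ?_
    rw [Real.exp_le_one_iff, neg_nonpos]
    have := Complex.normSq_nonneg (1 - s)
    have := Complex.normSq_nonneg (1 + s)
    have := hs.2.1
    positivity
  · have hf : (1 - t) * (1 + t) ≠ 0 := by
      intro h'; apply h; rw [← h']; ring
    exact (differentiableAt_mulKernel c (left_ne_zero_of_mul hf) (right_ne_zero_of_mul hf)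
      h3).continuousAt.continuousWithinAt

theorem continuousOn_mulKernel_ofReal {c : ℝ} (hc : 0 ≤ c) :
    ContinuousOn (fun x : ℝ => mulKernel c x) (Icc (-1 : ℝ) 1) := by
  refine (continuousOn_mulKernel hc).comp Complex.continuous_ofReal.continuousOn ?_
  intro x hx
  rw [Complex.mem_reProdIm]
  exact ⟨by simpa using hx, by simp; norm_num⟩

/-- On the upper side of the rectangle the two poles of the phase contribute at least as much as
at the midpoint. -/
theorem le_inv_normSq_add_inv_normSq {x H : ℝ} (hx : x ∈ Icc (-1 : ℝ) 1) (hH : 0 < H)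
    (hH1 : H ≤ 1) :
    2 / (1 + H ^ 2) ≤ 1 / ((1 - x) ^ 2 + H ^ 2) + 1 / ((1 + x) ^ 2 + H ^ 2) := by
  have hx2 : x ^ 2 ≤ 1 := by nlinarith [hx.1, hx.2]
  rw [div_add_div _ _ (by positivity) (by positivity), div_le_div_iff₀ (by positivity)
    (by positivity)]
  have h2 : H ^ 2 ≤ 1 := by nlinarith
  nlinarith [mul_nonneg (sq_nonneg x) (by linarith : 0 ≤ 2 - x ^ 2 - H ^ 2)]

/-! ### Fourier transforms on [-1, 1] and the decay of the multiplier -/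

/-- The Fourier transform of a function supported in `[-1, 1]`, rescaled by `r`. -/
def fourierOn (g : ℝ → ℂ) (r : ℝ) (z : ℂ) : ℂ :=
  ∫ x in (-1 : ℝ)..1, g x * Complex.exp (-(Complex.I * z * r * x))

theorem norm_exp_neg_I_mul (z t : ℂ) (r : ℝ) :
    ‖Complex.exp (-(Complex.I * z * r * t))‖ = Real.exp (r * (z.re * t.im + z.im * t.re)) := by
  rw [Complex.norm_exp]
  congr 1
  simp only [Complex.neg_re, Complex.mul_re, Complex.mul_im, Complex.I_re, Complex.I_im,
    Complex.ofReal_re, Complex.ofReal_im]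
  ring

theorem norm_fourierOn_le {g : ℝ → ℂ} {r : ℝ} (hr : 0 ≤ r) {C : ℝ}
    (hC : ∀ x ∈ Icc (-1 : ℝ) 1, ‖g x‖ ≤ C) (z : ℂ) :
    ‖fourierOn g r z‖ ≤ 2 * C * Real.exp (r * |z.im|) := by
  have hC0 : 0 ≤ C := (norm_nonneg _).trans (hC 0 (by norm_num))
  have h := intervalIntegral.norm_integral_le_of_norm_le_const (a := (-1 : ℝ)) (b := 1)
    (f := fun x : ℝ => g x * Complex.exp (-(Complex.I * z * r * x)))
    (C := C * Real.exp (r * |z.im|)) ?_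
  · refine h.trans (le_of_eq ?_)
    norm_num; ring
  · intro x hx
    rw [uIoc_of_le (by norm_num)] at hx
    rw [norm_mul, norm_exp_neg_I_mul]
    have hx' : |x| ≤ 1 := abs_le.2 ⟨hx.1.le, hx.2⟩
    have h1 : z.im * x ≤ |z.im| := by
      calc z.im * x ≤ |z.im * x| := le_abs_self _
        _ = |z.im| * |x| := abs_mul _ _
        _ ≤ |z.im| := mul_le_of_le_one_right (abs_nonneg _) hx'
    gcongr
    · exact hC x ⟨hx.1.le, hx.2⟩
    · simpa using h1

theorem differentiable_fourierOn {g : ℝ → ℂ} (hg : ContinuousOn g (Icc (-1 : ℝ) 1)) {r : ℝ}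
    (hr : 0 ≤ r) : Differentiable ℂ (fourierOn g r) := by
  intro z₀
  obtain ⟨C, hC⟩ := isCompact_Icc.exists_bound_of_continuousOn hg
  have hC0 : 0 ≤ C := (norm_nonneg _).trans (hC 0 (by norm_num))
  have hu : uIcc (-1 : ℝ) 1 = Icc (-1 : ℝ) 1 := uIcc_of_le (by norm_num)
  have hcont : ∀ z : ℂ, ContinuousOn
      (fun x : ℝ => g x * Complex.exp (-(Complex.I * z * r * x))) (uIcc (-1 : ℝ) 1) := by
    intro z
    rw [hu]
    exact hg.mul (by fun_prop)
  have hcont' : ContinuousOn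
      (fun x : ℝ => g x * (Complex.exp (-(Complex.I * z₀ * r * x)) * (-(Complex.I * r * x))))
      (uIcc (-1 : ℝ) 1) := by
    rw [hu]
    exact hg.mul (by fun_prop)
  have meas : ∀ f : ℝ → ℂ, ContinuousOn f (uIcc (-1 : ℝ) 1) →
      AEStronglyMeasurable f (volume.restrict (uIoc (-1 : ℝ) 1)) := fun f hf =>
    (hf.mono uIoc_subset_uIcc).aestronglyMeasurable measurableSet_uIoc
  refine (intervalIntegral.hasDerivAt_integral_of_dominated_loc_of_deriv_le
    (F := fun (z : ℂ) (x : ℝ) => g x * Complex.exp (-(Complex.I * z * r * x)))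
    (F' := fun (z : ℂ) (x : ℝ) =>
      g x * (Complex.exp (-(Complex.I * z * r * x)) * (-(Complex.I * r * x))))
    (bound := fun _ => C * (Real.exp (r * (|z₀.im| + 1)) * r))
    (s := Metric.ball z₀ 1) (Metric.ball_mem_nhds _ one_pos) ?_ ?_ ?_ ?_ ?_ ?_).2.differentiableAt
  · exact Eventually.of_forall fun z => meas _ (hcont z)
  · exact (hcont z₀).intervalIntegrable
  · exact meas _ hcont'
  · refine Eventually.of_forall fun x hx z hz => ?_
    rw [uIoc_of_le (by norm_num)] at hx
    have hx' : |x| ≤ 1 := abs_le.2 ⟨hx.1.le, hx.2⟩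
    have hzim : |z.im| ≤ |z₀.im| + 1 := by
      have h1 : |(z - z₀).im| ≤ 1 := (Complex.abs_im_le_norm _).trans
        (by rw [← dist_eq_norm]; exact (Metric.mem_ball.1 hz).le)
      rw [Complex.sub_im] at h1
      have := abs_sub_abs_le_abs_sub z.im z₀.im
      linarith
    have h1 : z.im * x ≤ |z₀.im| + 1 := by
      calc z.im * x ≤ |z.im * x| := le_abs_self _
        _ = |z.im| * |x| := abs_mul _ _
        _ ≤ |z.im| := mul_le_of_le_one_right (abs_nonneg _) hx'
        _ ≤ _ := hzim
    rw [norm_mul, norm_mul, norm_exp_neg_I_mul]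
    have h2 : ‖-(Complex.I * r * x)‖ ≤ r := by
      rw [norm_neg, norm_mul, norm_mul, Complex.norm_I, one_mul, Complex.norm_real,
        Complex.norm_real, Real.norm_of_nonneg hr, Real.norm_eq_abs]
      exact mul_le_of_le_one_right hr hx'
    have h3 : z.re * (x : ℂ).im + z.im * (x : ℂ).re ≤ |z₀.im| + 1 := by simpa using h1
    exact mul_le_mul (hC x ⟨hx.1.le, hx.2⟩) (mul_le_mul (Real.exp_le_exp.2
      (mul_le_mul_of_nonneg_left h3 hr)) h2 (norm_nonneg _) (Real.exp_nonneg _))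
      (by positivity) hC0
  · exact intervalIntegrable_const
  · refine Eventually.of_forall fun x _ z _ => ?_
    have h1 : HasDerivAt (fun z : ℂ => -(Complex.I * z * r * x)) (-(Complex.I * r * x)) z := by
      have := ((((hasDerivAt_id z).const_mul Complex.I).mul_const (r : ℂ)).mul_const (x : ℂ)).neg
      simpa only [id, mul_one] using! this
    exact h1.cexp.const_mul _

/-- The multiplier: entire of exponential type `r`, bounded on the positive half line, and decaying
like `exp (-2 √(c r |s|))` on the negative one. -/
def multiplier (c r : ℝ) : ℂ → ℂ := fourierOn (fun x => mulKernel c x) r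

/-- The arithmetic–geometric mean inequality. It makes the estimate on the vertical sides of the
contour uniform in the height v. -/
theorem two_mul_sqrt_le {a c v : ℝ} (ha : 0 ≤ a) (hc : 0 ≤ c) (hv : 0 < v) :
    2 * √(c * a) ≤ a * v + c / v := by
  have h : √(c * a) ≤ (a * v + c / v) / 2 := by
    rw [Real.sqrt_le_left (by positivity)]
    have e : c * a = (a * v) * (c / v) := by field_simp
    rw [e]
    nlinarith [sq_nonneg (a * v - c / v)]
  linarith

theorem norm_mulKernel_mul_exp_le {c r : ℝ} {t z : ℂ} (hx : t.re ∈ Icc (-1 : ℝ) 1)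
    (h0 : 0 ≤ t.im) (h1 : t.im ≤ 19 / 20) (hr : 0 ≤ r) {E : ℝ}
    (hE : E ≤ r * -z.re * t.im +
      c * (t.im * (1 / Complex.normSq (1 - t) + 1 / Complex.normSq (1 + t)))) :
    ‖mulKernel c t * Complex.exp (-(Complex.I * z * r * t))‖ ≤
      72000 * (Real.exp (r * |z.im|) * Real.exp (-E)) := by
  rw [norm_mul, norm_exp_neg_I_mul]
  refine (mul_le_mul_of_nonneg_right (norm_mulKernel_le hx h0 h1) (Real.exp_nonneg _)).trans ?_
  rw [mul_assoc, ← Real.exp_add, ← Real.exp_add]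
  have hz : z.im * t.re ≤ |z.im| := by
    calc z.im * t.re ≤ |z.im * t.re| := le_abs_self _
      _ = |z.im| * |t.re| := abs_mul _ _
      _ ≤ |z.im| := mul_le_of_le_one_right (abs_nonneg _) (abs_le.2 hx)
  have := mul_le_mul_of_nonneg_left hz hr
  refine mul_le_mul_of_nonneg_left (Real.exp_le_exp.2 ?_) (by norm_num)
  linarith

/-- For Re z ≤ 0 the factor exp(-izrt) does not grow with Im t, apart from exp(r|Im z|), so [-1, 1]
is replaced by the three other sides of the rectangle of height 19/20. On these, the decay r|Re z|
Im t and the decay of the kernel add up to at least 2√(cr|Re z|) - 27c/500. The sides have total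
length at most 4, whence 288000 = 4 · 72000. -/
theorem norm_multiplier_le_of_re_nonpos {c r : ℝ} (hc : 0 ≤ c) (hr : 0 ≤ r) {z : ℂ}
    (hz : z.re ≤ 0) :
    ‖multiplier c r z‖ ≤ 288000 * (Real.exp (r * |z.im|) *
      Real.exp (-(2 * √(c * (r * -z.re)) - 27 / 500 * c))) := by
  set F : ℂ → ℂ := fun t => mulKernel c t * Complex.exp (-(Complex.I * z * r * t)) with hF
  set E : ℝ := 2 * √(c * (r * -z.re)) - 27 / 500 * c with hEdef
  set B : ℝ := 72000 * (Real.exp (r * |z.im|) * Real.exp (-E)) with hB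
  have hB0 : 0 ≤ B := by positivity
  have hσ : 0 ≤ r * -z.re := mul_nonneg hr (by linarith)
  have key := Complex.integral_boundary_rect_eq_zero_of_continuousOn_of_differentiableOn F
    (-1 : ℂ) (⟨1, 19 / 20⟩ : ℂ) ?_ ?_
  rotate_left
  · have e1 : uIcc (-1 : ℂ).re (⟨1, 19 / 20⟩ : ℂ).re = Icc (-1 : ℝ) 1 := by
      simp only [Complex.neg_re, Complex.one_re]; exact uIcc_of_le (by norm_num)
    have e2 : uIcc (-1 : ℂ).im (⟨1, 19 / 20⟩ : ℂ).im = Icc (0 : ℝ) (19 / 20) := by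
      simp only [Complex.neg_im, Complex.one_im, neg_zero]; exact uIcc_of_le (by norm_num)
    rw [e1, e2]
    exact (continuousOn_mulKernel hc).mul (by fun_prop)
  · intro t ht
    rw [Complex.mem_reProdIm] at ht
    simp only [Complex.neg_re, Complex.one_re, Complex.neg_im, Complex.one_im, neg_zero] at ht
    rw [min_eq_left (by norm_num), max_eq_right (by norm_num), min_eq_left (by norm_num),
      max_eq_right (by norm_num)] at ht
    obtain ⟨⟨hx1, hx2⟩, h0, h1⟩ := ht
    have d1 : 1 - t ≠ 0 := fun h => by
      have := congrArg Complex.re h; simp at this; linarith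
    have d2 : 1 + t ≠ 0 := fun h => by
      have := congrArg Complex.re h; simp at this; linarith
    refine ((differentiableAt_mulKernel c d1 d2 (one_add_sq_ne_zero h0.le h1.le)).mul
      (by fun_prop)).differentiableWithinAt
  have hside : ∀ a : ℝ, a ^ 2 = 1 → ‖∫ y in (0 : ℝ)..(19 / 20), F (a + y * Complex.I)‖ ≤ B := by
    intro a ha
    have ha' : a ∈ Icc (-1 : ℝ) 1 := by constructor <;> nlinarith
    have := intervalIntegral.norm_integral_le_of_norm_le_const (a := (0 : ℝ)) (b := 19 / 20)
      (f := fun y : ℝ => F (a + y * Complex.I)) (C := B) ?_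
    · refine this.trans ?_
      norm_num
      linarith
    intro y hy
    rw [uIoc_of_le (by norm_num)] at hy
    refine norm_mulKernel_mul_exp_le (by simpa using ha') (by simpa using hy.1.le)
      (by simpa using hy.2) hr ?_
    have h2 := two_mul_sqrt_le hσ hc hy.1
    simp only [Complex.normSq_apply, Complex.add_re, Complex.add_im, Complex.sub_re,
      Complex.sub_im, Complex.one_re, Complex.one_im, Complex.ofReal_re, Complex.ofReal_im,
      Complex.mul_re, Complex.mul_im, Complex.I_re, Complex.I_im]
    -- On a vertical side the pole at its foot alone contributes c / y.
    have h3 : c / y ≤ c * (y * (1 / ((1 - a) * (1 - a) + y * y) +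
        1 / ((1 + a) * (1 + a) + y * y))) := by
      have hy0 := hy.1
      have e : c / y = c * (y * (1 / (y * y))) := by field_simp
      rw [e]
      refine mul_le_mul_of_nonneg_left (mul_le_mul_of_nonneg_left ?_ hy.1.le) hc
      have : (a - 1) * (a + 1) = 0 := by linarith
      rcases mul_eq_zero.1 this with h | h
      · rw [show 1 - a = 0 by linarith]
        have : 0 ≤ 1 / ((1 + a) * (1 + a) + y * y) :=
          one_div_nonneg.2 (add_nonneg (mul_self_nonneg _) (mul_self_nonneg _))
        simpa using this
      · rw [show 1 + a = 0 by linarith]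
        have : 0 ≤ 1 / ((1 - a) * (1 - a) + y * y) :=
          one_div_nonneg.2 (add_nonneg (mul_self_nonneg _) (mul_self_nonneg _))
        simpa using this
    rw [hEdef]
    simp only [mul_zero, mul_one, add_zero, zero_sub, zero_add, sub_zero, neg_mul_neg]
    linarith
  have htop : ‖∫ x in (-1 : ℝ)..1, F (x + (19 / 20 : ℝ) * Complex.I)‖ ≤ 2 * B := by
    have := intervalIntegral.norm_integral_le_of_norm_le_const (a := (-1 : ℝ)) (b := 1)
      (f := fun x : ℝ => F (x + (19 / 20 : ℝ) * Complex.I)) (C := B) ?_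
    · refine this.trans ?_
      norm_num
      linarith
    intro x hx
    rw [uIoc_of_le (by norm_num)] at hx
    have hx' : x ∈ Icc (-1 : ℝ) 1 := ⟨hx.1.le, hx.2⟩
    have him : ((x : ℂ) + (19 / 20 : ℝ) * Complex.I).im = 19 / 20 := by
      simp only [Complex.add_im, Complex.ofReal_im, Complex.mul_im, Complex.ofReal_re,
        Complex.I_im, Complex.I_re]
      norm_num
    have hre : ((x : ℂ) + (19 / 20 : ℝ) * Complex.I).re = x := by
      simp only [Complex.add_re, Complex.ofReal_im, Complex.mul_re, Complex.ofReal_re,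
        Complex.I_im, Complex.I_re]
      norm_num
    refine norm_mulKernel_mul_exp_le (by rw [hre]; exact hx') (by rw [him]; norm_num)
      (by rw [him]) hr ?_
    have h2 := two_mul_sqrt_le hσ hc (show (0 : ℝ) < 19 / 20 by norm_num)
    -- At height H = 19/20 the two poles contribute at least 2cH/(1+H²). This falls short of the c/H
    -- required by `h2` by 0.0539… c, less than 27c/500.
    have h3 := le_inv_normSq_add_inv_normSq hx' (show (0 : ℝ) < 19 / 20 by norm_num) (by norm_num)
    generalize (x : ℂ) + (19 / 20 : ℝ) * Complex.I = t at him hre ⊢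
    rw [him, Complex.normSq_apply, Complex.normSq_apply, Complex.sub_re, Complex.sub_im,
      Complex.add_re, Complex.add_im, him, hre, Complex.one_re, Complex.one_im, zero_sub, zero_add,
      neg_mul_neg]
    have h4 := mul_le_mul_of_nonneg_left h3 hc
    norm_num at h2 h4 ⊢
    simp only [← sq] at h4 ⊢
    rw [hEdef]
    norm_num
    linarith
  have e0 : multiplier c r z = ∫ x in (-1 : ℝ)..1, F (x + (0 : ℝ) * Complex.I) := by
    simp [multiplier, fourierOn, hF]
  have h1 := hside 1 (by norm_num)
  have h2 := hside (-1) (by norm_num)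
  simp only [Complex.neg_re, Complex.one_re, Complex.neg_im, Complex.one_im, neg_zero] at key
  rw [← e0] at key
  have e : multiplier c r z = (∫ x in (-1 : ℝ)..1, F (x + (19 / 20 : ℝ) * Complex.I)) -
      Complex.I • (∫ y in (0 : ℝ)..(19 / 20), F ((1 : ℝ) + y * Complex.I)) +
      Complex.I • (∫ y in (0 : ℝ)..(19 / 20), F ((-1 : ℝ) + y * Complex.I)) := by
    linear_combination key
  rw [e]
  refine (norm_add_le _ _).trans ((add_le_add_left (norm_sub_le _ _) _).trans ?_)
  rw [norm_smul, norm_smul, Complex.norm_I, one_mul, one_mul]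
  calc _ ≤ 2 * B + B + B := by gcongr
    _ = _ := by rw [hB]; ring

/-! ### The value of the multiplier at the origin -/

open scoped FourierTransform
open Real in
theorem integrableOn_one_add_mul_exp_neg :
    IntegrableOn (fun x : ℝ => (1 + 2 * π * x) * Real.exp (-(2 * π * x))) (Ioi 0) := by
  have hpi := Real.pi_pos
  have hd : ∀ x : ℝ, HasDerivAt (fun x : ℝ => -((1 / π + x) * Real.exp (-(2 * π * x))))
      ((1 + 2 * π * x) * Real.exp (-(2 * π * x))) x := by
    intro x
    have h1 : HasDerivAt (fun x : ℝ => -(2 * π * x)) (-(2 * π * 1)) x :=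
      ((hasDerivAt_id x).const_mul (2 * π)).neg
    have h2 : HasDerivAt (fun x : ℝ => 1 / π + x) 1 x := (hasDerivAt_id x).const_add _
    convert! (h2.mul h1.exp).neg using 1
    field_simp
    ring
  refine integrableOn_Ioi_deriv_of_nonneg' (l := 0) (fun x _ => hd x) (fun x hx => ?_) ?_
  · have : (0 : ℝ) < x := hx
    positivity
  · have h1 : Tendsto (fun x : ℝ => Real.exp (-(2 * π * x))) atTop (𝓝 0) := by
      refine Real.tendsto_exp_neg_atTop_nhds_zero.comp ?_
      exact tendsto_id.const_mul_atTop (by positivity)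
    have h2 : Tendsto (fun x : ℝ => x * Real.exp (-(2 * π * x))) atTop (𝓝 0) := by
      have := (Real.tendsto_pow_mul_exp_neg_atTop_nhds_zero 1).comp
        (tendsto_id.const_mul_atTop (show 0 < 2 * π by positivity))
      have h3 := this.const_mul (1 / (2 * π))
      rw [mul_zero] at h3
      refine h3.congr fun x => ?_
      simp only [Function.comp, id, pow_one]
      field_simp
    have h3 := ((h1.const_mul (1 / π)).add h2).neg
    simp only [mul_zero, add_zero, neg_zero] at h3
    refine h3.congr fun x => ?_
    ring

-- One half of the Fourier transform of (1 + 2π|x|) exp(-2π|x|), by an explicit primitive. Adding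
-- the half with -ξ gives (2/π)(1+ξ²)⁻², which Fourier inversion then turns around.
open Real in
theorem integral_Ioi_one_add_mul_exp_neg (ξ : ℝ) :
    ∫ x in Ioi (0 : ℝ), Complex.exp (↑(-2 * π * x * ξ) * Complex.I) *
      ((1 + 2 * π * x) * Real.exp (-(2 * π * x)) : ℝ) =
      1 / (2 * π) * (1 / (1 + Complex.I * ξ) + 1 / (1 + Complex.I * ξ) ^ 2) := by
  have hpi := Real.pi_pos
  have hpi' : (π : ℂ) ≠ 0 := by exact_mod_cast hpi.ne'
  set z : ℂ := 1 + Complex.I * ξ with hz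
  have hz0 : z ≠ 0 := by
    intro h
    have := congrArg Complex.re h
    simp [hz] at this
  have e : ∀ x : ℝ, Complex.exp (↑(-2 * π * x * ξ) * Complex.I) *
      ((1 + 2 * π * x) * Real.exp (-(2 * π * x)) : ℝ) =
      (1 + 2 * π * x) * Complex.exp (-(2 * π * z * x)) := by
    intro x
    push_cast
    rw [mul_left_comm, ← Complex.exp_add]
    congr 2
    rw [hz]; ring
  have hn : ∀ x : ℝ, ‖Complex.exp (↑(-2 * π * x * ξ) * Complex.I) *
      ((1 + 2 * π * x) * Real.exp (-(2 * π * x)) : ℝ)‖ =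
      ‖(1 + 2 * π * x) * Real.exp (-(2 * π * x))‖ := by
    intro x
    rw [norm_mul, Complex.norm_exp_ofReal_mul_I, one_mul, Complex.norm_real]
  have hd : ∀ x : ℝ, HasDerivAt
      (fun x : ℝ => -((1 / (2 * π * z) + 1 / (2 * π * z ^ 2) + x / z) *
        Complex.exp (-(2 * π * z * x))))
      (Complex.exp (↑(-2 * π * x * ξ) * Complex.I) *
        ((1 + 2 * π * x) * Real.exp (-(2 * π * x)) : ℝ)) x := by
    intro x
    rw [e]
    have h0 : HasDerivAt (fun x : ℝ => (x : ℂ)) 1 x := Complex.ofRealCLM.hasDerivAt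
    have h1 : HasDerivAt (fun x : ℝ => -(2 * π * z * (x : ℂ))) (-(2 * π * z * 1)) x :=
      (h0.const_mul (2 * π * z)).neg
    have h2 : HasDerivAt (fun x : ℝ => 1 / (2 * π * z) + 1 / (2 * π * z ^ 2) + (x : ℂ) / z)
      (1 / z) x := (h0.div_const z).const_add _
    convert! (h2.mul h1.cexp).neg using 1
    field_simp
    ring
  have key := integral_Ioi_of_hasDerivAt_of_tendsto' (a := (0 : ℝ)) (m := 0)
    (fun x _ => hd x) ?_ ?_
  · rw [key]
    simp only [Complex.ofReal_zero, mul_zero, neg_zero, Complex.exp_zero, zero_div, add_zero,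
      mul_one, zero_sub, neg_neg]
    field_simp
  · refine (integrableOn_one_add_mul_exp_neg).mono' ?_ ?_
    · exact Continuous.aestronglyMeasurable (by fun_prop)
    · refine (ae_restrict_iff' measurableSet_Ioi).2 (Eventually.of_forall fun x hx => ?_)
      have : (0 : ℝ) < x := hx
      rw [hn, Real.norm_of_nonneg (by positivity)]
  · rw [tendsto_zero_iff_norm_tendsto_zero]
    have h1 : Tendsto (fun x : ℝ => Real.exp (-(2 * π * x))) atTop (𝓝 0) := by
      refine Real.tendsto_exp_neg_atTop_nhds_zero.comp ?_
      exact tendsto_id.const_mul_atTop (by positivity)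
    have h2 : Tendsto (fun x : ℝ => x * Real.exp (-(2 * π * x))) atTop (𝓝 0) := by
      have := (Real.tendsto_pow_mul_exp_neg_atTop_nhds_zero 1).comp
        (tendsto_id.const_mul_atTop (show 0 < 2 * π by positivity))
      have h3 := this.const_mul (1 / (2 * π))
      rw [mul_zero] at h3
      refine h3.congr fun x => ?_
      simp only [Function.comp, id, pow_one]
      field_simp
    have h3 := (h1.const_mul ‖1 / (2 * π * z) + 1 / (2 * π * z ^ 2)‖).add (h2.div_const ‖z‖)
    simp only [mul_zero, zero_add, zero_div] at h3
    refine squeeze_zero' (Eventually.of_forall fun _ => norm_nonneg _) ?_ h3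
    filter_upwards [eventually_ge_atTop 0] with x hx
    rw [norm_neg, norm_mul]
    have hre : ‖Complex.exp (-(2 * π * z * x))‖ = Real.exp (-(2 * π * x)) := by
      rw [Complex.norm_exp]
      congr 1
      simp [hz]
    rw [hre, mul_div_right_comm, ← add_mul]
    refine mul_le_mul_of_nonneg_right ((norm_add_le _ _).trans ?_) (Real.exp_nonneg _)
    rw [norm_div (x : ℂ), Complex.norm_real, Real.norm_of_nonneg hx]

open Real in
/-- The Fourier transform of `(1 + c |x|) exp (-c |x|)`, in inverted form. -/
theorem integral_exp_mul_inv_one_add_sq_sq {c : ℝ} (hc : 0 ≤ c) :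
    ∫ w : ℝ, Complex.exp (Complex.I * c * w) * (((1 + w ^ 2) ^ 2)⁻¹ : ℝ) =
      (π / 2 * ((1 + c) * Real.exp (-c)) : ℝ) := by
  have hpi := Real.pi_pos
  set p : ℝ → ℝ := fun x => (1 + 2 * π * x) * Real.exp (-(2 * π * x)) with hp
  set q : ℝ → ℂ := fun x => (p |x| : ℂ) with hq
  have hqc : Continuous q := by
    rw [hq, hp]; fun_prop
  have hqi : Integrable q := by
    have h1 : IntegrableOn (fun x : ℝ => p |x|) (Ioi 0) :=
      integrableOn_one_add_mul_exp_neg.congr_fun (fun x hx => by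
        rw [abs_of_pos (show (0 : ℝ) < x from hx)]) measurableSet_Ioi
    have h2 : IntegrableOn (fun x : ℝ => p |x|) (Iic 0) := by
      rw [← Measure.map_neg_eq_self (volume : Measure ℝ)]
      have m : MeasurableEmbedding fun x : ℝ => -x := (Homeomorph.neg ℝ).measurableEmbedding
      rw [m.integrableOn_map_iff]
      simp only [Function.comp_def, abs_neg, neg_preimage, neg_Iic, neg_zero]
      exact Iff.mpr integrableOn_Ici_iff_integrableOn_Ioi h1
    have : Integrable (fun x : ℝ => p |x|) := by
      rw [← integrableOn_univ, ← Iic_union_Ioi (a := (0 : ℝ))]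
      exact h2.union h1
    exact this.ofReal
  have hF : ∀ ξ : ℝ, 𝓕 q ξ = ((2 / π * ((1 + ξ ^ 2) ^ 2)⁻¹ : ℝ) : ℂ) := by
    intro ξ
    rw [Real.fourier_real_eq_integral_exp_smul]
    simp only [smul_eq_mul]
    have hint : Integrable (fun v : ℝ => Complex.exp (↑(-2 * π * v * ξ) * Complex.I) * q v) := by
      refine hqi.norm.mono' (by fun_prop) (Eventually.of_forall fun v => ?_)
      rw [norm_mul, Complex.norm_exp_ofReal_mul_I, one_mul]
    rw [← intervalIntegral.integral_Iic_add_Ioi (b := 0) hint.integrableOn hint.integrableOn]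
    have h1 : ∫ v in Ioi (0 : ℝ), Complex.exp (↑(-2 * π * v * ξ) * Complex.I) * q v =
        1 / (2 * π) * (1 / (1 + Complex.I * ξ) + 1 / (1 + Complex.I * ξ) ^ 2) := by
      rw [← integral_Ioi_one_add_mul_exp_neg]
      refine setIntegral_congr_fun measurableSet_Ioi fun v hv => ?_
      simp only [hq, hp, abs_of_pos (show (0 : ℝ) < v from hv)]
    have h2 : ∫ v in Iic (0 : ℝ), Complex.exp (↑(-2 * π * v * ξ) * Complex.I) * q v =
        1 / (2 * π) * (1 / (1 + Complex.I * (-ξ : ℝ)) + 1 / (1 + Complex.I * (-ξ : ℝ)) ^ 2) := by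
      rw [← integral_Ioi_one_add_mul_exp_neg]
      have := integral_comp_neg_Iic (0 : ℝ) (fun v : ℝ =>
        Complex.exp (↑(-2 * π * v * -ξ) * Complex.I) *
          (((1 + 2 * π * v) * Real.exp (-(2 * π * v)) : ℝ) : ℂ))
      rw [neg_zero] at this
      rw [← this]
      refine setIntegral_congr_fun measurableSet_Iic fun v hv => ?_
      simp only [hq, hp, abs_of_nonpos (show v ≤ (0 : ℝ) from hv)]
      congr 3
      ring_nf
    rw [h1, h2]
    have n1 : (1 : ℂ) + Complex.I * ξ ≠ 0 := fun h => by
      have := congrArg Complex.re h; simp at this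
    have n2 : (1 : ℂ) + Complex.I * (-ξ : ℝ) ≠ 0 := fun h => by
      have := congrArg Complex.re h; simp at this
    have n3 : (1 : ℂ) + (ξ : ℂ) ^ 2 ≠ 0 := by
      have : (0 : ℝ) < 1 + ξ ^ 2 := by positivity
      exact_mod_cast this.ne'
    have n4 : (π : ℂ) ≠ 0 := by exact_mod_cast hpi.ne'
    have e3 : (1 + Complex.I * ξ) * (1 + Complex.I * (-ξ : ℝ)) = 1 + (ξ : ℂ) ^ 2 := by
      push_cast
      linear_combination (-(ξ : ℂ) ^ 2) * Complex.I_sq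
    push_cast at n2 e3 ⊢
    rw [← e3] at n3 ⊢
    have e4 : (1 + Complex.I * (ξ : ℂ)) = 2 - (1 + Complex.I * -(ξ : ℂ)) := by ring
    rw [e4] at n1 ⊢
    generalize 1 + Complex.I * -(ξ : ℂ) = Y at n1 n2 ⊢
    field_simp
    ring
  have hFi : Integrable (𝓕 q) := by
    have h := (integrable_inv_one_add_sq).const_mul (2 / π)
    have e : 𝓕 q = fun ξ : ℝ => ((2 / π * ((1 + ξ ^ 2) ^ 2)⁻¹ : ℝ) : ℂ) := funext hF
    rw [e]
    have h' : Integrable (fun ξ : ℝ => 2 / π * ((1 + ξ ^ 2) ^ 2)⁻¹) := by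
      refine h.mono' ?_ (Eventually.of_forall fun ξ => ?_)
      · refine Continuous.aestronglyMeasurable (continuous_const.mul ?_)
        exact Continuous.inv₀ (by fun_prop) fun x => by positivity
      · rw [Real.norm_of_nonneg (by positivity)]
        gcongr
        nlinarith [sq_nonneg ξ]
    exact h'.ofReal
  have key := congrFun (hqc.fourierInv_fourier_eq hqi hFi) (c / (2 * π))
  rw [Real.fourierInv_eq'] at key
  have e : (fun v : ℝ => Complex.exp (↑(2 * π * inner ℝ v (c / (2 * π))) * Complex.I) • 𝓕 q v) =
      fun v : ℝ => (2 / π : ℂ) * (Complex.exp (Complex.I * c * v) * (((1 + v ^ 2) ^ 2)⁻¹ : ℝ)) := by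
    funext v
    rw [hF, smul_eq_mul]
    have e1 : (↑(2 * π * inner ℝ v (c / (2 * π))) : ℂ) * Complex.I = Complex.I * c * v := by
      have : 2 * π * inner ℝ v (c / (2 * π)) = c * v := by
        rw [RCLike.inner_apply]; simp; field_simp
      rw [this]; push_cast; ring
    rw [e1]
    push_cast
    ring
  rw [e, integral_const_mul] at key
  have n4 : (π : ℂ) ≠ 0 := by exact_mod_cast hpi.ne'
  have e5 : q (c / (2 * π)) = ((1 + c) * Real.exp (-c) : ℝ) := by
    simp only [hq, hp]
    rw [abs_of_nonneg (by positivity)]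
    congr 3 <;> field_simp
  rw [e5] at key
  have : ∀ A B : ℂ, 2 / (π : ℂ) * A = B → A = π / 2 * B := by
    intro A B h
    rw [← h]; field_simp
  rw [this _ _ key]
  push_cast
  ring

theorem hasDerivAt_inv_sub_inv {t : ℝ} (ht : t ∈ Ioo (-1 : ℝ) 1) :
    HasDerivAt (fun t : ℝ => (1 - t)⁻¹ - (1 + t)⁻¹) (1 / (1 - t) ^ 2 + 1 / (1 + t) ^ 2) t := by
  have h1 : 1 - t ≠ 0 := by linarith [ht.2]
  have h2 : 1 + t ≠ 0 := by linarith [ht.1]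
  have d1 := (((hasDerivAt_id t).const_sub 1).inv h1)
  have d2 := (((hasDerivAt_id t).const_add 1).inv h2)
  convert! d1.sub d2 using 1
  simp only [id]
  ring

-- The map w = 1/(1-t) - 1/(1+t) = 2t/(1-t²) sends (-1, 1) onto ℝ, and the rational factor of
-- `mulKernel` is chosen so that twice the kernel times dt becomes exp(icw)(1+w²)⁻² dw. The
-- resulting size exp(-c) is the main price of the multiplier.
open Real in
theorem multiplier_zero {c : ℝ} (hc : 0 ≤ c) (r : ℝ) :
    multiplier c r 0 = (π / 4 * ((1 + c) * Real.exp (-c)) : ℝ) := by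
  have hinj : InjOn (fun t : ℝ => (1 - t)⁻¹ - (1 + t)⁻¹) (Ioo (-1 : ℝ) 1) := by
    refine StrictMonoOn.injOn (strictMonoOn_of_deriv_pos (convex_Ioo _ _) ?_ ?_)
    · exact fun t ht => (hasDerivAt_inv_sub_inv ht).continuousAt.continuousWithinAt
    · intro t ht
      rw [interior_Ioo] at ht
      rw [(hasDerivAt_inv_sub_inv ht).deriv]
      have h1 : 0 < 1 - t := by linarith [ht.2]
      have h2 : 0 < 1 + t := by linarith [ht.1]
      positivity
  have himg : (fun t : ℝ => (1 - t)⁻¹ - (1 + t)⁻¹) '' Ioo (-1 : ℝ) 1 = univ := by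
    refine eq_univ_of_forall fun w => ?_
    have hs : √(1 + w ^ 2) ^ 2 = 1 + w ^ 2 := Real.sq_sqrt (by positivity)
    have hs1 : |w| < √(1 + w ^ 2) := by
      rw [← Real.sqrt_sq_eq_abs]
      exact Real.sqrt_lt_sqrt (sq_nonneg _) (by linarith)
    have hs0 : 0 < √(1 + w ^ 2) := (abs_nonneg _).trans_lt hs1
    set s := √(1 + w ^ 2)
    have h1 := neg_abs_le w
    have h2 := le_abs_self w
    have h3 : 0 < 1 + s - w := by linarith
    have h4 : 0 < 1 + s + w := by linarith
    -- The root in (-1, 1) of wt² + 2t - w = 0.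
    refine ⟨w / (1 + s), ⟨?_, ?_⟩, ?_⟩
    · rw [lt_div_iff₀ (by positivity)]; linarith
    · rw [div_lt_one (by positivity)]; linarith
    · have e1 : 1 - w / (1 + s) = (1 + s - w) / (1 + s) := by field_simp
      have e2 : 1 + w / (1 + s) = (1 + s + w) / (1 + s) := by field_simp
      simp only [e1, e2, inv_div]
      rw [div_sub_div _ _ h3.ne' h4.ne', div_eq_iff (by positivity)]
      linear_combination -w * hs
  have hcv := integral_image_eq_integral_abs_deriv_smul measurableSet_Ioo
    (fun t ht => (hasDerivAt_inv_sub_inv ht).hasDerivWithinAt) hinj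
    (fun w : ℝ => Complex.exp (Complex.I * c * w) * (((1 + w ^ 2) ^ 2)⁻¹ : ℝ))
  rw [himg, setIntegral_univ, integral_exp_mul_inv_one_add_sq_sq hc] at hcv
  have e : multiplier c r 0 = ∫ x in Ioo (-1 : ℝ) 1, mulKernel c x := by
    rw [multiplier, fourierOn, intervalIntegral.integral_of_le (by norm_num),
      integral_Ioc_eq_integral_Ioo]
    simp
  have e2 : ∫ t in Ioo (-1 : ℝ) 1, |1 / (1 - t) ^ 2 + 1 / (1 + t) ^ 2| •
      (Complex.exp (Complex.I * c * ((1 - t)⁻¹ - (1 + t)⁻¹ : ℝ)) *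
        (((1 + ((1 - t)⁻¹ - (1 + t)⁻¹) ^ 2) ^ 2)⁻¹ : ℝ)) =
      ∫ t in Ioo (-1 : ℝ) 1, 2 * mulKernel c t := by
    refine setIntegral_congr_fun measurableSet_Ioo fun t ht => ?_
    have h1 : 0 < 1 - t := by linarith [ht.2]
    have h2 : 0 < 1 + t := by linarith [ht.1]
    simp only [Complex.real_smul]
    rw [mulKernel, abs_of_pos (by positivity)]
    push_cast
    have h3 : (1 / (1 - t) ^ 2 + 1 / (1 + t) ^ 2) * ((1 + ((1 - t)⁻¹ - (1 + t)⁻¹) ^ 2) ^ 2)⁻¹ =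
        2 * ((1 - t ^ 2) ^ 2 / (1 + t ^ 2) ^ 3) := by
      have e3 : (1 + ((1 - t)⁻¹ - (1 + t)⁻¹) ^ 2) = (1 + t ^ 2) ^ 2 / (1 - t ^ 2) ^ 2 := by
        have : 1 - t ^ 2 ≠ 0 := by nlinarith
        field_simp
        ring
      have e4 : 1 / (1 - t) ^ 2 + 1 / (1 + t) ^ 2 = 2 * (1 + t ^ 2) / (1 - t ^ 2) ^ 2 := by
        have : 1 - t ^ 2 ≠ 0 := by nlinarith
        field_simp
        ring
      have : 1 - t ^ 2 ≠ 0 := by nlinarith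
      rw [e3, e4]
      field_simp
    have h3' := congrArg (fun x : ℝ => (x : ℂ)) h3
    push_cast at h3'
    linear_combination (Complex.exp (Complex.I * c * ((1 - (t : ℂ))⁻¹ - (1 + (t : ℂ))⁻¹))) * h3'
  rw [e2, integral_const_mul, ← e] at hcv
  have : ∀ A B : ℂ, B = 2 * A → A = B / 2 := by
    intro A B h; rw [h]; ring
  rw [this _ _ hcv]
  push_cast
  ring

/-! ### The entire functions sin(y√z)/√z and sin(δz)/(δz) -/

open scoped Nat in
/-- The entire function `z ↦ sin (y √z) / √z`. -/
def sinSqrt (y : ℝ) (z : ℂ) : ℂ :=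
  ∑' j : ℕ, (-1) ^ j * (y : ℂ) ^ (2 * j + 1) * z ^ j / ((2 * j + 1)! : ℂ)

open scoped Nat in
theorem differentiable_sinSqrt (y : ℝ) : Differentiable ℂ (sinSqrt y) := by
  intro z
  have h := Complex.differentiableOn_tsum_of_summable_norm (U := Metric.ball (0 : ℂ) (‖z‖ + 1))
    (F := fun (j : ℕ) (z : ℂ) => (-1) ^ j * (y : ℂ) ^ (2 * j + 1) * z ^ j / ((2 * j + 1)! : ℂ))
    (u := fun j => |y| * ((y ^ 2 * (‖z‖ + 1)) ^ j / (j ! : ℝ)))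
    ((Real.summable_pow_div_factorial _).mul_left _) (fun j => by fun_prop)
    Metric.isOpen_ball (fun j w hw => ?_)
  · exact h.differentiableAt (Metric.isOpen_ball.mem_nhds (by simp))
  · rw [mem_ball_zero_iff] at hw
    rw [norm_div, norm_mul, norm_mul, norm_pow, norm_neg, norm_one, one_pow, one_mul, norm_pow,
      norm_pow, Complex.norm_real, Real.norm_eq_abs, Complex.norm_natCast, mul_pow, ← sq_abs y,
      ← pow_mul, ← mul_div_assoc, ← mul_assoc, ← pow_succ']
    gcongr
    omega

open scoped Nat in
theorem sinSqrt_sq_mul (y : ℝ) (w : ℂ) : sinSqrt y (w ^ 2) * w = Complex.sin (y * w) := by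
  rw [← (Complex.hasSum_sin (y * w)).tsum_eq, sinSqrt, ← tsum_mul_right]
  refine tsum_congr fun j => ?_
  rw [mul_pow, ← pow_mul]
  ring

theorem sinSqrt_zero (y : ℝ) : sinSqrt y 0 = y := by
  rw [sinSqrt, tsum_eq_single 0]
  · simp
  · intro j hj
    simp [hj]

theorem norm_exp_I_mul_le (z : ℂ) : ‖Complex.exp (z * Complex.I)‖ ≤ Real.exp |z.im| := by
  rw [Complex.norm_exp]
  simpa using neg_le_abs z.im

theorem norm_exp_neg_mul_I_le (z : ℂ) : ‖Complex.exp (-z * Complex.I)‖ ≤ Real.exp |z.im| := by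
  simpa using norm_exp_I_mul_le (-z)

theorem norm_cos_le (z : ℂ) : ‖Complex.cos z‖ ≤ Real.exp |z.im| := by
  rw [Complex.cos, norm_div, RCLike.norm_ofNat, div_le_iff₀ two_pos]
  linarith [norm_add_le (Complex.exp (z * Complex.I)) (Complex.exp (-z * Complex.I)),
    norm_exp_I_mul_le z, norm_exp_neg_mul_I_le z]

theorem norm_sin_le (z : ℂ) : ‖Complex.sin z‖ ≤ Real.exp |z.im| := by
  rw [Complex.sin, norm_div, norm_mul, Complex.norm_I, mul_one, RCLike.norm_ofNat,
    div_le_iff₀ two_pos]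
  linarith [norm_sub_le (Complex.exp (-z * Complex.I)) (Complex.exp (z * Complex.I)),
    norm_exp_I_mul_le z, norm_exp_neg_mul_I_le z]

/-- The mean value inequality for x ↦ sin(xw) on [0, y] produces a factor |w| that cancels the
denominator, so the bound stays uniform near w = 0. -/
theorem norm_sinSqrt_sq_le {y : ℝ} (hy : 0 ≤ y) (w : ℂ) :
    ‖sinSqrt y (w ^ 2)‖ ≤ y * Real.exp (y * |w.im|) := by
  by_cases hw : w = 0
  · simp [hw, sinSqrt_zero, abs_of_nonneg hy]
  have h : ‖Complex.sin (y * w) - Complex.sin ((0 : ℝ) * w)‖ ≤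
      (‖w‖ * Real.exp (y * |w.im|)) * (y - 0) := by
    refine norm_image_sub_le_of_norm_deriv_le_segment' (f := fun x : ℝ => Complex.sin (x * w))
      (f' := fun x : ℝ => Complex.cos (x * w) * w) (fun x _ => ?_) (fun x hx => ?_) y ⟨hy, le_rfl⟩
    · have h0 : HasDerivAt (fun x : ℝ => (x : ℂ) * w) (1 * w) x :=
        (Complex.ofRealCLM.hasDerivAt (x := x)).mul_const w
      rw [one_mul] at h0
      exact ((Complex.hasDerivAt_sin _).comp x h0).hasDerivWithinAt
    · rw [norm_mul, mul_comm]
      refine mul_le_mul_of_nonneg_left ((norm_cos_le _).trans ?_) (norm_nonneg _)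
      rw [Real.exp_le_exp, Complex.im_ofReal_mul, abs_mul, abs_of_nonneg hx.1]
      exact mul_le_mul_of_nonneg_right hx.2.le (abs_nonneg _)
  rw [Complex.ofReal_zero, zero_mul, Complex.sin_zero, sub_zero, sub_zero, ← sinSqrt_sq_mul,
    norm_mul] at h
  have hw' : 0 < ‖w‖ := norm_pos_iff.2 hw
  nlinarith

theorem sqrt_add_le {a b : ℝ} (ha : 0 ≤ a) (hb : 0 ≤ b) : √(a + b) ≤ √a + √b := by
  rw [Real.sqrt_le_left (by positivity)]
  nlinarith [Real.sq_sqrt ha, Real.sq_sqrt hb, mul_nonneg (Real.sqrt_nonneg a) (Real.sqrt_nonneg b)]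

/-- If w² = z then (Im w)² ≤ max(-Re z, 0) + |Im z|/2. Splitting the square root separates the
growth along the negative axis, left to the multiplier, from a growth in Im z of exponential type
zero. -/
theorem norm_sinSqrt_le {y : ℝ} (hy : 0 ≤ y) (z : ℂ) :
    ‖sinSqrt y z‖ ≤ y * Real.exp (y * (√(max (-z.re) 0) + √(|z.im| / 2))) := by
  obtain ⟨w, rfl⟩ := IsAlgClosed.exists_pow_nat_eq z two_pos
  refine (norm_sinSqrt_sq_le hy w).trans ?_
  gcongr
  refine le_trans ?_ (sqrt_add_le (le_max_right _ _) (by positivity))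
  refine Real.abs_le_sqrt ?_
  have h1 : (w ^ 2).re = w.re ^ 2 - w.im ^ 2 := by simp [sq]
  have h2 : (w ^ 2).im = 2 * (w.re * w.im) := by simp [sq]; ring
  rw [h1, h2, abs_mul, abs_two, abs_mul, ← sq_abs w.im, ← sq_abs w.re]
  have := abs_nonneg w.re
  have := abs_nonneg w.im
  rcases le_total |w.re| |w.im| with h | h
  · have := le_max_left (-(|w.re| ^ 2 - |w.im| ^ 2)) 0
    nlinarith
  · have := le_max_right (-(|w.re| ^ 2 - |w.im| ^ 2)) 0
    nlinarith

/-- The entire function `z ↦ sin (δ z) / (δ z)`. -/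
def csinc (δ : ℝ) (z : ℂ) : ℂ := sinSqrt δ (z ^ 2) / δ

theorem differentiable_csinc (δ : ℝ) : Differentiable ℂ (csinc δ) :=
  ((differentiable_sinSqrt δ).comp (differentiable_id.pow 2)).div_const _

theorem csinc_zero {δ : ℝ} (hδ : 0 < δ) : csinc δ 0 = 1 := by
  have : (δ : ℂ) ≠ 0 := by exact_mod_cast hδ.ne'
  rw [csinc, zero_pow two_ne_zero, sinSqrt_zero, div_self this]

theorem norm_csinc_le {δ : ℝ} (hδ : 0 < δ) (z : ℂ) : ‖csinc δ z‖ ≤ Real.exp (δ * |z.im|) := by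
  rw [csinc, norm_div, Complex.norm_real, Real.norm_of_nonneg hδ.le, div_le_iff₀ hδ, mul_comm]
  exact norm_sinSqrt_sq_le hδ.le z

theorem norm_csinc_mul_le {δ : ℝ} (hδ : 0 < δ) (z : ℂ) :
    ‖csinc δ z‖ * ‖z‖ ≤ Real.exp (δ * |z.im|) / δ := by
  rw [← norm_mul, csinc, div_mul_eq_mul_div, sinSqrt_sq_mul, norm_div, Complex.norm_real,
    Real.norm_of_nonneg hδ.le]
  gcongr
  refine (norm_sin_le _).trans ?_
  rw [Complex.im_ofReal_mul, abs_mul, abs_of_pos hδ]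

/-- Two sinc factors provide the quadratic decay that the Paley–Wiener theorem needs, at the cost of
2δ in the type. -/
theorem norm_csinc_sq_mul_le {δ : ℝ} (hδ : 0 < δ) (hδ1 : δ ≤ 1) (z : ℂ) :
    ‖csinc δ z ^ 2‖ * (1 + ‖z‖ ^ 2) ≤ 2 / δ ^ 2 * Real.exp (2 * δ * |z.im|) := by
  have h1 := norm_csinc_le hδ z
  have h2 := norm_csinc_mul_le hδ z
  have e : Real.exp (2 * δ * |z.im|) = Real.exp (δ * |z.im|) ^ 2 := by
    rw [← Real.exp_nat_mul]; congr 1; push_cast; ring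
  rw [norm_pow, e]
  have h3 : ‖csinc δ z‖ ^ 2 ≤ Real.exp (δ * |z.im|) ^ 2 := by gcongr
  have h4 : (‖csinc δ z‖ * ‖z‖) ^ 2 ≤ (Real.exp (δ * |z.im|) / δ) ^ 2 := by gcongr
  have h5 : Real.exp (δ * |z.im|) ^ 2 ≤ Real.exp (δ * |z.im|) ^ 2 / δ ^ 2 := by
    rw [le_div_iff₀ (by positivity)]
    exact mul_le_of_le_one_right (by positivity) (pow_le_one₀ hδ.le hδ1)
  calc _ = ‖csinc δ z‖ ^ 2 + (‖csinc δ z‖ * ‖z‖) ^ 2 := by ring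
    _ ≤ Real.exp (δ * |z.im|) ^ 2 / δ ^ 2 + (Real.exp (δ * |z.im|) / δ) ^ 2 := by linarith
    _ = _ := by ring

/-! ### A Paley–Wiener theorem -/

open Complex in
theorem integral_mul_exp_eq_zero {F : ℂ → ℂ} (hF : Differentiable ℂ F) {C b τ : ℝ}
    (h : ∀ z, ‖F z‖ * (1 + ‖z‖ ^ 2) ≤ C * Real.exp (b * |z.im|)) (hτ : b < τ) :
    ∫ s : ℝ, F s * exp (τ * s * I) = 0 := by
  set f : ℂ → ℂ := fun z => F z * exp (τ * z * I) with hf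
  have hfd : Differentiable ℂ f := hF.mul (by fun_prop)
  have hC : 0 ≤ C := by
    have := h 0
    simp at this
    exact (norm_nonneg _).trans this
  have hb : ∀ z : ℂ, 0 ≤ z.im → ‖f z‖ ≤ C / (1 + ‖z‖ ^ 2) := by
    intro z hz
    have h1 := h z
    rw [abs_of_nonneg hz] at h1
    have e : ‖exp (τ * z * I)‖ = Real.exp (-(τ * z.im)) := by
      rw [norm_exp]; congr 1; simp
    rw [hf, norm_mul, e, le_div_iff₀ (by positivity)]
    calc ‖F z‖ * Real.exp (-(τ * z.im)) * (1 + ‖z‖ ^ 2)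
        = ‖F z‖ * (1 + ‖z‖ ^ 2) * Real.exp (-(τ * z.im)) := by ring
      _ ≤ C * Real.exp (b * z.im) * Real.exp (-(τ * z.im)) := by gcongr
      _ = C * Real.exp ((b - τ) * z.im) := by rw [mul_assoc, ← Real.exp_add]; ring_nf
      _ ≤ C * 1 := by
        gcongr
        rw [Real.exp_le_one_iff]
        exact mul_nonpos_of_nonpos_of_nonneg (by linarith) hz
      _ = C := mul_one C
  have hint : Integrable (fun s : ℝ => f s) := by
    refine (integrable_inv_one_add_sq.const_mul C).mono'
      (hfd.continuous.comp continuous_ofReal).aestronglyMeasurable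
      (Eventually.of_forall fun s => ?_)
    have := hb s (by simp)
    rwa [norm_real, Real.norm_eq_abs, sq_abs, div_eq_mul_inv] at this
  have hlim := intervalIntegral_tendsto_integral hint tendsto_neg_atTop_atBot tendsto_id
  refine tendsto_nhds_unique hlim ?_
  rw [tendsto_zero_iff_norm_tendsto_zero]
  have hz : Tendsto (fun R : ℝ => 4 * C / R) atTop (𝓝 0) :=
    tendsto_const_nhds.div_atTop tendsto_id
  refine squeeze_zero' (Eventually.of_forall fun _ => norm_nonneg _) ?_ hz
  -- Cauchy's theorem on [-R, R] × [0, R]: since b < τ, the integrand is at most C/R² on the three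
  -- other sides, of total length 4R.
  filter_upwards [eventually_gt_atTop 0] with R hR
  have hcauchy := integral_boundary_rect_eq_zero_of_differentiableOn f (-R : ℂ) (⟨R, R⟩ : ℂ)
    hfd.differentiableOn
  simp only [neg_re, ofReal_re, neg_im, ofReal_im, neg_zero] at hcauchy
  have hside : ∀ z : ℂ, 0 ≤ z.im → R ≤ ‖z‖ → ‖f z‖ ≤ C / R ^ 2 := by
    intro z h0 h1
    refine (hb z h0).trans ?_
    gcongr
    nlinarith
  have hn : ∀ a : ℝ, |a| = R → ‖∫ y in (0 : ℝ)..R, f (a + y * I)‖ ≤ C / R ^ 2 * R := by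
    intro a ha
    have := intervalIntegral.norm_integral_le_of_norm_le_const (a := (0 : ℝ)) (b := R)
      (f := fun y : ℝ => f (a + y * I)) (C := C / R ^ 2) ?_
    · rwa [sub_zero, abs_of_pos hR] at this
    intro y hy
    rw [uIoc_of_le hR.le] at hy
    refine hside _ (by simpa using hy.1.le) ?_
    have := abs_re_le_norm ((a : ℂ) + y * I)
    simp only [add_re, ofReal_re, mul_re, I_re, mul_zero, ofReal_im, I_im, mul_one, sub_self,
      add_zero] at this
    rwa [ha] at this
  have ht : ‖∫ x in (-R)..R, f (x + R * I)‖ ≤ C / R ^ 2 * (2 * R) := by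
    have := intervalIntegral.norm_integral_le_of_norm_le_const (a := -R) (b := R)
      (f := fun x : ℝ => f (x + R * I)) (C := C / R ^ 2) ?_
    · rwa [sub_neg_eq_add, ← two_mul, abs_of_pos (by positivity)] at this
    intro x _
    refine hside _ (by simpa using hR.le) ?_
    have := abs_im_le_norm ((x : ℂ) + R * I)
    simp only [add_im, ofReal_im, mul_im, I_re, mul_zero, ofReal_re, I_im, mul_one, zero_add,
      add_zero, abs_of_pos hR] at this
    exact this
  have e : (∫ x in (-R)..R, f x) = (∫ x in (-R)..R, f (x + R * I)) -
      I • (∫ y in (0 : ℝ)..R, f (R + y * I)) +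
      I • (∫ y in (0 : ℝ)..R, f ((-R : ℝ) + y * I)) := by
    have e0 : (∫ x in (-R)..R, f x) = ∫ x in (-R)..R, f (x + (0 : ℝ) * I) := by simp
    rw [e0]
    linear_combination hcauchy
  rw [id, e]
  have h1 := hn R (abs_of_pos hR)
  have h2 := hn (-R) (by rw [abs_neg, abs_of_pos hR])
  refine (norm_add_le _ _).trans ((add_le_add_left (norm_sub_le _ _) _).trans ?_)
  rw [norm_smul, norm_smul, norm_I, one_mul, one_mul]
  calc _ ≤ C / R ^ 2 * (2 * R) + C / R ^ 2 * R + C / R ^ 2 * R := by gcongr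
    _ = _ := by field_simp; norm_num

open scoped FourierTransform in
/-- A Paley–Wiener theorem: an entire function of exponential type `b`, with quadratic decay, is
the Fourier transform of a continuous function supported in `[-b, b]`. -/
theorem exists_fourier_eq_of_exponential_type {F : ℂ → ℂ} (hF : Differentiable ℂ F) {C D b : ℝ}
    (h : ∀ z, ‖F z‖ * (1 + ‖z‖ ^ 2) ≤ C * Real.exp (b * |z.im|))
    (hD : ∀ s : ℝ, ‖F s‖ * (1 + s ^ 2) ≤ D) :
    ∃ g : ℝ → ℂ, Continuous g ∧ (∀ t, b < |t| → g t = 0) ∧ (∀ t, ‖g t‖ ≤ D) ∧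
      ∀ s : ℝ, ∫ t : ℝ, g t * Complex.exp (-(s * t * Complex.I)) = F s := by
  have hpi := Real.pi_pos
  set f : ℝ → ℂ := fun s => F s with hf
  have hfc : Continuous f := hF.continuous.comp Complex.continuous_ofReal
  have hfb : ∀ s : ℝ, ‖f s‖ ≤ D * (1 + s ^ 2)⁻¹ := by
    intro s
    rw [← div_eq_mul_inv, le_div_iff₀ (by positivity)]
    exact hD s
  have hfi : Integrable f := (integrable_inv_one_add_sq.const_mul D).mono'
    hfc.aestronglyMeasurable (Eventually.of_forall hfb)
  set G : ℝ → ℂ := 𝓕⁻ f with hG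
  have hGeq : ∀ t : ℝ, G t = ∫ s : ℝ, F s * Complex.exp ((2 * Real.pi * t : ℝ) * s * Complex.I) := by
    intro t
    rw [hG, Real.fourierInv_eq']
    refine integral_congr_ae (Eventually.of_forall fun s => ?_)
    simp only [RCLike.inner_apply, conj_trivial, smul_eq_mul]
    rw [mul_comm]
    congr 2
    push_cast
    ring
  have hGc : Continuous G := by
    rw [hG]
    have : (𝓕⁻ f : ℝ → ℂ) = fun t => 𝓕 f (-t) := by
      funext t; exact Real.fourierInv_eq_fourier_neg f t
    rw [this]
    exact (VectorFourier.fourierIntegral_continuous Real.continuous_fourierChar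
      (by exact continuous_inner) hfi).comp continuous_neg
  have hG0 : ∀ t : ℝ, b < |2 * Real.pi * t| → G t = 0 := by
    intro t ht
    rw [hGeq]
    rcases le_total 0 (2 * Real.pi * t) with h0 | h0
    · rw [abs_of_nonneg h0] at ht
      exact integral_mul_exp_eq_zero hF h ht
    · rw [abs_of_nonpos h0] at ht
      -- Negative times reduce to positive ones through the reflection s ↦ -s.
      have h' := integral_mul_exp_eq_zero (F := fun z => F (-z)) (C := C) (b := b)
        (hF.comp differentiable_neg) (fun z => by simpa using h (-z)) ht
      rw [← h', ← integral_neg_eq_self]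
      refine integral_congr_ae (Eventually.of_forall fun s => ?_)
      simp
  have hGi : Integrable G := by
    refine hGc.integrable_of_hasCompactSupport
      (HasCompactSupport.intro (isCompact_Icc (a := -(b / (2 * Real.pi)))
        (b := b / (2 * Real.pi))) fun t ht => hG0 t ?_)
    by_contra hc
    apply ht
    rw [not_lt, abs_mul, abs_of_pos (by positivity : 0 < 2 * Real.pi)] at hc
    rw [mem_Icc, ← abs_le, le_div_iff₀ (by positivity)]
    linarith
  have hinv : 𝓕 G = f := hfc.fourier_fourierInv_eq hfi (by
    rw [show 𝓕 f = fun t => G (-t) by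
      funext t; rw [hG, Real.fourierInv_eq_fourier_neg, neg_neg]]
    exact hGi.comp_neg)
  -- This rescales the Fourier kernel exp(-2πist) to exp(-ist). As (1+s²)⁻¹ has integral π, the
  -- supremum is at most Dπ/(2π) ≤ D.
  refine ⟨fun t => (2 * Real.pi : ℝ)⁻¹ • G ((2 * Real.pi)⁻¹ * t), by fun_prop, ?_, ?_, ?_⟩
  · intro t ht
    have e : 2 * Real.pi * ((2 * Real.pi)⁻¹ * t) = t := by field_simp
    simp only [hG0 _ (by rwa [e]), smul_zero]
  · intro t
    have hb : ‖G ((2 * Real.pi)⁻¹ * t)‖ ≤ D * Real.pi := by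
      rw [hGeq]
      refine (norm_integral_le_of_norm_le (integrable_inv_one_add_sq.const_mul D)
        (Eventually.of_forall fun s => ?_)).trans ?_
      · rw [norm_mul]
        have : ‖Complex.exp ((2 * Real.pi * ((2 * Real.pi)⁻¹ * t) : ℝ) * s * Complex.I)‖ = 1 := by
          rw [← Complex.ofReal_mul, Complex.norm_exp_ofReal_mul_I]
        rw [this, mul_one]
        exact hfb s
      · rw [integral_const_mul, integral_univ_inv_one_add_sq]
    have hD0 : 0 ≤ D := by
      have := (norm_nonneg _).trans hb
      exact nonneg_of_mul_nonneg_left this hpi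
    rw [norm_smul, Real.norm_of_nonneg (by positivity), inv_mul_le_iff₀ (by positivity)]
    nlinarith
  · intro s
    have h1 := congrFun hinv s
    rw [Real.fourier_real_eq_integral_exp_smul] at h1
    have h2 := Measure.integral_comp_mul_left
      (fun t : ℝ => Complex.exp (↑(-2 * Real.pi * t * s) * Complex.I) • G t) (2 * Real.pi)⁻¹
    rw [h1, inv_inv, abs_of_pos (by positivity)] at h2
    have e : ∀ t : ℝ, (2 * Real.pi : ℝ)⁻¹ • G ((2 * Real.pi)⁻¹ * t) *
        Complex.exp (-(s * t * Complex.I)) = (2 * Real.pi : ℝ)⁻¹ •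
        (Complex.exp (↑(-2 * Real.pi * ((2 * Real.pi)⁻¹ * t) * s) * Complex.I) •
          G ((2 * Real.pi)⁻¹ * t)) := by
      intro t
      rw [smul_mul_assoc, smul_eq_mul, mul_comm (G _)]
      congr 3
      have : -2 * Real.pi * ((2 * Real.pi)⁻¹ * t) * s = -(s * t) := by field_simp
      rw [this]; push_cast; ring
    simp only [e]
    rw [integral_smul, h2, smul_smul, inv_mul_cancel₀ (by positivity), one_smul]

/-! ### Observability of a single coefficient -/

open Real in
theorem integral_sin_mul_sin {m n : ℕ} (hm : 1 ≤ m) (hn : 1 ≤ n) :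
    ∫ y in (0 : ℝ)..π, Real.sin (n * y) * Real.sin (m * y) = if m = n then π / 2 else 0 := by
  have hcos : ∀ k : ℤ, k ≠ 0 → ∫ y in (0 : ℝ)..π, Real.cos (k * y) = 0 := by
    intro k hk
    have hk' : (k : ℝ) ≠ 0 := by exact_mod_cast hk
    rw [intervalIntegral.integral_comp_mul_left _ hk', integral_cos, Real.sin_int_mul_pi]
    simp
  have e : ∀ y : ℝ, Real.sin (n * y) * Real.sin (m * y) =
      1 / 2 * (Real.cos ((n - m : ℤ) * y) - Real.cos ((n + m : ℤ) * y)) := by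
    intro y
    push_cast
    rw [sub_mul, add_mul, Real.cos_sub, Real.cos_add]
    ring
  simp only [e]
  rw [intervalIntegral.integral_const_mul, intervalIntegral.integral_sub
    (by apply Continuous.intervalIntegrable; fun_prop)
    (by apply Continuous.intervalIntegrable; fun_prop), hcos (n + m) (by omega)]
  split_ifs with h
  · subst h
    simp
    ring
  · rw [hcos _ (by omega)]
    simp

/-- The trigonometric sum `∑ aₘ exp (-i m² t)`. -/
def expSum (s : Finset ℕ) (a : ℕ → ℂ) (t : ℝ) : ℂ :=
  ∑ m ∈ s, a m * Complex.exp (-((m : ℂ) ^ 2 * t * Complex.I))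

theorem continuous_expSum (s : Finset ℕ) (a : ℕ → ℂ) : Continuous (expSum s a) := by
  unfold expSum
  fun_prop

/-- Testing an exponential sum against a function with known Fourier transform. -/
theorem norm_sum_mul_le {F : ℂ → ℂ} (hF : Differentiable ℂ F) {C D b R : ℝ} (hbR : b ≤ R)
    (hR : 0 ≤ R)
    (h : ∀ z, ‖F z‖ * (1 + ‖z‖ ^ 2) ≤ C * Real.exp (b * |z.im|))
    (hD : ∀ s : ℝ, ‖F s‖ * (1 + s ^ 2) ≤ D) (s : Finset ℕ) (a : ℕ → ℂ) (n : ℕ) :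
    ‖∑ m ∈ s, a m * F ((m : ℂ) ^ 2 - (n : ℂ) ^ 2)‖ ≤ D * ∫ t in (-R)..R, ‖expSum s a t‖ := by
  -- The constant `C` only serves to locate the support of `g` in [-b, b]. The size of `g` depends
  -- on `D` alone, so `C` may be huge at no cost.
  obtain ⟨g, hgc, hg0, hgD, hg⟩ := exists_fourier_eq_of_exponential_type hF h hD
  have hgi : ∀ φ : ℝ → ℂ, Continuous φ → Integrable (fun t => g t * φ t) := by
    intro φ hφ
    refine (hgc.mul hφ).integrable_of_hasCompactSupport
      (HasCompactSupport.intro (isCompact_Icc (a := -b) (b := b)) fun t ht => ?_)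
    have : b < |t| := by
      by_contra hc
      exact ht (abs_le.1 (not_lt.1 hc))
    simp [hg0 t this]
  have e : ∑ m ∈ s, a m * F ((m : ℂ) ^ 2 - (n : ℂ) ^ 2) =
      ∫ t : ℝ, g t * (Complex.exp ((n : ℂ) ^ 2 * t * Complex.I) * expSum s a t) := by
    have e1 : ∀ t : ℝ, g t * (Complex.exp ((n : ℂ) ^ 2 * t * Complex.I) * expSum s a t) =
        ∑ m ∈ s, a m * (g t *
          Complex.exp (-(((m : ℝ) ^ 2 - (n : ℝ) ^ 2 : ℝ) * t * Complex.I))) := by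
      intro t
      rw [expSum, Finset.mul_sum, Finset.mul_sum]
      refine Finset.sum_congr rfl fun m _ => ?_
      have e2 : Complex.exp (-(((m : ℝ) ^ 2 - (n : ℝ) ^ 2 : ℝ) * t * Complex.I)) =
          Complex.exp ((n : ℂ) ^ 2 * t * Complex.I) *
            Complex.exp (-((m : ℂ) ^ 2 * t * Complex.I)) := by
        rw [← Complex.exp_add]
        push_cast
        ring_nf
      rw [e2]
      ring
    simp only [e1]
    rw [integral_finsetSum _ fun m _ => (hgi _ (by fun_prop)).const_mul _]
    refine Finset.sum_congr rfl fun m _ => ?_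
    rw [integral_const_mul, hg]
    push_cast
    rfl
  rw [e]
  have hsub : ∫ t : ℝ, g t * (Complex.exp ((n : ℂ) ^ 2 * t * Complex.I) * expSum s a t) =
      ∫ t in (-R)..R, g t * (Complex.exp ((n : ℂ) ^ 2 * t * Complex.I) * expSum s a t) := by
    rw [intervalIntegral.integral_of_le (by linarith), ← integral_Icc_eq_integral_Ioc]
    refine (setIntegral_eq_integral_of_forall_compl_eq_zero fun t ht => ?_).symm
    have : b < |t| := by
      by_contra hc
      exact ht (abs_le.1 ((not_lt.1 hc).trans hbR))
    rw [hg0 t this, zero_mul]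
  rw [hsub, ← intervalIntegral.integral_const_mul]
  refine intervalIntegral.norm_integral_le_of_norm_le (by linarith)
    (Eventually.of_forall fun t _ => ?_) ?_
  · rw [norm_mul, norm_mul]
    have : ‖Complex.exp ((n : ℂ) ^ 2 * t * Complex.I)‖ = 1 := by
      have := Complex.norm_exp_ofReal_mul_I ((n : ℝ) ^ 2 * t)
      push_cast at this
      exact this
    rw [this, one_mul]
    exact mul_le_mul_of_nonneg_right (hgD t) (norm_nonneg _)
  · exact (((continuous_expSum s a).norm).const_mul D).intervalIntegrable _ _

-- The condition cr = π²/4 turns the decay 2√(cr|Re z|) of the multiplier into π√|Re z|, the fastest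
-- growth of sin(y√z)/√z for y ≤ π. The shift by n² moves the argument to the right, so the bound is
-- uniform in n.
open Real in
theorem norm_sinSqrt_mul_multiplier_le {c r y : ℝ} (hr : 0 < r) (hc : 0 ≤ c)
    (hcr : c * r = π ^ 2 / 4) (hy : y ∈ Icc 0 π) (n : ℕ) (z : ℂ) :
    ‖sinSqrt y (z + n ^ 2)‖ * ‖multiplier c r z‖ ≤
      1152000 * Real.exp (27 / 500 * c) * Real.exp (r * |z.im| + π * √(|z.im| / 2)) := by
  have hpi := Real.pi_pos
  have hpi4 := Real.pi_le_four
  have hre : (z + (n : ℂ) ^ 2).re = z.re + (n : ℝ) ^ 2 := by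
    rw [Complex.add_re]
    congr 1
    exact_mod_cast Complex.ofReal_re ((n : ℝ) ^ 2)
  have him : (z + (n : ℂ) ^ 2).im = z.im := by
    rw [Complex.add_im]
    have : ((n : ℂ) ^ 2).im = 0 := by exact_mod_cast Complex.ofReal_im ((n : ℝ) ^ 2)
    rw [this, add_zero]
  have h1 : ‖sinSqrt y (z + n ^ 2)‖ ≤
      4 * Real.exp (π * (√(max (-z.re) 0) + √(|z.im| / 2))) := by
    refine (norm_sinSqrt_le hy.1 _).trans ?_
    rw [him, hre]
    have hy1 := hy.1
    have hy2 := hy.2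
    gcongr
    · linarith
    · nlinarith
  rw [Real.exp_add]
  have hE : (1 : ℝ) ≤ Real.exp (27 / 500 * c) := Real.one_le_exp (by positivity)
  rcases le_total 0 z.re with h | h
  · have h2 : ‖multiplier c r z‖ ≤ 2 * 1 * Real.exp (r * |z.im|) :=
      norm_fourierOn_le hr.le (fun x hx => norm_mulKernel_ofReal_le c x hx) z
    rw [max_eq_right (by linarith), Real.sqrt_zero, zero_add] at h1
    calc _ ≤ (4 * Real.exp (π * √(|z.im| / 2))) * (2 * 1 * Real.exp (r * |z.im|)) := by gcongr
      _ = (8 * 1) * (Real.exp (r * |z.im|) * Real.exp (π * √(|z.im| / 2))) := by ring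
      _ ≤ (1152000 * Real.exp (27 / 500 * c)) *
          (Real.exp (r * |z.im|) * Real.exp (π * √(|z.im| / 2))) := by
        gcongr
        norm_num
  · have h2 := norm_multiplier_le_of_re_nonpos hc hr.le h
    have e : 2 * √(c * (r * -z.re)) = π * √(-z.re) := by
      rw [← mul_assoc, hcr, show π ^ 2 / 4 = (π / 2) ^ 2 by ring, Real.sqrt_mul (by positivity),
        Real.sqrt_sq (by positivity)]
      ring
    rw [max_eq_left (by linarith), mul_add, Real.exp_add] at h1
    rw [e, neg_sub, sub_eq_add_neg, Real.exp_add, Real.exp_neg] at h2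
    have h3 := Real.exp_pos (π * √(-z.re))
    calc _ ≤ (4 * (Real.exp (π * √(-z.re)) * Real.exp (π * √(|z.im| / 2)))) *
          (288000 * (Real.exp (r * |z.im|) *
            (Real.exp (27 / 500 * c) * (Real.exp (π * √(-z.re)))⁻¹))) := by gcongr
      _ = _ := by field_simp; ring

open Real in
/-- The observability of a single coefficient, with the exponential cost. -/
theorem norm_coeff_le {T : ℝ} (hT : 0 < T) (hT1 : T ≤ 1) {s : Finset ℕ} (hs : ∀ m ∈ s, 1 ≤ m)
    (a : ℕ → ℂ) {n : ℕ} (hn : n ∈ s) :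
    ‖a n‖ ≤ 10 ^ 12 / T ^ 2 * Real.exp (5548 / 10000 * π ^ 2 / T) * n *
      ∫ t in (-(T / 2))..(T / 2), ‖expSum s a t‖ := by
  have hpi := Real.pi_pos
  have hpi3 := Real.pi_gt_three
  -- The types must fit in the window: r + 3δ = 0.49 T ≤ T/2. Two δ pay for the sinc factors and the
  -- third for the term √(|Im z|/2).
  set r : ℝ := 475 / 1000 * T with hr
  set c : ℝ := π ^ 2 / 4 / r with hc
  set δ : ℝ := T / 200 with hδ
  have hr0 : 0 < r := by positivity
  have hc0 : 0 < c := by positivity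
  have hδ0 : 0 < δ := by positivity
  have hcr : c * r = π ^ 2 / 4 := by rw [hc]; field_simp
  have hn1 : 1 ≤ n := hs n hn
  set D : ℝ := 1152000 * Real.exp (27 / 500 * c) * (2 / δ ^ 2) with hD
  set A : ℝ := ∫ t in (-(T / 2))..(T / 2), ‖expSum s a t‖ with hA
  set W : ℂ → ℂ := fun z => multiplier c r z * csinc δ z ^ 2 with hW
  have hWd : Differentiable ℂ W :=
    (differentiable_fourierOn (continuousOn_mulKernel_ofReal hc0.le) hr0.le).mul
      ((differentiable_csinc δ).pow 2)
  have key : ∀ y ∈ Icc 0 π, ‖∑ m ∈ s, a m * (sinSqrt y ((m : ℂ) ^ 2) *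
      W ((m : ℂ) ^ 2 - (n : ℂ) ^ 2))‖ ≤ D * A := by
    intro y hy
    have hb : ∀ z : ℂ, ‖sinSqrt y (z + n ^ 2) * W z‖ * (1 + ‖z‖ ^ 2) ≤
        D * Real.exp (r * |z.im| + π * √(|z.im| / 2) + 2 * δ * |z.im|) := by
      intro z
      have h1 := norm_sinSqrt_mul_multiplier_le hr0 hc0.le hcr hy n z
      have h2 := norm_csinc_sq_mul_le hδ0 (by rw [hδ]; linarith) z
      rw [hW, norm_mul, norm_mul, Real.exp_add _ (2 * δ * |z.im|)]
      calc _ = (‖sinSqrt y (z + n ^ 2)‖ * ‖multiplier c r z‖) *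
            (‖csinc δ z ^ 2‖ * (1 + ‖z‖ ^ 2)) := by ring
        _ ≤ _ * _ := mul_le_mul h1 h2 (by positivity) (by positivity)
        _ = _ := by rw [hD]; ring
    -- The factor exp(π²/(8δ)) enters only `C`, because on the real axis the term √(|Im z|/2)
    -- vanishes. It would otherwise ruin the exponent.
    have h := norm_sum_mul_le (F := fun z => sinSqrt y (z + n ^ 2) * W z)
      (((differentiable_sinSqrt y).comp (differentiable_id.add_const _)).mul hWd)
      (C := D * Real.exp (π ^ 2 / (8 * δ))) (D := D) (b := r + 3 * δ) (R := T / 2)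
      (by rw [hr, hδ]; linarith) (by positivity) ?_ ?_ s a n
    · simpa only [sub_add_cancel] using h
    · intro z
      refine (hb z).trans ?_
      rw [mul_assoc D, ← Real.exp_add]
      refine mul_le_mul_of_nonneg_left (Real.exp_le_exp.2 ?_) (by positivity)
      have hx : √(|z.im| / 2) ^ 2 = |z.im| / 2 := Real.sq_sqrt (by positivity)
      -- Young's inequality: the square root is traded for an extra type δ and a constant.
      have h3 : π * √(|z.im| / 2) ≤ π ^ 2 / (8 * δ) + 2 * δ * √(|z.im| / 2) ^ 2 := by
        have h4 : π ^ 2 / (8 * δ) + 2 * δ * √(|z.im| / 2) ^ 2 - π * √(|z.im| / 2) =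
            (4 * δ * √(|z.im| / 2) - π) ^ 2 / (8 * δ) := by field_simp; ring
        have h5 : 0 ≤ (4 * δ * √(|z.im| / 2) - π) ^ 2 / (8 * δ) := by positivity
        linarith
      rw [hx] at h3
      linarith
    · intro x
      have := hb x
      rw [Complex.ofReal_im, abs_zero, Complex.norm_real, Real.norm_eq_abs, sq_abs] at this
      simpa using this
  have hW0 : W 0 = (π / 4 * ((1 + c) * Real.exp (-c)) : ℝ) := by
    rw [hW]
    simp only
    rw [csinc_zero hδ0, multiplier_zero hc0.le, one_pow, mul_one]
  have hsin : ∀ m ∈ s, ∀ y : ℝ, sinSqrt y ((m : ℂ) ^ 2) = (Real.sin (m * y) : ℝ) / m := by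
    intro m hm y
    have hm0 : (m : ℂ) ≠ 0 := by
      have := hs m hm
      exact_mod_cast (by omega : m ≠ 0)
    rw [eq_div_iff hm0, sinSqrt_sq_mul]
    push_cast
    rw [mul_comm]
  -- Orthogonality of the sines on (0, π) removes every m ≠ n, without any information on the values
  -- of `W` away from 0.
  have hval : ∫ y in (0 : ℝ)..π, (Real.sin (n * y) : ℂ) * ∑ m ∈ s, a m *
      (sinSqrt y ((m : ℂ) ^ 2) * W ((m : ℂ) ^ 2 - (n : ℂ) ^ 2)) = a n * W 0 / n * (π / 2) := by
    have e : ∀ y : ℝ, (Real.sin (n * y) : ℂ) * ∑ m ∈ s, a m *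
        (sinSqrt y ((m : ℂ) ^ 2) * W ((m : ℂ) ^ 2 - (n : ℂ) ^ 2)) =
        ∑ m ∈ s, (a m * W ((m : ℂ) ^ 2 - (n : ℂ) ^ 2) / m) *
          ((Real.sin (n * y) * Real.sin (m * y) : ℝ) : ℂ) := by
      intro y
      rw [Finset.mul_sum]
      refine Finset.sum_congr rfl fun m hm => ?_
      rw [hsin m hm]
      push_cast
      ring
    simp only [e]
    rw [intervalIntegral.integral_finsetSum]
    · rw [Finset.sum_eq_single_of_mem n hn]
      · rw [intervalIntegral.integral_const_mul, intervalIntegral.integral_ofReal,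
          integral_sin_mul_sin hn1 hn1, if_pos rfl, sub_self]
        push_cast
        ring
      · intro m hm hmn
        rw [intervalIntegral.integral_const_mul, intervalIntegral.integral_ofReal,
          integral_sin_mul_sin (hs m hm) hn1, if_neg hmn]
        simp
    · intro m _
      apply Continuous.intervalIntegrable
      fun_prop
  have hle : ‖a n * W 0 / n * (π / 2)‖ ≤ D * A * π := by
    rw [← hval]
    have := intervalIntegral.norm_integral_le_of_norm_le_const (a := (0 : ℝ)) (b := π)
      (f := fun y : ℝ => (Real.sin (n * y) : ℂ) * ∑ m ∈ s, a m *
      (sinSqrt y ((m : ℂ) ^ 2) * W ((m : ℂ) ^ 2 - (n : ℂ) ^ 2))) (C := D * A) ?_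
    · rwa [sub_zero, abs_of_pos hpi] at this
    intro y hy
    rw [uIoc_of_le hpi.le] at hy
    rw [norm_mul, Complex.norm_real, Real.norm_eq_abs]
    refine (mul_le_of_le_one_left (norm_nonneg _) (Real.abs_sin_le_one _)).trans ?_
    exact key y ⟨hy.1.le, hy.2⟩
  have hn0 : (0 : ℝ) < n := by exact_mod_cast hn1
  have hA0 : 0 ≤ A := intervalIntegral.integral_nonneg (by linarith) fun _ _ => norm_nonneg _
  have hnorm : ‖a n * W 0 / n * (π / 2)‖ =
      ‖a n‖ * (π / 4 * ((1 + c) * Real.exp (-c))) / n * (π / 2) := by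
    rw [norm_mul, norm_div, norm_mul, hW0, Complex.norm_real, Real.norm_of_nonneg (by positivity),
      Complex.norm_natCast]
    congr 1
    rw [← Complex.ofReal_ofNat, ← Complex.ofReal_div, Complex.norm_real,
      Real.norm_of_nonneg (by positivity)]
  rw [hnorm] at hle
  have h6 : ‖a n‖ * (π ^ 2 / 8 * Real.exp (-c)) ≤ D * A * π * n := by
    have : ‖a n‖ * (π / 4 * ((1 + c) * Real.exp (-c))) / n * (π / 2) =
        ‖a n‖ * (π ^ 2 / 8 * ((1 + c) * Real.exp (-c))) / n := by ring
    rw [this, div_le_iff₀ hn0] at hle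
    refine le_trans ?_ hle
    gcongr
    -- The factor 1 + c ≥ 1 is dropped.
    nlinarith [Real.exp_pos (-c)]
  have h7 : ‖a n‖ ≤ 8 / π * (D * Real.exp c) * n * A := by
    have h8 : ‖a n‖ = ‖a n‖ * (π ^ 2 / 8 * Real.exp (-c)) * (8 / π ^ 2 * Real.exp c) := by
      rw [Real.exp_neg]; field_simp
    rw [h8]
    calc _ ≤ D * A * π * n * (8 / π ^ 2 * Real.exp c) := by gcongr
      _ = _ := by field_simp
  refine h7.trans ?_
  gcongr ?_ * _ * _
  have h9 : D * Real.exp c = 1152000 * (2 / δ ^ 2) * Real.exp (527 / 500 * c) := by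
    rw [hD, show 527 / 500 * c = 27 / 500 * c + c by ring, Real.exp_add]; ring
  -- Here 527/500 adds the 1 from W(0) ~ exp(-c) and the 27/500 from the contour, and 1.054/(4 ·
  -- 0.475) = 0.55473…
  have h10 : 527 / 500 * c ≤ 5548 / 10000 * π ^ 2 / T := by
    rw [hc, hr]
    have : 527 / 500 * (π ^ 2 / 4 / (475 / 1000 * T)) = (527 / 500 / 4 / (475 / 1000)) * (π ^ 2 / T) := by
      field_simp
    rw [this, mul_div_assoc]
    exact mul_le_mul_of_nonneg_right (by norm_num) (by positivity)
  rw [h9]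
  have h11 : 8 / π ≤ 8 / 3 := by gcongr
  calc _ ≤ 8 / 3 * (1152000 * (2 / δ ^ 2) * Real.exp (5548 / 10000 * π ^ 2 / T)) := by gcongr
    _ = (8 / 3 * 1152000 * 2 * 40000) / T ^ 2 * Real.exp (5548 / 10000 * π ^ 2 / T) := by
      rw [hδ]; field_simp; norm_num
    _ ≤ _ := by gcongr; norm_num

/-! ### Ingham's inequality for the high frequencies -/

theorem sum_inv_sq_le_two {s : Finset ℕ} {j : ℕ → ℕ} (hj : InjOn j s) :
    ∑ k ∈ s, 1 / (j k : ℝ) ^ 2 ≤ 2 := by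
  have h := hasSum_zeta_two
  calc ∑ k ∈ s, 1 / (j k : ℝ) ^ 2 = ∑ n ∈ s.image j, 1 / (n : ℝ) ^ 2 :=
        (Finset.sum_image (f := fun n : ℕ => 1 / (n : ℝ) ^ 2) hj).symm
    _ ≤ ∑' n : ℕ, 1 / (n : ℝ) ^ 2 := h.summable.sum_le_tsum _ fun _ _ => by positivity
    _ = Real.pi ^ 2 / 6 := h.tsum_eq
    _ ≤ 2 := by nlinarith [Real.pi_pos, Real.pi_lt_d2]

theorem sum_inv_sub_sq_le_four (s : Finset ℕ) (m : ℕ) :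
    ∑ k ∈ s.erase m, 1 / ((m : ℝ) - k) ^ 2 ≤ 4 := by
  rw [← Finset.sum_filter_add_sum_filter_not (s.erase m) (fun k => k < m)]
  have h1 : ∑ k ∈ (s.erase m).filter (fun k => k < m), 1 / ((m : ℝ) - k) ^ 2 ≤ 2 := by
    have hj : InjOn (fun k => m - k) ((s.erase m).filter (fun k => k < m) : Finset ℕ) := by
      intro k hk l hl h
      simp only [Finset.coe_filter, mem_ofPred_eq] at hk hl
      simp only at h
      omega
    refine le_trans (le_of_eq ?_) (sum_inv_sq_le_two hj)
    refine Finset.sum_congr rfl fun k hk => ?_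
    rw [Finset.mem_filter] at hk
    rw [Nat.cast_sub hk.2.le]
  have h2 : ∑ k ∈ (s.erase m).filter (fun k => ¬ k < m), 1 / ((m : ℝ) - k) ^ 2 ≤ 2 := by
    have hj : InjOn (fun k => k - m) ((s.erase m).filter (fun k => ¬ k < m) : Finset ℕ) := by
      intro k hk l hl h
      simp only [Finset.coe_filter, mem_ofPred_eq] at hk hl
      simp only at h
      omega
    refine le_trans (le_of_eq ?_) (sum_inv_sq_le_two hj)
    refine Finset.sum_congr rfl fun k hk => ?_
    rw [Finset.mem_filter, not_lt] at hk
    rw [Nat.cast_sub hk.2, ← neg_sub, neg_sq]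
  linarith

/-- The Fourier transform of the triangular weight on `[-R, R]`, folded onto `[0, R]`. -/
def triangleTransform (R ω : ℝ) : ℂ :=
  ∫ t in (0 : ℝ)..R, (1 - t / R : ℝ) *
    (Complex.exp (ω * t * Complex.I) + Complex.exp (-(ω * t * Complex.I)))

theorem triangleTransform_zero {R : ℝ} (hR : 0 < R) : triangleTransform R 0 = R := by
  have e : ∀ t : ℝ, ((1 - t / R : ℝ) : ℂ) * (Complex.exp ((0 : ℝ) * t * Complex.I) +
      Complex.exp (-((0 : ℝ) * t * Complex.I))) = ((2 - 2 / R * t : ℝ) : ℂ) := by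
    intro t
    simp
    ring
  rw [triangleTransform]
  simp only [e]
  rw [intervalIntegral.integral_ofReal, intervalIntegral.integral_sub
    (by apply Continuous.intervalIntegrable; fun_prop)
    (by apply Continuous.intervalIntegrable; fun_prop), intervalIntegral.integral_const_mul,
    integral_id, intervalIntegral.integral_const]
  congr 1
  simp
  field_simp
  ring

/-- The explicit primitive amounts to two integrations by parts. The first boundary terms vanish, at
R because the weight does and at 0 because the two exponentials cancel; what remains is of order
ω⁻², summable over the gaps. -/
theorem norm_triangleTransform_le {R ω : ℝ} (hR : 0 < R) (hω : ω ≠ 0) :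
    ‖triangleTransform R ω‖ ≤ 4 / (R * ω ^ 2) := by
  have hR' : (R : ℂ) ≠ 0 := by exact_mod_cast hR.ne'
  have hω' : (ω : ℂ) ≠ 0 := by exact_mod_cast hω
  have hI := Complex.I_ne_zero
  have hd : ∀ t : ℝ, HasDerivAt (fun t : ℝ =>
      (1 - t / R : ℂ) * (Complex.exp (ω * t * Complex.I) - Complex.exp (-(ω * t * Complex.I))) /
        (ω * Complex.I) +
      (Complex.exp (ω * t * Complex.I) + Complex.exp (-(ω * t * Complex.I))) /
        (R * (ω * Complex.I) ^ 2))
      ((1 - t / R : ℝ) *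
        (Complex.exp (ω * t * Complex.I) + Complex.exp (-(ω * t * Complex.I)))) t := by
    intro t
    have h0 : HasDerivAt (fun x : ℝ => (x : ℂ)) 1 t := Complex.ofRealCLM.hasDerivAt
    have h1 : HasDerivAt (fun t : ℝ => (ω : ℂ) * t * Complex.I) (ω * 1 * Complex.I) t :=
      (h0.const_mul _).mul_const _
    have h2 : HasDerivAt (fun t : ℝ => (1 - t / R : ℂ)) (-(1 / R)) t :=
      (h0.div_const _).const_sub _
    have h3 := h1.cexp
    have h4 := h1.neg.cexp
    convert! ((h2.mul (h3.sub h4)).div_const (ω * Complex.I)).add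
      ((h3.add h4).div_const (R * (ω * Complex.I) ^ 2)) using 1
    simp only [Pi.neg_apply, Pi.sub_apply]
    push_cast
    field_simp
    ring
  rw [triangleTransform, intervalIntegral.integral_eq_sub_of_hasDerivAt (fun t _ => hd t)
    (by apply Continuous.intervalIntegrable; fun_prop)]
  have e : ∀ A B : ℂ, (1 - (R : ℂ) / R) * (A - B) / (ω * Complex.I) +
      (A + B) / (R * (ω * Complex.I) ^ 2) -
      ((1 - (0 : ℝ) / (R : ℂ)) * (Complex.exp (ω * (0 : ℝ) * Complex.I) -
        Complex.exp (-(ω * (0 : ℝ) * Complex.I))) / (ω * Complex.I) +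
        (Complex.exp (ω * (0 : ℝ) * Complex.I) + Complex.exp (-(ω * (0 : ℝ) * Complex.I))) /
        (R * (ω * Complex.I) ^ 2)) = (A + B - 2) / (R * (ω * Complex.I) ^ 2) := by
    intro A B
    rw [div_self hR']
    simp
    ring
  rw [e, norm_div, norm_mul, norm_pow, norm_mul, Complex.norm_I, mul_one, Complex.norm_real,
    Complex.norm_real, Real.norm_of_nonneg hR.le, Real.norm_eq_abs, sq_abs]
  gcongr
  have h1 : ‖Complex.exp (ω * R * Complex.I)‖ = 1 := by
    rw [← Complex.ofReal_mul, Complex.norm_exp_ofReal_mul_I]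
  have h2 : ‖Complex.exp (-(ω * R * Complex.I))‖ = 1 := by
    have := Complex.norm_exp_ofReal_mul_I (-(ω * R))
    rwa [Complex.ofReal_neg, neg_mul, Complex.ofReal_mul] at this
  have h3 := norm_sub_le (Complex.exp (ω * R * Complex.I) + Complex.exp (-(ω * R * Complex.I))) 2
  have h4 := norm_add_le (Complex.exp (ω * R * Complex.I)) (Complex.exp (-(ω * R * Complex.I)))
  rw [RCLike.norm_ofNat] at h3
  linarith

theorem norm_expSum_sq (s : Finset ℕ) (a : ℕ → ℂ) (t : ℝ) :
    ((‖expSum s a t‖ ^ 2 : ℝ) : ℂ) = ∑ m ∈ s, ∑ k ∈ s, a m * (starRingEnd ℂ) (a k) *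
      Complex.exp (((k : ℝ) ^ 2 - (m : ℝ) ^ 2 : ℝ) * t * Complex.I) := by
  rw [Complex.ofReal_pow, ← Complex.mul_conj', expSum, map_sum, Finset.sum_mul_sum]
  refine Finset.sum_congr rfl fun m _ => Finset.sum_congr rfl fun k _ => ?_
  rw [map_mul, ← Complex.exp_conj]
  have e : (starRingEnd ℂ) (-((k : ℂ) ^ 2 * t * Complex.I)) = (k : ℂ) ^ 2 * t * Complex.I := by
    simp
  have e2 : Complex.exp (((k : ℝ) ^ 2 - (m : ℝ) ^ 2 : ℝ) * t * Complex.I) =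
      Complex.exp (-((m : ℂ) ^ 2 * t * Complex.I)) * Complex.exp ((k : ℂ) ^ 2 * t * Complex.I) := by
    rw [← Complex.exp_add]
    push_cast
    ring_nf
  rw [e, e2]
  ring

theorem integral_triangle_norm_expSum_sq (s : Finset ℕ) (a : ℕ → ℂ) (R : ℝ) :
    ((∫ t in (0 : ℝ)..R, (1 - t / R) * (‖expSum s a t‖ ^ 2 + ‖expSum s a (-t)‖ ^ 2) : ℝ) : ℂ) =
      ∑ m ∈ s, ∑ k ∈ s, a m * (starRingEnd ℂ) (a k) *
        triangleTransform R ((k : ℝ) ^ 2 - (m : ℝ) ^ 2) := by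
  rw [← intervalIntegral.integral_ofReal]
  have e : ∀ t : ℝ, (((1 - t / R) * (‖expSum s a t‖ ^ 2 + ‖expSum s a (-t)‖ ^ 2) : ℝ) : ℂ) =
      ∑ m ∈ s, ∑ k ∈ s, a m * (starRingEnd ℂ) (a k) * ((1 - t / R : ℝ) *
        (Complex.exp (((k : ℝ) ^ 2 - (m : ℝ) ^ 2 : ℝ) * t * Complex.I) +
          Complex.exp (-(((k : ℝ) ^ 2 - (m : ℝ) ^ 2 : ℝ) * t * Complex.I)))) := by
    intro t
    rw [Complex.ofReal_mul, Complex.ofReal_add, norm_expSum_sq, norm_expSum_sq,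
      ← Finset.sum_add_distrib, Finset.mul_sum]
    refine Finset.sum_congr rfl fun m _ => ?_
    rw [← Finset.sum_add_distrib, Finset.mul_sum]
    refine Finset.sum_congr rfl fun k _ => ?_
    rw [Complex.ofReal_neg, mul_neg, neg_mul]
    ring
  simp only [e]
  rw [intervalIntegral.integral_finsetSum]
  · refine Finset.sum_congr rfl fun m _ => ?_
    rw [intervalIntegral.integral_finsetSum]
    · refine Finset.sum_congr rfl fun k _ => ?_
      rw [intervalIntegral.integral_const_mul, triangleTransform]
    · intro k _
      apply Continuous.intervalIntegrable
      fun_prop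
  · intro m _
    apply Continuous.intervalIntegrable
    fun_prop

/-- Ingham's inequality for high frequencies. -/
theorem sum_norm_sq_le_of_lt {N R : ℝ} (hN : 0 < N) (hR : 0 < R) (hNR : 8 ≤ N ^ 2 * R ^ 2)
    {s : Finset ℕ} (hs : ∀ m ∈ s, N ≤ m) (a : ℕ → ℂ) :
    ∑ m ∈ s, ‖a m‖ ^ 2 ≤ 2 / R * ∫ t in (-R)..R, ‖expSum s a t‖ ^ 2 := by
  set S := ∑ m ∈ s, ‖a m‖ ^ 2 with hS
  have hS0 : 0 ≤ S := Finset.sum_nonneg fun _ _ => by positivity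
  set X : ℝ := ∫ t in (0 : ℝ)..R, (1 - t / R) * (‖expSum s a t‖ ^ 2 + ‖expSum s a (-t)‖ ^ 2)
    with hX
  have hc := continuous_expSum s a
  have hXle : X ≤ ∫ t in (-R)..R, ‖expSum s a t‖ ^ 2 := by
    have e : ∫ t in (-R)..R, ‖expSum s a t‖ ^ 2 =
        ∫ t in (0 : ℝ)..R, (‖expSum s a t‖ ^ 2 + ‖expSum s a (-t)‖ ^ 2) := by
      rw [intervalIntegral.integral_add (by apply Continuous.intervalIntegrable; fun_prop)
        (by apply Continuous.intervalIntegrable; fun_prop),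
        intervalIntegral.integral_comp_neg (fun t => ‖expSum s a t‖ ^ 2), neg_zero, add_comm,
        intervalIntegral.integral_add_adjacent_intervals
        (by apply Continuous.intervalIntegrable; fun_prop)
        (by apply Continuous.intervalIntegrable; fun_prop)]
    rw [e, hX]
    refine intervalIntegral.integral_mono_on hR.le
      (by apply Continuous.intervalIntegrable; fun_prop)
      (by apply Continuous.intervalIntegrable; fun_prop) fun t ht => ?_
    refine mul_le_of_le_one_left (by positivity) ?_
    have : 0 ≤ t / R := div_nonneg ht.1 hR.le
    linarith
  have hsplit : (X : ℂ) = (R * S : ℝ) + ∑ m ∈ s, ∑ k ∈ s.erase m, a m * (starRingEnd ℂ) (a k) *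
        triangleTransform R ((k : ℝ) ^ 2 - (m : ℝ) ^ 2) := by
    rw [hX, integral_triangle_norm_expSum_sq, hS, Finset.mul_sum, Complex.ofReal_sum,
      ← Finset.sum_add_distrib]
    refine Finset.sum_congr rfl fun m hm => ?_
    rw [← Finset.add_sum_erase s _ hm, sub_self, triangleTransform_zero hR, Complex.mul_conj']
    push_cast
    ring
  have hpair : ∀ m ∈ s, ∀ k ∈ s.erase m,
      ‖triangleTransform R ((k : ℝ) ^ 2 - (m : ℝ) ^ 2)‖ ≤
        1 / (R * N ^ 2) * (1 / ((m : ℝ) - k) ^ 2) := by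
    intro m hm k hk
    have hkm : k ≠ m := Finset.ne_of_mem_erase hk
    have hm' := hs m hm
    have hk' := hs k (Finset.mem_of_mem_erase hk)
    have hsub : (m : ℝ) - k ≠ 0 := sub_ne_zero.2 (by exact_mod_cast hkm.symm)
    have hne : (k : ℝ) ^ 2 - (m : ℝ) ^ 2 ≠ 0 := by
      have : (k : ℝ) ^ 2 - (m : ℝ) ^ 2 = -((m - k) * (m + k)) := by ring
      rw [this]
      exact neg_ne_zero.2 (mul_ne_zero hsub (by linarith))
    refine (norm_triangleTransform_le hR hne).trans ?_
    -- Frequencies beyond N have wide gaps: |k²-m²| ≥ 2N|k-m|.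
    have h4 : 4 * N ^ 2 ≤ ((m : ℝ) + k) ^ 2 := by nlinarith
    have hpos : 0 < ((m : ℝ) - k) ^ 2 := by positivity
    rw [div_mul_div_comm, div_le_div_iff₀ (by positivity) (by positivity)]
    have e : ((k : ℝ) ^ 2 - (m : ℝ) ^ 2) ^ 2 = (m - k) ^ 2 * (m + k) ^ 2 := by ring
    rw [e]
    have := mul_le_mul_of_nonneg_left h4 (mul_nonneg hR.le hpos.le)
    linarith
  have hoff : ‖∑ m ∈ s, ∑ k ∈ s.erase m, a m * (starRingEnd ℂ) (a k) *
        triangleTransform R ((k : ℝ) ^ 2 - (m : ℝ) ^ 2)‖ ≤ 4 / (R * N ^ 2) * S := by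
    have h1 : ‖∑ m ∈ s, ∑ k ∈ s.erase m, a m * (starRingEnd ℂ) (a k) *
        triangleTransform R ((k : ℝ) ^ 2 - (m : ℝ) ^ 2)‖ ≤
        ∑ m ∈ s, ∑ k ∈ s.erase m, (‖a m‖ ^ 2 / 2 + ‖a k‖ ^ 2 / 2) *
          (1 / (R * N ^ 2) * (1 / ((m : ℝ) - k) ^ 2)) := by
      refine (norm_sum_le _ _).trans (Finset.sum_le_sum fun m hm => (norm_sum_le _ _).trans
        (Finset.sum_le_sum fun k hk => ?_))
      rw [norm_mul, norm_mul, RCLike.norm_conj]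
      refine mul_le_mul ?_ (hpair m hm k hk) (norm_nonneg _) (by positivity)
      nlinarith [sq_nonneg (‖a m‖ - ‖a k‖)]
    refine h1.trans ?_
    -- Symmetry of the kernel in (m, k), as in Schur's test, reduces both halves of the sum to one.
    have hswap : ∑ m ∈ s, ∑ k ∈ s.erase m, ‖a k‖ ^ 2 / 2 *
        (1 / (R * N ^ 2) * (1 / ((m : ℝ) - k) ^ 2)) =
        ∑ m ∈ s, ∑ k ∈ s.erase m, ‖a m‖ ^ 2 / 2 *
        (1 / (R * N ^ 2) * (1 / ((m : ℝ) - k) ^ 2)) := by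
      rw [Finset.sum_comm' (t' := s) (s' := fun k => s.erase k)]
      · refine Finset.sum_congr rfl fun m _ => Finset.sum_congr rfl fun k _ => ?_
        rw [← neg_sub (m : ℝ), neg_sq]
      · intro m k
        simp only [Finset.mem_erase]
        tauto
    simp only [add_mul, Finset.sum_add_distrib]
    rw [hswap, ← two_mul, Finset.mul_sum, hS, Finset.mul_sum]
    refine Finset.sum_le_sum fun m _ => ?_
    rw [← Finset.mul_sum, ← Finset.mul_sum]
    have := sum_inv_sub_sq_le_four s m
    calc _ = ‖a m‖ ^ 2 * (1 / (R * N ^ 2)) * ∑ k ∈ s.erase m, 1 / ((m : ℝ) - k) ^ 2 := by ring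
      _ ≤ ‖a m‖ ^ 2 * (1 / (R * N ^ 2)) * 4 := by gcongr
      _ = _ := by ring
  have hlow : R * S - 4 / (R * N ^ 2) * S ≤ X := by
    have h1 : R * S = ‖((R * S : ℝ) : ℂ)‖ := by
      rw [Complex.norm_real, Real.norm_of_nonneg (by positivity)]
    have h2 : ((R * S : ℝ) : ℂ) = X - ∑ m ∈ s, ∑ k ∈ s.erase m, a m * (starRingEnd ℂ) (a k) *
        triangleTransform R ((k : ℝ) ^ 2 - (m : ℝ) ^ 2) := by rw [hsplit]; ring
    have hX0 : 0 ≤ X := intervalIntegral.integral_nonneg hR.le fun t ht => by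
      have : t / R ≤ 1 := (div_le_one hR).2 ht.2
      exact mul_nonneg (by linarith) (by positivity)
    have h3 : ‖(X : ℂ)‖ = X := by rw [Complex.norm_real, Real.norm_of_nonneg hX0]
    have h4 := norm_sub_le (X : ℂ) (∑ m ∈ s, ∑ k ∈ s.erase m, a m * (starRingEnd ℂ) (a k) *
        triangleTransform R ((k : ℝ) ^ 2 - (m : ℝ) ^ 2))
    rw [← h2, ← h1, h3] at h4
    linarith
  -- The hypothesis 8 ≤ N²R² makes the off-diagonal part at most half of the diagonal one.
  have hq : 4 / (R * N ^ 2) ≤ R / 2 := by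
    rw [div_le_div_iff₀ (by positivity) two_pos]
    nlinarith
  have h5 : S * (R / 2) ≤ ∫ t in (-R)..R, ‖expSum s a t‖ ^ 2 := by
    have := mul_le_mul_of_nonneg_right hq hS0
    linarith
  calc S = 2 / R * (S * (R / 2)) := by field_simp
    _ ≤ _ := by gcongr

/-! ### From single coefficients to the ℓ² norm -/

theorem sq_integral_norm_le {f : ℝ → ℂ} (hf : Continuous f) {T : ℝ} (hT : 0 < T) :
    (∫ t in (-(T / 2))..(T / 2), ‖f t‖) ^ 2 ≤ T * ∫ t in (-(T / 2))..(T / 2), ‖f t‖ ^ 2 := by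
  set A := ∫ t in (-(T / 2))..(T / 2), ‖f t‖ with hA
  have h : 0 ≤ ∫ t in (-(T / 2))..(T / 2), (‖f t‖ - A / T) ^ 2 :=
    intervalIntegral.integral_nonneg (by linarith) fun _ _ => sq_nonneg _
  have e : ∫ t in (-(T / 2))..(T / 2), (‖f t‖ - A / T) ^ 2 =
      (∫ t in (-(T / 2))..(T / 2), ‖f t‖ ^ 2) - A ^ 2 / T := by
    have e1 : ∀ t : ℝ, (‖f t‖ - A / T) ^ 2 = ‖f t‖ ^ 2 - 2 * (A / T) * ‖f t‖ + (A / T) ^ 2 := by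
      intro t; ring
    simp only [e1]
    rw [intervalIntegral.integral_add (by apply Continuous.intervalIntegrable; fun_prop)
        (by apply Continuous.intervalIntegrable; fun_prop),
      intervalIntegral.integral_sub (by apply Continuous.intervalIntegrable; fun_prop)
        (by apply Continuous.intervalIntegrable; fun_prop),
      intervalIntegral.integral_const_mul, intervalIntegral.integral_const, ← hA]
    simp only [smul_eq_mul]
    field_simp
    ring
  rw [e, sub_nonneg, div_le_iff₀ hT] at h
  linarith

theorem expSum_filter_add (s : Finset ℕ) (a : ℕ → ℂ) (p : ℕ → Prop) [DecidablePred p] (t : ℝ) :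
    expSum (s.filter p) a t + expSum (s.filter fun m => ¬ p m) a t = expSum s a t := by
  unfold expSum
  exact Finset.sum_filter_add_sum_filter_not s p _

theorem norm_expSum_le (s : Finset ℕ) (a : ℕ → ℂ) (t : ℝ) :
    ‖expSum s a t‖ ≤ ∑ m ∈ s, ‖a m‖ := by
  refine (norm_sum_le _ _).trans (Finset.sum_le_sum fun m _ => ?_)
  have := Complex.norm_exp_ofReal_mul_I (-((m : ℝ) ^ 2 * t))
  push_cast at this
  rw [norm_mul, ← neg_mul, this, mul_one]

/-- Passing from the observability of single coefficients to that of the whole `ℓ²` norm. -/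
theorem sum_norm_sq_le_of_norm_coeff_le {T P : ℝ} (hT : 0 < T) (hT1 : T ≤ 1) (hP : 1 ≤ P)
    {s : Finset ℕ} (hs : ∀ m ∈ s, 1 ≤ m) (a : ℕ → ℂ)
    (h : ∀ n ∈ s, ‖a n‖ ≤ P * n * ∫ t in (-(T / 2))..(T / 2), ‖expSum s a t‖) :
    ∑ m ∈ s, ‖a m‖ ^ 2 ≤
      10 ^ 5 * P ^ 2 / T ^ 4 * ∫ t in (-(T / 2))..(T / 2), ‖expSum s a t‖ ^ 2 := by
  set A := ∫ t in (-(T / 2))..(T / 2), ‖expSum s a t‖ with hA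
  set B := ∫ t in (-(T / 2))..(T / 2), ‖expSum s a t‖ ^ 2 with hB
  have hA0 : 0 ≤ A := intervalIntegral.integral_nonneg (by linarith) fun _ _ => norm_nonneg _
  have hB0 : 0 ≤ B := intervalIntegral.integral_nonneg (by linarith) fun _ _ => by positivity
  have hAB : A ^ 2 ≤ T * B := sq_integral_norm_le (continuous_expSum s a) hT
  have hAB' : A ^ 2 ≤ B := hAB.trans (mul_le_of_le_one_left hB0 hT1)
  -- With R = T/2, the bound NT ≥ 6 gives N²R² ≥ 9, enough for Ingham's inequality, while N ≤ 7/T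
  -- keeps the losses from the low modes polynomial in 1/T.
  set N : ℕ := ⌈6 / T⌉₊ with hN
  have hN6 : 6 / T ≤ N := Nat.le_ceil _
  have hN7 : (N : ℝ) ≤ 7 / T := by
    have h1 : (N : ℝ) < 6 / T + 1 := Nat.ceil_lt_add_one (by positivity)
    have h2 : 1 ≤ 1 / T := by rw [le_div_iff₀ hT]; linarith
    have h3 : 7 / T = 6 / T + 1 / T := by ring
    linarith
  have hN0 : (0 : ℝ) < N := lt_of_lt_of_le (by positivity) hN6
  set sl := s.filter (fun m => m ≤ N) with hsl
  set sh := s.filter (fun m => ¬ m ≤ N) with hsh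
  have hcard : (sl.card : ℝ) ≤ N := by
    have : sl ⊆ Finset.Icc 1 N := by
      intro m hm
      rw [hsl, Finset.mem_filter] at hm
      exact Finset.mem_Icc.2 ⟨hs m hm.1, hm.2⟩
    have := Finset.card_le_card this
    rw [Nat.card_Icc, Nat.add_sub_cancel] at this
    exact_mod_cast this
  have hlow : ∀ m ∈ sl, ‖a m‖ ≤ P * N * A := by
    intro m hm
    rw [hsl, Finset.mem_filter] at hm
    refine (h m hm.1).trans ?_
    have : (m : ℝ) ≤ N := by exact_mod_cast hm.2
    gcongr
  have hlow2 : ∑ m ∈ sl, ‖a m‖ ^ 2 ≤ N * (P * N * A) ^ 2 := by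
    calc ∑ m ∈ sl, ‖a m‖ ^ 2 ≤ ∑ _m ∈ sl, (P * N * A) ^ 2 := by
          refine Finset.sum_le_sum fun m hm => ?_
          have := hlow m hm
          gcongr
      _ = sl.card * (P * N * A) ^ 2 := by rw [Finset.sum_const, nsmul_eq_mul]
      _ ≤ _ := by gcongr
  have hlow1 : ∀ t, ‖expSum sl a t‖ ≤ N * (P * N * A) := by
    intro t
    calc ‖expSum sl a t‖ ≤ ∑ m ∈ sl, ‖a m‖ := norm_expSum_le _ _ _
      _ ≤ ∑ _m ∈ sl, (P * N * A) := Finset.sum_le_sum hlow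
      _ = sl.card * (P * N * A) := by rw [Finset.sum_const, nsmul_eq_mul]
      _ ≤ _ := by gcongr
  have hc := continuous_expSum s a
  have hch := continuous_expSum sh a
  -- The high part is the whole sum minus the low part, and the coefficient bounds control the
  -- latter uniformly in t.
  have hint : ∫ t in (-(T / 2))..(T / 2), ‖expSum sh a t‖ ^ 2 ≤
      2 * B + 2 * (N * (P * N * A)) ^ 2 * T := by
    have h1 : ∫ t in (-(T / 2))..(T / 2), ‖expSum sh a t‖ ^ 2 ≤
        ∫ t in (-(T / 2))..(T / 2), (2 * ‖expSum s a t‖ ^ 2 + 2 * (N * (P * N * A)) ^ 2) := by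
      refine intervalIntegral.integral_mono_on (by linarith)
        (by apply Continuous.intervalIntegrable; fun_prop)
        (by apply Continuous.intervalIntegrable; fun_prop) fun t _ => ?_
      have e : expSum sh a t = expSum s a t - expSum sl a t := by
        rw [← expSum_filter_add s a (fun m => m ≤ N) t]; ring
      have h2 : ‖expSum sh a t‖ ≤ ‖expSum s a t‖ + N * (P * N * A) := by
        rw [e]
        exact (norm_sub_le _ _).trans (by linarith [hlow1 t])
      have h3 : ‖expSum sh a t‖ ^ 2 ≤ (‖expSum s a t‖ + N * (P * N * A)) ^ 2 := by gcongr
      nlinarith [sq_nonneg (‖expSum s a t‖ - N * (P * N * A))]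
    refine h1.trans (le_of_eq ?_)
    rw [intervalIntegral.integral_add (by apply Continuous.intervalIntegrable; fun_prop)
      (by apply Continuous.intervalIntegrable; fun_prop), intervalIntegral.integral_const_mul,
      intervalIntegral.integral_const, smul_eq_mul, ← hB]
    ring
  have hhigh : ∑ m ∈ sh, ‖a m‖ ^ 2 ≤
      2 / (T / 2) * ∫ t in (-(T / 2))..(T / 2), ‖expSum sh a t‖ ^ 2 := by
    refine sum_norm_sq_le_of_lt hN0 (by positivity) ?_ (fun m hm => ?_) a
    · have h1 : 6 ≤ N * T := by rwa [div_le_iff₀ hT] at hN6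
      nlinarith
    · rw [hsh, Finset.mem_filter, not_le] at hm
      exact_mod_cast hm.2.le
  rw [← Finset.sum_filter_add_sum_filter_not s (fun m => m ≤ N)]
  have hP2 : 1 ≤ P ^ 2 := one_le_pow₀ hP
  have hT4 : T ^ 4 ≤ T ^ 3 := pow_le_pow_of_le_one hT.le hT1 (by norm_num)
  have hT41 : T ^ 4 ≤ T := by
    have := pow_le_pow_of_le_one hT.le hT1 (show 1 ≤ 4 by norm_num)
    rwa [pow_one] at this
  calc _ ≤ N * (P * N * A) ^ 2 + 2 / (T / 2) * (2 * B + 2 * (N * (P * N * A)) ^ 2 * T) := by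
        refine add_le_add hlow2 (hhigh.trans ?_)
        gcongr
    _ = (N : ℝ) ^ 3 * P ^ 2 * A ^ 2 + (8 / T * B + 8 * N ^ 4 * P ^ 2 * A ^ 2) := by
        field_simp
        ring
    _ ≤ (7 / T) ^ 3 * P ^ 2 * B + (8 / T * B + 8 * (7 / T) ^ 4 * P ^ 2 * B) := by gcongr
    _ = (343 / T ^ 3 * P ^ 2 + 8 / T * 1 + 19208 / T ^ 4 * P ^ 2) * B := by ring
    _ ≤ (343 / T ^ 4 * P ^ 2 + 8 / T ^ 4 * P ^ 2 + 19208 / T ^ 4 * P ^ 2) * B := by gcongr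
    _ = 19559 * (P ^ 2 / T ^ 4 * B) := by ring
    _ ≤ 10 ^ 5 * (P ^ 2 / T ^ 4 * B) := by gcongr; norm_num
    _ = _ := by ring

-- The powers of 1/T are absorbed by exp(π²/(100T)), and 2 · 0.5548 + 0.01 = 1.1196 ≤ 1.12.
open Real in
theorem exists_observability :
    ∃ K : ℝ, 0 < K ∧ ∀ T : ℝ, 0 < T → T ≤ 1 → ∀ s : Finset ℕ, (∀ m ∈ s, 1 ≤ m) → ∀ a : ℕ → ℂ,
      ∑ m ∈ s, ‖a m‖ ^ 2 ≤ K * Real.exp (112 / 100 * π ^ 2 / T) *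
        ∫ t in (-(T / 2))..(T / 2), ‖expSum s a t‖ ^ 2 := by
  -- 10²⁹ = 10⁵ · (10¹²)² comes from the two preceding bounds, and 8! · 100⁸ from comparing T⁻⁸ with
  -- exp(1/(100T)).
  refine ⟨10 ^ 29 * (40320 * 100 ^ 8), by positivity, fun T hT hT1 s hs a => ?_⟩
  have hpi3 := Real.pi_gt_three
  set P : ℝ := 10 ^ 12 / T ^ 2 * Real.exp (5548 / 10000 * π ^ 2 / T) with hP
  have hP1 : 1 ≤ P := by
    have h1 : 1 ≤ Real.exp (5548 / 10000 * π ^ 2 / T) := Real.one_le_exp (by positivity)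
    have h2 : (1 : ℝ) ≤ 10 ^ 12 / T ^ 2 := by
      rw [le_div_iff₀ (by positivity)]
      have : T ^ 2 ≤ 1 := pow_le_one₀ hT.le hT1
      linarith
    exact one_le_mul_of_one_le_of_one_le h2 h1
  refine (sum_norm_sq_le_of_norm_coeff_le hT hT1 hP1 hs a
    fun n hn => norm_coeff_le hT hT1 hs a hn).trans ?_
  refine mul_le_mul_of_nonneg_right ?_ (intervalIntegral.integral_nonneg (by linarith)
    fun _ _ => by positivity)
  have h8 : (1 / T) ^ 8 ≤ 40320 * 100 ^ 8 * Real.exp (1 / 100 * π ^ 2 / T) := by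
    have h1 := Real.pow_div_factorial_le_exp (1 / 100 * (1 / T)) (by positivity) 8
    have h2 : Real.exp (1 / 100 * (1 / T)) ≤ Real.exp (1 / 100 * π ^ 2 / T) := by
      rw [Real.exp_le_exp, mul_one_div]
      gcongr
      nlinarith
    have h3 := h1.trans h2
    have e : ((8 : ℕ).factorial : ℝ) = 40320 := by norm_num [Nat.factorial]
    rw [e, div_le_iff₀ (by norm_num), mul_pow] at h3
    norm_num at h3 ⊢
    linarith
  have e1 : Real.exp (112 / 100 * π ^ 2 / T) ≥
      Real.exp (1 / 100 * π ^ 2 / T) * Real.exp (5548 / 10000 * π ^ 2 / T) ^ 2 := by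
    rw [← Real.exp_nat_mul, ← Real.exp_add, ge_iff_le, Real.exp_le_exp]
    have : 1 / 100 * π ^ 2 / T + (2 : ℕ) * (5548 / 10000 * π ^ 2 / T) =
        (11196 / 10000) * (π ^ 2 / T) := by push_cast; ring
    rw [this, mul_div_assoc]
    exact mul_le_mul_of_nonneg_right (by norm_num) (by positivity)
  calc 10 ^ 5 * P ^ 2 / T ^ 4 =
        10 ^ 29 * ((1 / T) ^ 8 * Real.exp (5548 / 10000 * π ^ 2 / T) ^ 2) := by
        rw [hP]; field_simp
    _ ≤ 10 ^ 29 * (40320 * 100 ^ 8 * Real.exp (1 / 100 * π ^ 2 / T) *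
        Real.exp (5548 / 10000 * π ^ 2 / T) ^ 2) := by gcongr
    _ = 10 ^ 29 * (40320 * 100 ^ 8) * (Real.exp (1 / 100 * π ^ 2 / T) *
        Real.exp (5548 / 10000 * π ^ 2 / T) ^ 2) := by ring
    _ ≤ _ := by gcongr

/-- The frequencies `μₘ = (m π / L)²` of the Schrödinger equation on `(0, L)`. -/
def freq (L : ℝ) (m : ℕ) : ℝ := (m * Real.pi / L) ^ 2

open Real in
/-- The boundary observability of the Schrödinger equation in small time, on finite sums. -/
theorem exists_observability_freq {L : ℝ} (hL : 0 < L) :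
    ∃ K : ℝ, 0 < K ∧ ∀ T : ℝ, 0 < T → T * (π / L) ^ 2 ≤ 1 → ∀ s : Finset ℕ,
      (∀ m ∈ s, 1 ≤ m) → ∀ a : ℕ → ℂ,
      ∑ m ∈ s, ‖a m‖ ^ 2 ≤ K * Real.exp (112 / 100 * L ^ 2 / T) *
        ∫ t in (0 : ℝ)..T, ‖∑ m ∈ s, a m * Complex.exp (-(freq L m * t * Complex.I))‖ ^ 2 := by
  obtain ⟨K, hK, h⟩ := exists_observability
  have hpi := Real.pi_pos
  set θ : ℝ := (π / L) ^ 2 with hθ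
  have hθ0 : 0 < θ := by positivity
  refine ⟨K * θ, by positivity, fun T hT hT1 s hs a => ?_⟩
  set T' : ℝ := T * θ with hT'
  have hT'0 : 0 < T' := by positivity
  -- Phases of modulus one move the window (-T'/2, T'/2) to (0, T').
  set a' : ℕ → ℂ := fun m => a m * Complex.exp (-((m : ℂ) ^ 2 * (T' / 2 : ℝ) * Complex.I)) with ha'
  have h1 := h T' hT'0 hT1 s hs a'
  have hn : ∀ m, ‖a' m‖ = ‖a m‖ := by
    intro m
    have := Complex.norm_exp_ofReal_mul_I (-((m : ℝ) ^ 2 * (T' / 2)))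
    rw [ha', norm_mul, ← neg_mul]
    push_cast at this ⊢
    rw [this, mul_one]
  simp only [hn] at h1
  have hexp : 112 / 100 * π ^ 2 / T' = 112 / 100 * L ^ 2 / T := by
    rw [hT', hθ]; field_simp
  rw [hexp] at h1
  have hint : ∫ t in (-(T' / 2))..(T' / 2), ‖expSum s a' t‖ ^ 2 =
      θ * ∫ t in (0 : ℝ)..T, ‖∑ m ∈ s, a m * Complex.exp (-(freq L m * t * Complex.I))‖ ^ 2 := by
    have e1 : ∀ t : ℝ, expSum s a' t = expSum s a (t + T' / 2) := by
      intro t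
      unfold expSum
      refine Finset.sum_congr rfl fun m _ => ?_
      rw [ha', mul_assoc, ← Complex.exp_add]
      push_cast
      ring_nf
    have e2 : ∀ t : ℝ, ∑ m ∈ s, a m * Complex.exp (-(freq L m * t * Complex.I)) =
        expSum s a (θ * t) := by
      intro t
      unfold expSum
      refine Finset.sum_congr rfl fun m _ => ?_
      have : (freq L m : ℂ) = (m : ℂ) ^ 2 * θ := by
        have : freq L m = (m : ℝ) ^ 2 * θ := by rw [freq, hθ]; ring
        rw [this]; push_cast; rfl
      rw [this]
      push_cast
      ring_nf
    simp only [e1, e2]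
    rw [intervalIntegral.integral_comp_add_right (fun t => ‖expSum s a t‖ ^ 2),
      ← smul_eq_mul θ, intervalIntegral.smul_integral_comp_mul_left
      (fun t => ‖expSum s a t‖ ^ 2), mul_zero, neg_add_cancel, add_halves, hT', mul_comm]
  rw [hint] at h1
  calc _ ≤ _ := h1
    _ = _ := by ring

/-! ### Continuous functions in L² and the basis of cosines -/

theorem memLp_of_continuous {f : ℝ → ℂ} (hf : Continuous f) (a : ℝ) :
    MemLp f 2 (volume.restrict (Ioo (0 : ℝ) a)) := by
  obtain ⟨C, hC⟩ := (isCompact_Icc (a := (0 : ℝ)) (b := a)).exists_bound_of_continuousOn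
    hf.continuousOn
  refine MemLp.of_bound hf.aestronglyMeasurable C ?_
  exact (ae_restrict_iff' measurableSet_Ioo).2
    (Eventually.of_forall fun x hx => hC x ⟨hx.1.le, hx.2.le⟩)

/-- A continuous function as an element of `L²(0, a)`. -/
def contVec (a : ℝ) : C(ℝ, ℂ) →ₗ[ℂ] L2 a where
  toFun f := (memLp_of_continuous f.continuous a).toLp f
  map_add' f g := MemLp.toLp_add (memLp_of_continuous f.continuous a)
    (memLp_of_continuous g.continuous a)
  map_smul' c f := MemLp.toLp_const_smul c (memLp_of_continuous f.continuous a)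

theorem contVec_ae (a : ℝ) (f : C(ℝ, ℂ)) :
    ∀ᵐ x ∂(volume.restrict (Ioo (0 : ℝ) a)), contVec a f x = f x :=
  (memLp_of_continuous f.continuous a).coeFn_toLp

theorem integral_Ioo_eq {a : ℝ} (ha : 0 ≤ a) (f : ℝ → ℂ) :
    ∫ t in Ioo (0 : ℝ) a, f t = ∫ t in (0 : ℝ)..a, f t := by
  rw [intervalIntegral.integral_of_le ha, integral_Ioc_eq_integral_Ioo]

theorem inner_contVec {a : ℝ} (ha : 0 ≤ a) (f : C(ℝ, ℂ)) (g : L2 a) :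
    inner ℂ (contVec a f) g = ∫ t in (0 : ℝ)..a, (starRingEnd ℂ) (f t) * g t := by
  rw [MeasureTheory.L2.inner_def, ← integral_Ioo_eq ha]
  refine integral_congr_ae ?_
  filter_upwards [contVec_ae a f] with t ht
  rw [ht, RCLike.inner_apply, mul_comm]

theorem integral_mul_contVec {a x : ℝ} (h0 : 0 ≤ x) (hx : x ≤ a) (f : ℝ → ℂ) (g : C(ℝ, ℂ)) :
    ∫ t in (0 : ℝ)..x, f t * contVec a g t = ∫ t in (0 : ℝ)..x, f t * g t := by
  rw [intervalIntegral.integral_of_le h0, intervalIntegral.integral_of_le h0]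
  refine integral_congr_ae ?_
  filter_upwards [ae_Ioc_of_ae_Ioo hx (contVec_ae a g)] with t ht
  rw [ht]

theorem inner_contVec_contVec {a : ℝ} (ha : 0 ≤ a) (f g : C(ℝ, ℂ)) :
    inner ℂ (contVec a f) (contVec a g) = ∫ t in (0 : ℝ)..a, (starRingEnd ℂ) (f t) * g t := by
  rw [inner_contVec ha, integral_mul_contVec ha le_rfl]

theorem norm_sq_eq_integral {a : ℝ} (ha : 0 ≤ a) (g : L2 a) :
    ‖g‖ ^ 2 = ∫ t in (0 : ℝ)..a, ‖g t‖ ^ 2 := by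
  have h5 : ((‖g‖ ^ 2 : ℝ) : ℂ) = ((∫ x in (0 : ℝ)..a, ‖g x‖ ^ 2 : ℝ) : ℂ) := by
    rw [← intervalIntegral.integral_ofReal, ← integral_Ioo_eq ha]
    have := inner_self_eq_norm_sq_to_K (𝕜 := ℂ) g
    rw [MeasureTheory.L2.inner_def] at this
    push_cast
    refine this.symm.trans ?_
    congr 1
    funext t
    rw [RCLike.inner_apply, Complex.mul_conj']
  exact_mod_cast h5

theorem intervalIntegrable_norm_sq {a : ℝ} (ha : 0 ≤ a) (g : L2 a) :
    IntervalIntegrable (fun x => ‖g x‖ ^ 2) volume 0 a := by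
  rw [intervalIntegrable_iff_integrableOn_Ioc_of_le ha,
    integrableOn_congr_set_ae (Ioo_ae_eq_Ioc (μ := volume)).symm]
  exact (memLp_two_iff_integrable_sq_norm (Lp.memLp g).1).1 (Lp.memLp g)

theorem norm_sq_contVec {a : ℝ} (ha : 0 ≤ a) (f : C(ℝ, ℂ)) :
    ‖contVec a f‖ ^ 2 = ∫ t in (0 : ℝ)..a, ‖f t‖ ^ 2 := by
  have h : ((‖contVec a f‖ ^ 2 : ℝ) : ℂ) = ((∫ t in (0 : ℝ)..a, ‖f t‖ ^ 2 : ℝ) : ℂ) := by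
    rw [← intervalIntegral.integral_ofReal]
    have := inner_self_eq_norm_sq_to_K (𝕜 := ℂ) (contVec a f)
    rw [inner_contVec_contVec ha] at this
    push_cast
    refine this.symm.trans ?_
    congr 1
    funext t
    rw [Complex.conj_mul']
  exact_mod_cast h

/-- Lebesgue differentiation: almost everywhere the vanishing primitive has derivative g. -/
theorem ae_eq_zero_of_forall_integral_eq_zero {a : ℝ} (ha : 0 ≤ a) (g : L2 a)
    (h : ∀ x ∈ Icc (0 : ℝ) a, ∫ t in (0 : ℝ)..x, g t = 0) : g = 0 := by
  have hi := L2.intervalIntegrable ha le_rfl g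
  have h1 := hi.ae_hasDerivAt_integral
  refine (Lp.eq_zero_iff_ae_eq_zero).2 ?_
  refine (ae_restrict_iff' measurableSet_Ioo).2 ?_
  filter_upwards [h1] with x hx hx0
  rw [uIcc_of_le ha] at hx
  have h2 := hx ⟨hx0.1.le, hx0.2.le⟩ 0 ⟨le_rfl, ha⟩
  have h3 : (fun y => ∫ t in (0 : ℝ)..y, g t) =ᶠ[𝓝 x] fun _ => 0 := by
    filter_upwards [Ioo_mem_nhds hx0.1 hx0.2] with y hy
    exact h y ⟨hy.1.le, hy.2.le⟩
  exact ((hasDerivAt_const x (0 : ℂ)).congr_of_eventuallyEq h3).unique h2 |>.symm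

/-- The normalization of the `n`-th cosine. -/
def cosNorm (L : ℝ) (n : ℕ) : ℝ := if n = 0 then √(1 / L) else √(2 / L)

open Real in
/-- The normalized cosines. -/
def cosMap (L : ℝ) (n : ℕ) : C(ℝ, ℂ) :=
  ⟨fun x => (cosNorm L n * Real.cos (n * π / L * x) : ℝ), by fun_prop⟩

open Real in
theorem integral_cos_int {L : ℝ} (hL : 0 < L) {k : ℤ} (hk : k ≠ 0) :
    ∫ x in (0 : ℝ)..L, Real.cos (k * π / L * x) = 0 := by
  have hk' : (k : ℝ) ≠ 0 := by exact_mod_cast hk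
  have hpi := Real.pi_pos
  rw [intervalIntegral.integral_comp_mul_left _ (by positivity), integral_cos,
    div_mul_cancel₀ _ hL.ne', Real.sin_int_mul_pi]
  simp

open Real in
theorem integral_cos_mul_cos {L : ℝ} (hL : 0 < L) (m n : ℕ) :
    ∫ x in (0 : ℝ)..L, Real.cos (m * π / L * x) * Real.cos (n * π / L * x) =
      if m = n then (if n = 0 then L else L / 2) else 0 := by
  have e : ∀ y : ℝ, Real.cos (m * π / L * y) * Real.cos (n * π / L * y) =
      1 / 2 * (Real.cos ((m - n : ℤ) * π / L * y) + Real.cos ((m + n : ℤ) * π / L * y)) := by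
    intro y
    have e1 : ((m - n : ℤ) : ℝ) * π / L * y = m * π / L * y - n * π / L * y := by push_cast; ring
    have e2 : ((m + n : ℤ) : ℝ) * π / L * y = m * π / L * y + n * π / L * y := by push_cast; ring
    rw [e1, e2, Real.cos_sub, Real.cos_add]
    ring
  simp only [e]
  rw [intervalIntegral.integral_const_mul, intervalIntegral.integral_add
    (by apply Continuous.intervalIntegrable; fun_prop)
    (by apply Continuous.intervalIntegrable; fun_prop)]
  split_ifs with h1 h2
  · subst h1
    subst h2
    simp
    ring
  · rw [integral_cos_int hL (k := m + n) (by omega), h1]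
    simp
    ring
  · rw [integral_cos_int hL (k := m + n) (by omega), integral_cos_int hL (by omega)]
    simp

theorem cosNorm_sq {L : ℝ} (hL : 0 < L) (n : ℕ) :
    cosNorm L n * cosNorm L n = if n = 0 then 1 / L else 2 / L := by
  rw [cosNorm]
  split_ifs <;> exact Real.mul_self_sqrt (by positivity)

theorem orthonormal_cosMap {L : ℝ} (hL : 0 < L) :
    Orthonormal ℂ (fun n => contVec L (cosMap L n)) := by
  classical
  rw [orthonormal_iff_ite]
  intro m n
  rw [inner_contVec_contVec hL.le]
  have e : ∀ t : ℝ, (starRingEnd ℂ) (cosMap L m t) * cosMap L n t =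
      ((cosNorm L m * cosNorm L n *
        (Real.cos (m * Real.pi / L * t) * Real.cos (n * Real.pi / L * t)) : ℝ) : ℂ) := by
    intro t
    simp only [cosMap, ContinuousMap.coe_mk, Complex.conj_ofReal]
    push_cast
    ring
  simp only [e]
  rw [intervalIntegral.integral_ofReal, intervalIntegral.integral_const_mul,
    integral_cos_mul_cos hL]
  split_ifs with h1 h2
  · rw [h1, cosNorm_sq hL, if_pos h2]
    rw [one_div, inv_mul_cancel₀ hL.ne', Complex.ofReal_one]
  · rw [h1, cosNorm_sq hL, if_neg h2]
    rw [div_mul_div_comm, mul_comm, div_self (by positivity), Complex.ofReal_one]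
  · simp

theorem measurable_abs_comp {g : ℝ → ℂ} (hg : StronglyMeasurable g) :
    StronglyMeasurable fun x : ℝ => g |x| := hg.comp_measurable (by fun_prop)

theorem integrableOn_comp_abs {E : Type*} [NormedAddCommGroup E] {f : ℝ → E} {L : ℝ}
    (hL : 0 ≤ L) (hf : IntervalIntegrable f volume 0 L) :
    IntervalIntegrable (fun x => f |x|) volume (-L) L := by
  have h1 : IntervalIntegrable (fun x => f |x|) volume 0 L := by
    refine hf.congr fun x hx => ?_
    rw [uIoc_of_le hL] at hx
    simp only [abs_of_pos hx.1]
  have h2 : IntervalIntegrable (fun x => f |x|) volume (-L) 0 := by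
    have := (IntervalIntegrable.iff_comp_neg (f := fun x => f |x|) (by simp)).1 h1
    simp only [abs_neg, neg_zero] at this
    exact this.symm
  exact h2.trans h1

theorem integral_even {E : Type*} [NormedAddCommGroup E] [NormedSpace ℝ E] {f : ℝ → E} {L : ℝ}
    (h1 : IntervalIntegrable f volume (-L) 0) (h2 : IntervalIntegrable f volume 0 L) :
    ∫ x in (-L)..L, f x = ∫ x in (0 : ℝ)..L, (f x + f (-x)) := by
  have h3 : IntervalIntegrable (fun x => f (-x)) volume 0 L := by
    have := (IntervalIntegrable.iff_comp_neg (f := f) (by simp)).1 h1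
    simp only [neg_neg, neg_zero] at this
    exact this.symm
  rw [intervalIntegral.integral_add h2 h3, intervalIntegral.integral_comp_neg, neg_zero, add_comm,
    intervalIntegral.integral_add_adjacent_intervals h1 h2]

/-- The even reflection of g to [-L, L] has only cosine coefficients, which vanish by hypothesis, so
Parseval's identity for Fourier series gives g = 0. -/
theorem eq_zero_of_inner_cosMap_eq_zero {L : ℝ} (hL : 0 < L) (g : L2 L)
    (h : ∀ n, inner ℂ (contVec L (cosMap L n)) g = 0) : g = 0 := by
  have hab : -L < L := by linarith
  have hgi := L2.intervalIntegrable hL.le le_rfl g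
  have hg2 := intervalIntegrable_norm_sq hL.le g
  set F : ℝ → ℂ := fun x => g |x| with hF
  have hFi : IntervalIntegrable F volume (-L) L := integrableOn_comp_abs hL.le hgi
  have hF2 : IntervalIntegrable (fun x => ‖F x‖ ^ 2) volume (-L) L :=
    integrableOn_comp_abs (f := fun x => ‖g x‖ ^ 2) hL.le hg2
  have hFm : MemLp F 2 (volume.restrict (Ioc (-L) L)) := by
    refine (memLp_two_iff_integrable_sq_norm ?_).2 ?_
    · exact (measurable_abs_comp (Lp.stronglyMeasurable g)).aestronglyMeasurable
    · exact (intervalIntegrable_iff_integrableOn_Ioc_of_le hab.le).1 hF2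
  have hcos : ∀ n : ℕ, ∫ x in (0 : ℝ)..L, (Real.cos (n * Real.pi / L * x) : ℂ) * g x = 0 := by
    intro n
    have h1 := h n
    rw [inner_contVec hL.le] at h1
    have e : ∀ t : ℝ, (starRingEnd ℂ) (cosMap L n t) * g t =
        (cosNorm L n : ℂ) * ((Real.cos (n * Real.pi / L * t) : ℂ) * g t) := by
      intro t
      simp only [cosMap, ContinuousMap.coe_mk, Complex.conj_ofReal]
      push_cast
      ring
    simp only [e] at h1
    rw [intervalIntegral.integral_const_mul] at h1
    refine (mul_eq_zero.1 h1).resolve_left ?_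
    have : cosNorm L n ≠ 0 := by
      intro h0
      have := cosNorm_sq hL n
      rw [h0] at this
      split_ifs at this <;> field_simp at this <;> simp at this
    exact_mod_cast this
  have hcoef : ∀ k : ℤ, fourierCoeffOn hab F k = 0 := by
    intro k
    rw [fourierCoeffOn_eq_integral]
    have hc : ∀ x : ℝ, fourier (-k) (x : AddCircle (L - -L)) =
        Complex.exp (-(k * Real.pi / L * x : ℝ) * Complex.I) := by
      intro x
      rw [fourier_coe_apply]
      congr 1
      have : (L : ℂ) ≠ 0 := by exact_mod_cast hL.ne'
      push_cast
      field_simp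
      ring
    have hsm : ∀ a b : ℝ, IntervalIntegrable F volume a b → IntervalIntegrable
        (fun x => Complex.exp (-(k * Real.pi / L * x : ℝ) * Complex.I) * F x) volume a b :=
      fun a b hi => hi.continuousOn_mul (by fun_prop)
    have hi1 : IntervalIntegrable F volume (-L) 0 := hFi.mono_set (by
      rw [uIcc_of_le (by linarith), uIcc_of_le (by linarith)]
      exact Icc_subset_Icc le_rfl hL.le)
    have hi2 : IntervalIntegrable F volume 0 L := hFi.mono_set (by
      rw [uIcc_of_le (by linarith), uIcc_of_le (by linarith)]
      exact Icc_subset_Icc (by linarith) le_rfl)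
    simp only [hc, smul_eq_mul]
    rw [integral_even (hsm _ _ hi1) (hsm _ _ hi2)]
    have e : ∫ x in (0 : ℝ)..L, (Complex.exp (-(k * Real.pi / L * x : ℝ) * Complex.I) * F x +
        Complex.exp (-(k * Real.pi / L * (-x) : ℝ) * Complex.I) * F (-x)) =
        ∫ x in (0 : ℝ)..L, 2 * ((Real.cos (k.natAbs * Real.pi / L * x) : ℂ) * g x) := by
      refine intervalIntegral.integral_congr fun x hx => ?_
      rw [uIcc_of_le hL.le] at hx
      simp only [hF, abs_neg, abs_of_nonneg hx.1]
      have hcosk : Real.cos (k.natAbs * Real.pi / L * x) = Real.cos (k * Real.pi / L * x) := by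
        rw [Nat.cast_natAbs, Int.cast_abs]
        rcases abs_choice (k : ℝ) with h | h <;> rw [h]
        rw [← Real.cos_neg]
        ring_nf
      rw [hcosk, ← add_mul, ← mul_assoc]
      congr 1
      rw [Complex.ofReal_cos, Complex.two_cos, add_comm]
      congr 2
      push_cast
      ring
    rw [e, intervalIntegral.integral_const_mul, hcos, mul_zero, smul_zero]
  have hsum := hasSum_sq_fourierCoeffOn hab hFm
  simp only [hcoef, norm_zero, ne_eq, OfNat.ofNat_ne_zero, not_false_eq_true, zero_pow] at hsum
  have h0 : ∫ x in (-L)..L, ‖F x‖ ^ 2 = 0 := by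
    have := hsum.unique hasSum_zero
    rw [smul_eq_mul] at this
    exact (mul_eq_zero.1 this).resolve_left (inv_ne_zero (by linarith))
  have hz : ∫ x in (0 : ℝ)..L, ‖g x‖ ^ 2 = 0 := by
    have h1 : ∫ x in (0 : ℝ)..L, ‖F x‖ ^ 2 ≤ ∫ x in (-L)..L, ‖F x‖ ^ 2 :=
      intervalIntegral.integral_mono_interval (by linarith) hL.le le_rfl
        (Eventually.of_forall fun x => by positivity) hF2
    have h2 : ∫ x in (0 : ℝ)..L, ‖F x‖ ^ 2 = ∫ x in (0 : ℝ)..L, ‖g x‖ ^ 2 := by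
      refine intervalIntegral.integral_congr fun x hx => ?_
      rw [uIcc_of_le hL.le] at hx
      simp only [hF, abs_of_nonneg hx.1]
    have h3 : 0 ≤ ∫ x in (0 : ℝ)..L, ‖g x‖ ^ 2 :=
      intervalIntegral.integral_nonneg hL.le fun _ _ => by positivity
    linarith
  rw [← norm_eq_zero, ← sq_eq_zero_iff, norm_sq_eq_integral hL.le, hz]

/-- The cosines are a Hilbert basis of `L²(0, L)`. -/
def cosBasis {L : ℝ} (hL : 0 < L) : HilbertBasis ℕ ℂ (L2 L) :=
  HilbertBasis.mkOfOrthogonalEqBot (orthonormal_cosMap hL) (by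
    rw [Submodule.eq_bot_iff]
    intro g hg
    refine eq_zero_of_inner_cosMap_eq_zero hL g fun n => ?_
    exact (Submodule.mem_orthogonal _ _).1 hg _ (Submodule.subset_span ⟨n, rfl⟩))

theorem cosBasis_apply {L : ℝ} (hL : 0 < L) (n : ℕ) :
    cosBasis hL n = contVec L (cosMap L n) := by
  rw [cosBasis, HilbertBasis.coe_mkOfOrthogonalEqBot]

/-! ### Moment problems in a Hilbert space -/

section Riesz

variable {H : Type*} [NormedAddCommGroup H] [InnerProductSpace ℂ H] [CompleteSpace H]

/-- A functional on a subspace of a Hilbert space is represented by a vector of the same norm. -/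
theorem exists_inner_eq_of_subspace (p : Submodule ℂ H) (f : StrongDual ℂ p) :
    ∃ u : H, (∀ x : p, inner ℂ u (x : H) = f x) ∧ ‖u‖ = ‖f‖ := by
  obtain ⟨g, hg, hn⟩ := exists_extension_norm_eq p f
  refine ⟨(InnerProductSpace.toDual ℂ H).symm g, fun x => ?_, ?_⟩
  · rw [InnerProductSpace.toDual_symm_apply, hg]
  · rw [LinearIsometryEquiv.norm_map, hn]

/-- A functional on an isometrically embedded space is represented by a vector. -/
theorem exists_inner_eq_of_isometry {E : Type*} [NormedAddCommGroup E] [NormedSpace ℂ E]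
    (G : E →ₗᵢ[ℂ] H) (f : StrongDual ℂ E) :
    ∃ u : H, (∀ x : E, inner ℂ u (G x) = f x) ∧ ‖u‖ ≤ ‖f‖ := by
  obtain ⟨u, hu, hn⟩ := exists_inner_eq_of_subspace (LinearMap.range G.toLinearMap)
    (f.comp (G.equivRange.symm.toContinuousLinearEquiv : _ →L[ℂ] E))
  refine ⟨u, fun x => ?_, ?_⟩
  · have := hu (G.equivRange x)
    simpa using! this
  · rw [hn]
    refine ContinuousLinearMap.opNorm_le_bound _ (norm_nonneg f) fun x => ?_
    refine (f.le_opNorm _).trans_eq ?_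
    congr 1
    exact G.equivRange.symm.norm_map x

/-- The moment problem `⟨E i, u⟩ = β i` is solvable when the family `E` is bounded below. -/
theorem exists_inner_eq_of_bounded_below {ι : Type*} (E : ι → H) {C B : ℝ} (hC : 0 ≤ C)
    (hB : 0 ≤ B) (β : ι → ℂ)
    (hE : ∀ (s : Finset ι) (a : ι → ℂ), ∑ m ∈ s, ‖a m‖ ^ 2 ≤ C ^ 2 * ‖∑ m ∈ s, a m • E m‖ ^ 2)
    (hβ : ∀ s : Finset ι, ∑ m ∈ s, ‖β m‖ ^ 2 ≤ B ^ 2) :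
    ∃ u : H, (∀ n, inner ℂ (E n) u = β n) ∧ ‖u‖ ≤ C * B := by
  -- The lower bound makes coefficients unique, so Σ aₘEₘ ↦ Σ aₘ conj(βₘ) is well defined on the
  -- span. The conjugate compensates for the representing vector standing in the antilinear slot.
  have hli : LinearIndependent ℂ E := by
    rw [linearIndependent_iff']
    intro s a ha i hi
    have h1 := hE s a
    rw [ha, norm_zero, zero_pow two_ne_zero, mul_zero] at h1
    have h2 := Finset.single_le_sum (f := fun m => ‖a m‖ ^ 2) (fun _ _ => by positivity) hi
    have h3 : ‖a i‖ ^ 2 = 0 := le_antisymm (h2.trans h1) (by positivity)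
    simpa using h3
  set p := Submodule.span ℂ (Set.range E)
  set f : p →ₗ[ℂ] ℂ := (Finsupp.linearCombination ℂ fun i => (starRingEnd ℂ) (β i)).comp hli.repr
  have hf : ∀ x : p, ‖f x‖ ≤ C * B * ‖x‖ := by
    intro x
    set l := hli.repr x with hl
    have hx : ∑ i ∈ l.support, l i • E i = x := by
      have := hli.linearCombination_repr x
      rwa [Finsupp.linearCombination_apply, Finsupp.sum] at this
    have hfx : f x = ∑ i ∈ l.support, l i * (starRingEnd ℂ) (β i) := by
      change Finsupp.linearCombination ℂ _ l = _
      rw [Finsupp.linearCombination_apply, Finsupp.sum]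
      rfl
    have h1 : ‖f x‖ ≤ ∑ i ∈ l.support, ‖l i‖ * ‖β i‖ := by
      rw [hfx]
      refine (norm_sum_le _ _).trans_eq ?_
      refine Finset.sum_congr rfl fun i _ => ?_
      rw [norm_mul, RCLike.norm_conj]
    have h2 := Finset.sum_mul_sq_le_sq_mul_sq l.support (fun i => ‖l i‖) fun i => ‖β i‖
    have h3 := hE l.support l
    rw [hx] at h3
    have h4 : (∑ i ∈ l.support, ‖l i‖ * ‖β i‖) ^ 2 ≤ (C * B * ‖x‖) ^ 2 := by
      refine h2.trans ?_
      calc _ ≤ (C ^ 2 * ‖(x : H)‖ ^ 2) * B ^ 2 := by gcongr; exact hβ _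
        _ = _ := by rw [Submodule.coe_norm]; ring
    exact h1.trans (abs_le_of_sq_le_sq' h4 (by positivity)).2
  obtain ⟨u, hu, hn⟩ := exists_inner_eq_of_subspace p (f.mkContinuous (C * B) hf)
  refine ⟨u, fun n => ?_, ?_⟩
  · have h1 := hu ⟨E n, Submodule.subset_span ⟨n, rfl⟩⟩
    rw [LinearMap.mkContinuous_apply] at h1
    have h2 : f ⟨E n, Submodule.subset_span ⟨n, rfl⟩⟩ = (starRingEnd ℂ) (β n) := by
      change Finsupp.linearCombination ℂ _ (hli.repr _) = _
      rw [hli.repr_eq_single n _ rfl, Finsupp.linearCombination_single, one_smul]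
    rw [h2] at h1
    rw [← inner_conj_symm, h1, Complex.conj_conj]
  · rw [hn]
    exact LinearMap.mkContinuous_norm_le _ (by positivity) _

end Riesz

/-! ### H⁻¹ through the gradient, integration by parts, Bessel's inequality -/

/-- The derivative as an isometric embedding of `H¹₀` in `L²`. -/
def gradIsometry (L : ℝ) : H10 L →ₗᵢ[ℂ] L2 L := ⟨H10.grad L, fun _ => rfl⟩

/-- The functional on `H¹₀` that is represented by an element of `L²`. -/
def ofL2 (L : ℝ) (x : L2 L) : HNegOne L :=
  (innerSL ℂ x).comp (gradIsometry L).toContinuousLinearMap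

theorem ofL2_apply (L : ℝ) (x : L2 L) (φ : H10 L) : ofL2 L x φ = inner ℂ x (H10.grad L φ) := rfl

theorem continuous_ofL2 (L : ℝ) : Continuous (ofL2 L) :=
  ((innerSL ℂ (E := L2 L)).continuous).clm_comp continuous_const

/-- Integration by parts against a control that is merely integrable needs both the derivative
almost everywhere and the absolute continuity of the primitive. -/
theorem exists_absolutelyContinuous_primitive {g : ℝ → ℂ} {T : ℝ} (hT : 0 ≤ T)
    (hg : IntervalIntegrable g volume 0 T) :
    ∃ P : ℝ → ℂ, AbsolutelyContinuousOnInterval P 0 T ∧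
      (∀ x ∈ Icc 0 T, P x = ∫ r in (0 : ℝ)..x, g r) ∧
      ∀ᵐ x, x ∈ uIcc 0 T → HasDerivAt P (g x) x := by
  have hre : IntervalIntegrable (fun x => (g x).re) volume 0 T := ⟨hg.1.re, hg.2.re⟩
  have him : IntervalIntegrable (fun x => (g x).im) volume 0 T := ⟨hg.1.im, hg.2.im⟩
  have hc : ∀ c : ℂ, AbsolutelyContinuousOnInterval (fun _ : ℝ => c) 0 T := fun c =>
    ContDiffOn.absolutelyContinuousOnInterval contDiffOn_const
  refine ⟨fun x => (∫ r in (0 : ℝ)..x, (g r).re) • (1 : ℂ) +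
    (∫ r in (0 : ℝ)..x, (g r).im) • Complex.I,
    ((hre.absolutelyContinuousOnInterval_intervalIntegral left_mem_uIcc).smul
      (hc 1)).add ((him.absolutelyContinuousOnInterval_intervalIntegral left_mem_uIcc).smul
      (hc Complex.I)), fun x hx => ?_, ?_⟩
  · have hgx : IntervalIntegrable g volume 0 x := hg.mono_set (by
      rw [uIcc_of_le hx.1, uIcc_of_le hT]
      exact Icc_subset_Icc_right hx.2)
    have h1 : (∫ r in (0 : ℝ)..x, (g r).re) = (∫ r in (0 : ℝ)..x, g r).re :=
      Complex.reCLM.intervalIntegral_comp_comm hgx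
    have h2 : (∫ r in (0 : ℝ)..x, (g r).im) = (∫ r in (0 : ℝ)..x, g r).im :=
      Complex.imCLM.intervalIntegral_comp_comm hgx
    simp only [h1, h2, Complex.real_smul, mul_one]
    exact Complex.re_add_im _
  · filter_upwards [hre.ae_hasDerivAt_integral, him.ae_hasDerivAt_integral] with x h1 h2 hx
    have h3 := ((h1 hx 0 left_mem_uIcc).smul_const (1 : ℂ)).add
      ((h2 hx 0 left_mem_uIcc).smul_const Complex.I)
    convert! h3 using 1
    rw [Complex.real_smul, Complex.real_smul, mul_one, Complex.re_add_im]

/-- Integration by parts for the primitive of an integrable function. -/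
theorem mul_integral_eq_integral {f E E' : ℝ → ℂ} {T : ℝ} (hT : 0 ≤ T)
    (hf : IntervalIntegrable f volume 0 T) (hE : ContDiff ℝ 1 E) (hc : Continuous E')
    (hE' : ∀ t, HasDerivAt E (E' t) t) :
    E T * ∫ s in (0 : ℝ)..T, f s =
      (∫ s in (0 : ℝ)..T, E' s * ∫ r in (0 : ℝ)..s, f r) + ∫ s in (0 : ℝ)..T, E s * f s := by
  obtain ⟨P, hP, hP1, hP2⟩ := exists_absolutelyContinuous_primitive hT hf
  have hi1 : IntervalIntegrable (fun s => E' s * P s) volume 0 T :=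
    (hc.continuousOn.mul hP.continuousOn).intervalIntegrable
  have hi2 : IntervalIntegrable (fun s => E s * f s) volume 0 T :=
    hf.continuousOn_mul hE.continuous.continuousOn
  -- E P minus this primitive of E'P + E f is absolutely continuous with zero derivative almost
  -- everywhere, hence constant.
  obtain ⟨R, hR, hR1, hR2⟩ := exists_absolutelyContinuous_primitive hT (hi1.add hi2)
  have hG : AbsolutelyContinuousOnInterval (fun x => E x • P x - R x) 0 T :=
    ((ContDiffOn.absolutelyContinuousOnInterval hE.contDiffOn).smul hP).sub hR
  have hG0 : ∀ᵐ x, x ∈ uIcc 0 T → HasDerivAt (fun x => E x • P x - R x) 0 x := by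
    filter_upwards [hP2, hR2] with x h1 h2 hx
    convert! ((hE' x).mul (h1 hx)).sub (h2 hx) using 1
    simp
  obtain ⟨C, hC⟩ := hG.const_of_ae_hasDerivAt_zero hG0
  have h0 := hC 0 left_mem_uIcc
  have h1 := hC T right_mem_uIcc
  rw [hP1 0 ⟨le_rfl, hT⟩, hR1 0 ⟨le_rfl, hT⟩] at h0
  rw [hP1 T ⟨hT, le_rfl⟩, hR1 T ⟨hT, le_rfl⟩, ← h0, intervalIntegral.integral_same,
    intervalIntegral.integral_same, smul_zero, sub_zero, sub_eq_zero, smul_eq_mul] at h1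
  rw [h1]
  rw [intervalIntegral.integral_add hi1 hi2]
  congr 1
  refine intervalIntegral.integral_congr fun x hx => ?_
  rw [uIcc_of_le hT] at hx
  simp only [hP1 x hx]

theorem integral_deriv2_mul_cos {F : ℝ → ℂ} (hF : ContDiff ℝ 2 F) {L : ℝ} (hL : 0 < L) (n : ℕ) :
    ∫ x in (0 : ℝ)..L, deriv (deriv F) x * (Real.cos (n * Real.pi / L * x) : ℂ) =
      (-1) ^ n * deriv F L - deriv F 0 -
        (freq L n : ℂ) * ∫ x in (0 : ℝ)..L, F x * (Real.cos (n * Real.pi / L * x) : ℂ) := by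
  set k : ℝ := n * Real.pi / L with hk
  have hF' : ContDiff ℝ 1 (deriv F) := ((contDiff_succ_iff_deriv (n := 1)).1 hF).2.2
  have hF'' : Continuous (deriv (deriv F)) := hF'.continuous_deriv le_rfl
  have hd : ∀ x : ℝ, HasDerivAt (fun x : ℝ => deriv F x * (Real.cos (k * x) : ℂ) +
      k * (F x * (Real.sin (k * x) : ℂ)))
      (deriv (deriv F) x * (Real.cos (k * x) : ℂ) + k ^ 2 * (F x * (Real.cos (k * x) : ℂ))) x := by
    intro x
    have h1 := (hF'.differentiable one_ne_zero x).hasDerivAt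
    have h2 := ((hF.differentiable two_ne_zero) x).hasDerivAt
    have h3 : HasDerivAt (fun x : ℝ => k * x) k x := by
      simpa using (hasDerivAt_id x).const_mul k
    have h4 := (h3.cos).ofReal_comp
    have h5 := (h3.sin).ofReal_comp
    convert! (h1.mul h4).add ((h2.mul h5).const_mul (k : ℂ)) using 1
    push_cast
    ring
  have hcF := hF.continuous
  have hI := intervalIntegral.integral_eq_sub_of_hasDerivAt (a := 0) (b := L) (fun x _ => hd x)
    (by apply Continuous.intervalIntegrable; fun_prop)
  rw [intervalIntegral.integral_add (by apply Continuous.intervalIntegrable; fun_prop)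
    (by apply Continuous.intervalIntegrable; fun_prop), intervalIntegral.integral_const_mul] at hI
  have hkL : k * L = n * Real.pi := by rw [hk]; field_simp
  rw [hkL, Real.cos_nat_mul_pi, Real.sin_nat_mul_pi, mul_zero, Real.cos_zero, Real.sin_zero] at hI
  have hfr : (freq L n : ℂ) = (k : ℂ) ^ 2 := by rw [freq, ← hk]; push_cast; rfl
  rw [hfr, eq_sub_iff_add_eq, hI]
  push_cast
  ring

/-- Bessel's inequality for the exponentials with square frequencies. -/
theorem sum_norm_sq_integral_exp_le {L T t t' : ℝ} (hL : 0 < L) (hT : T ≤ 2 * L ^ 2 / Real.pi)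
    (h0 : 0 ≤ t) (htt : t ≤ t') (htT : t' ≤ T) (u : L2 T) (s : Finset ℕ) :
    ∑ n ∈ s, ‖∫ r in t..t', Complex.exp (freq L n * r * Complex.I) * u r‖ ^ 2 ≤
      2 * L ^ 2 / Real.pi * ∫ r in t..t', ‖u r‖ ^ 2 := by
  -- On an interval of length P the exponential of frequency μₙ is exactly the harmonic of index n²,
  -- so the family is orthogonal there.
  set P := 2 * L ^ 2 / Real.pi with hPdef
  have hpi := Real.pi_pos
  have hP : 0 < P := by positivity
  set F : ℝ → ℂ := (Ioc t t').indicator u with hF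
  have hsub : Ioc t t' ⊆ Ioc 0 P := Ioc_subset_Ioc h0 (htT.trans hT)
  have hint : ∀ {X : Type} [NormedAddCommGroup X] [NormedSpace ℝ X] (g : ℝ → X),
      ∫ r in (0 : ℝ)..P, (Ioc t t').indicator g r = ∫ r in t..t', g r := by
    intro X _ _ g
    rw [intervalIntegral.integral_of_le hP.le, intervalIntegral.integral_of_le htt,
      setIntegral_indicator measurableSet_Ioc, inter_eq_self_of_subset_right hsub]
  have hFm : MemLp F 2 (volume.restrict (Ioc 0 P)) := by
    rw [hF, memLp_indicator_iff_restrict measurableSet_Ioc,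
      Measure.restrict_restrict measurableSet_Ioc, inter_eq_self_of_subset_left hsub]
    have h1 : MemLp u 2 (volume.restrict (Ioc 0 T)) := by
      rw [← Measure.restrict_congr_set (Ioo_ae_eq_Ioc (μ := volume) (a := (0 : ℝ)) (b := T))]
      exact Lp.memLp u
    exact h1.mono_measure (Measure.restrict_mono (Ioc_subset_Ioc h0 htT) le_rfl)
  have hsum := hasSum_sq_fourierCoeffOn hP hFm
  have hcoef : ∀ n : ℕ, fourierCoeffOn hP F (-((n : ℤ) ^ 2)) =
      (1 / P : ℝ) • ∫ r in t..t', Complex.exp (freq L n * r * Complex.I) * u r := by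
    intro n
    rw [fourierCoeffOn_eq_integral, sub_zero]
    congr 1
    rw [← hint]
    refine intervalIntegral.integral_congr fun r _ => ?_
    simp only [hF, indicator_apply, smul_eq_mul]
    split_ifs
    · congr 1
      rw [fourier_coe_apply]
      congr 1
      have : (L : ℂ) ≠ 0 := by exact_mod_cast hL.ne'
      have : (Real.pi : ℂ) ≠ 0 := by exact_mod_cast hpi.ne'
      rw [freq, hPdef]
      push_cast
      field_simp
    · rw [mul_zero]
  have hinj : Function.Injective fun n : ℕ => -((n : ℤ) ^ 2) := by
    intro m n h
    have h1 : ((m : ℤ)) ^ 2 = (n : ℤ) ^ 2 := neg_inj.1 h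
    have h2 : m ^ 2 = n ^ 2 := by exact_mod_cast h1
    exact Nat.pow_left_injective two_ne_zero h2
  have h1 := sum_le_hasSum (s.map ⟨_, hinj⟩) (fun _ _ => by positivity) hsum
  rw [Finset.sum_map] at h1
  simp only [Function.Embedding.coeFn_mk, hcoef] at h1
  have hnF : ∫ x in (0 : ℝ)..P, ‖F x‖ ^ 2 = ∫ r in t..t', ‖u r‖ ^ 2 := by
    rw [← hint]
    refine intervalIntegral.integral_congr fun r _ => ?_
    simp only [hF, indicator_apply]
    split_ifs <;> simp
  rw [hnF, sub_zero, smul_eq_mul] at h1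
  have h2 : ∑ n ∈ s, ‖∫ r in t..t', Complex.exp (freq L n * r * Complex.I) * u r‖ ^ 2 =
      P ^ 2 * ∑ n ∈ s, ‖(1 / P : ℝ) •
        ∫ r in t..t', Complex.exp (freq L n * r * Complex.I) * u r‖ ^ 2 := by
    rw [Finset.mul_sum]
    refine Finset.sum_congr rfl fun n _ => ?_
    rw [norm_smul, Real.norm_of_nonneg (by positivity), mul_pow, ← mul_assoc, ← mul_pow,
      mul_one_div_cancel hP.ne', one_pow, one_mul]
  rw [h2]
  calc _ ≤ P ^ 2 * (P⁻¹ * ∫ r in t..t', ‖u r‖ ^ 2) := by gcongr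
    _ = _ := by field_simp

/-! ### Continuous curves with prescribed coefficients -/

section Curve

variable {H : Type*} [NormedAddCommGroup H] [InnerProductSpace ℂ H] (b : HilbertBasis ℕ ℂ H)

theorem hasSum_norm_sq_inner (v : H) : HasSum (fun n => ‖inner ℂ (b n) v‖ ^ 2) (‖v‖ ^ 2) := by
  have h := b.hasSum_inner_mul_inner v v
  rw [inner_self_eq_norm_sq_to_K] at h
  have e : ∀ n, inner ℂ v (b n) * inner ℂ (b n) v = ((‖inner ℂ (b n) v‖ ^ 2 : ℝ) : ℂ) := by
    intro n
    rw [← inner_conj_symm, Complex.conj_mul']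
    push_cast
    rfl
  simp only [e] at h
  have h2 : HasSum (fun n => ((‖inner ℂ (b n) v‖ ^ 2 : ℝ) : ℂ)) ((‖v‖ ^ 2 : ℝ) : ℂ) := by
    convert! h using 1
    push_cast
    rfl
  exact Complex.hasSum_ofReal.1 h2

theorem exists_inner_basis_eq {c : ℕ → ℂ} (hc : Summable fun n => ‖c n‖ ^ 2) :
    ∃ v : H, ∀ n, inner ℂ (b n) v = c n := by
  have hm : Memℓp c 2 := by
    refine memℓp_gen ?_
    simpa using hc
  refine ⟨b.repr.symm ⟨c, hm⟩, fun n => ?_⟩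
  rw [← b.repr_apply_apply, LinearIsometryEquiv.apply_symm_apply]

/-- A curve is continuous when its coefficients are those of a continuous curve, multiplied by
continuous functions of modulus one. -/
theorem exists_continuousOn_curve {T : ℝ} {e p : ℝ → ℕ → ℂ} {M : ℝ → ℝ}
    (he : ∀ t n, ‖e t n‖ = 1) (hec : ∀ n, Continuous fun t => e t n)
    (hM : ContinuousOn M (Icc 0 T)) (hp0 : Summable fun n => ‖p 0 n‖ ^ 2)
    (hp : ∀ t ∈ Icc 0 T, ∀ t' ∈ Icc 0 T, ∀ s : Finset ℕ,
      ∑ n ∈ s, ‖p t n - p t' n‖ ^ 2 ≤ |M t - M t'|) :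
    ∃ x : ℝ → H, ContinuousOn x (Icc 0 T) ∧
      ∀ t ∈ Icc 0 T, ∀ n, inner ℂ (b n) (x t) = e t n * p t n := by
  have hd : ∀ t ∈ Icc 0 T, ∀ t' ∈ Icc 0 T, Summable fun n => ‖p t n - p t' n‖ ^ 2 :=
    fun t ht t' ht' => summable_of_sum_le (fun _ => by positivity) (hp t ht t' ht')
  have hsq : ∀ z w : ℂ, ‖z + w‖ ^ 2 ≤ 2 * ‖z‖ ^ 2 + 2 * ‖w‖ ^ 2 := by
    intro z w
    have h1 := norm_add_le z w
    have h2 : ‖z + w‖ ^ 2 ≤ (‖z‖ + ‖w‖) ^ 2 := by gcongr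
    nlinarith [sq_nonneg (‖z‖ - ‖w‖)]
  have hps : ∀ t ∈ Icc 0 T, Summable fun n => ‖p t n‖ ^ 2 := by
    intro t ht
    refine Summable.of_nonneg_of_le (fun _ => by positivity) (fun n => ?_)
      (((hd t ht 0 ⟨le_rfl, ht.1.trans ht.2⟩).mul_left 2).add (hp0.mul_left 2))
    have := hsq (p t n - p 0 n) (p 0 n)
    rwa [sub_add_cancel] at this
  have hx : ∀ t, ∃ v : H, t ∈ Icc 0 T → ∀ n, inner ℂ (b n) v = e t n * p t n := by
    intro t
    by_cases ht : t ∈ Icc 0 T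
    · obtain ⟨v, hv⟩ := exists_inner_basis_eq b (c := fun n => e t n * p t n) (by
        simpa only [norm_mul, he, one_mul] using hps t ht)
      exact ⟨v, fun _ => hv⟩
    · exact ⟨0, fun h => absurd h ht⟩
  choose x hx using hx
  refine ⟨x, fun t₀ ht₀ => ?_, hx⟩
  -- The difference of coefficients is split as e(t)(p(t) - p(t₀)) + (e(t) - e(t₀))p(t₀). The
  -- modulus M controls the first part and dominated convergence the second.
  have hlim : Tendsto (fun t => 2 * |M t - M t₀| + 2 * ∑' n, ‖e t n - e t₀ n‖ ^ 2 * ‖p t₀ n‖ ^ 2)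
      (𝓝[Icc 0 T] t₀) (𝓝 (2 * |M t₀ - M t₀| + 2 * ∑' n : ℕ, (0 : ℝ))) := by
    have hMt : Tendsto M (𝓝[Icc 0 T] t₀) (𝓝 (M t₀)) := hM t₀ ht₀
    refine (((hMt.sub tendsto_const_nhds).abs).const_mul 2).add
      (Tendsto.const_mul 2 ?_)
    refine tendsto_tsum_of_dominated_convergence (bound := fun n => 4 * ‖p t₀ n‖ ^ 2)
      ((hps t₀ ht₀).mul_left 4) (fun n => ?_) (Eventually.of_forall fun t n => ?_)
    · have h1 : Continuous fun t => ‖e t n - e t₀ n‖ ^ 2 * ‖p t₀ n‖ ^ 2 := by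
        have := hec n
        fun_prop
      have h2 := h1.tendsto t₀
      simp only [sub_self, norm_zero, ne_eq, OfNat.ofNat_ne_zero, not_false_eq_true, zero_pow,
        zero_mul] at h2
      exact h2.mono_left nhdsWithin_le_nhds
    · rw [Real.norm_of_nonneg (by positivity)]
      gcongr
      have h1 := norm_sub_le (e t n) (e t₀ n)
      rw [he, he] at h1
      nlinarith [norm_nonneg (e t n - e t₀ n)]
  rw [sub_self, abs_zero, tsum_zero, mul_zero, add_zero] at hlim
  have hsq0 : Tendsto (fun t => ‖x t - x t₀‖ ^ 2) (𝓝[Icc 0 T] t₀) (𝓝 0) := by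
    refine squeeze_zero' (Eventually.of_forall fun _ => by positivity) ?_ hlim
    filter_upwards [self_mem_nhdsWithin] with t ht
    have hs2 : Summable fun n => ‖e t n - e t₀ n‖ ^ 2 * ‖p t₀ n‖ ^ 2 := by
      refine Summable.of_nonneg_of_le (fun _ => by positivity) (fun n => ?_)
        ((hps t₀ ht₀).mul_left 4)
      gcongr
      have h1 := norm_sub_le (e t n) (e t₀ n)
      rw [he, he] at h1
      nlinarith [norm_nonneg (e t n - e t₀ n)]
    have h1 := hasSum_norm_sq_inner b (x t - x t₀)
    refine (hasSum_le (fun n => ?_) h1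
      ((((hd t ht t₀ ht₀).mul_left 2).add (hs2.mul_left 2))).hasSum).trans ?_
    · rw [inner_sub_right, hx t ht, hx t₀ ht₀]
      have h2 := hsq (e t n * (p t n - p t₀ n)) ((e t n - e t₀ n) * p t₀ n)
      rw [norm_mul, norm_mul, he, one_mul, mul_pow] at h2
      refine le_trans (le_of_eq ?_) h2
      congr 2
      ring
    · rw [((hd t ht t₀ ht₀).mul_left 2).tsum_add (hs2.mul_left 2), tsum_mul_left, tsum_mul_left]
      gcongr
      exact Real.tsum_le_of_sum_le (fun _ => by positivity) (hp t ht t₀ ht₀)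
  rw [ContinuousWithinAt, tendsto_iff_norm_sub_tendsto_zero]
  have h3 := hsq0.sqrt
  simpa using h3

end Curve

/-! ### Test functions in the basis of cosines -/

theorem grad_eq_contVec {L : ℝ} (hL : 0 < L) {η : ℝ → ℂ} (hη : ContDiff ℝ 1 η) (φ : H10 L)
    (hφ : ∀ x ∈ Icc (0 : ℝ) L, φ x = η x) :
    H10.grad L φ = contVec L ⟨deriv η, hη.continuous_deriv le_rfl⟩ ∧ η 0 = 0 ∧ η L = 0 := by
  have hφ' : ∀ x ∈ Icc (0 : ℝ) L, η x = ∫ t in (0 : ℝ)..x, H10.grad L φ t :=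
    fun x hx => (hφ x hx).symm.trans (φ.2.1 x hx)
  have h0 : η 0 = 0 := by
    rw [hφ' 0 ⟨le_rfl, hL.le⟩, intervalIntegral.integral_same]
  have h1 : η L = 0 := (hφ L ⟨hL.le, le_rfl⟩).symm.trans φ.2.2.1
  refine ⟨?_, h0, h1⟩
  rw [← sub_eq_zero]
  refine ae_eq_zero_of_forall_integral_eq_zero hL.le _ fun x hx => ?_
  have hc : Continuous (deriv η) := hη.continuous_deriv le_rfl
  have e : ∫ t in (0 : ℝ)..x, (H10.grad L φ - contVec L ⟨deriv η, hc⟩ : L2 L) t =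
      ∫ t in (0 : ℝ)..x, (H10.grad L φ t - deriv η t) := by
    rw [intervalIntegral.integral_of_le hx.1, intervalIntegral.integral_of_le hx.1]
    refine integral_congr_ae ?_
    filter_upwards [ae_Ioc_of_ae_Ioo hx.2 (contVec_ae L ⟨deriv η, hc⟩),
      ae_Ioc_of_ae_Ioo hx.2 (Lp.coeFn_sub (H10.grad L φ) (contVec L ⟨deriv η, hc⟩))] with t h2 h3
    rw [h3, Pi.sub_apply, h2]
    rfl
  rw [e, intervalIntegral.integral_sub (L2.intervalIntegrable hx.1 hx.2 _)
    (hc.intervalIntegrable _ _), ← hφ' x hx, intervalIntegral.integral_deriv_eq_sub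
    (fun y _ => hη.differentiable one_ne_zero y) (hc.intervalIntegrable _ _), h0, sub_zero,
    sub_self]

theorem inner_cosMap_contVec {L : ℝ} (hL : 0 < L) (n : ℕ) (f : C(ℝ, ℂ)) :
    inner ℂ (contVec L (cosMap L n)) (contVec L f) =
      cosNorm L n * ∫ x in (0 : ℝ)..L, f x * (Real.cos (n * Real.pi / L * x) : ℂ) := by
  rw [inner_contVec_contVec hL.le, ← intervalIntegral.integral_const_mul]
  refine intervalIntegral.integral_congr fun x _ => ?_
  simp only [cosMap, ContinuousMap.coe_mk, Complex.conj_ofReal]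
  push_cast
  ring

/-- Gradients of H¹₀ functions have mean zero, so the zero mode of a representative is invisible in
H⁻¹ and need not be controlled. -/
theorem inner_cosMap_zero_grad {L : ℝ} (hL : 0 < L) (φ : H10 L) :
    inner ℂ (contVec L (cosMap L 0)) (H10.grad L φ) = 0 := by
  rw [inner_contVec hL.le]
  have e : ∀ t, (starRingEnd ℂ) (cosMap L 0 t) * H10.grad L φ t =
      (cosNorm L 0 : ℂ) * H10.grad L φ t := by
    intro t
    simp [cosMap]
  simp only [e]
  rw [intervalIntegral.integral_const_mul]
  have h1 : φ L = ∫ t in (0 : ℝ)..L, H10.grad L φ t := φ.2.1 L ⟨hL.le, le_rfl⟩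
  have h2 : φ L = 0 := φ.2.2.1
  rw [← h1, h2, mul_zero]

theorem freq_zero (L : ℝ) : freq L 0 = 0 := by simp [freq]

/-- The weight of the `n`-th mode in the boundary term. -/
def boundaryWeight (L : ℝ) (n : ℕ) : ℝ := if n = 0 then 0 else √(2 / L)

section TestFunction

variable {L : ℝ} {η : ℝ → ℂ} {φ ψ : H10 L}

/-- The boundary terms of the two integrations by parts contain η'' at 0 and L, which vanishes
because it belongs to H¹₀. -/
theorem inner_cosMap_grad_deriv2 (hL : 0 < L) (hη : ContDiff ℝ 3 η)
    (hφ : ∀ x ∈ Icc (0 : ℝ) L, φ x = η x)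
    (hψ : ∀ x ∈ Icc (0 : ℝ) L, ψ x = deriv (deriv η) x) (n : ℕ) :
    inner ℂ (contVec L (cosMap L n)) (H10.grad L ψ) =
      -(freq L n : ℂ) * inner ℂ (contVec L (cosMap L n)) (H10.grad L φ) := by
  have h1 : ContDiff ℝ 2 (deriv η) := ((contDiff_succ_iff_deriv (n := 2)).1 hη).2.2
  have h2 : ContDiff ℝ 1 (deriv (deriv η)) := ((contDiff_succ_iff_deriv (n := 1)).1 h1).2.2
  obtain ⟨hφ1, -, -⟩ := grad_eq_contVec hL (hη.of_le (by norm_num)) φ hφ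
  obtain ⟨hψ1, hψ2, hψ3⟩ := grad_eq_contVec hL h2 ψ hψ
  rw [hφ1, hψ1, inner_cosMap_contVec hL, inner_cosMap_contVec hL]
  simp only [ContinuousMap.coe_mk]
  rw [integral_deriv2_mul_cos h1 hL n, hψ2, hψ3]
  ring

/-- This is the cosine series of η' at the point 0. Instead of pointwise convergence, the proof uses
Parseval's identity for η''' and F(x) = -(L-x)²/2: their product integrates to Lη'(0), the n-th
coefficient of F carries -L/μₙ, and that of η''' is -μₙ times that of η'. -/
theorem hasSum_boundaryWeight (hL : 0 < L) (hη : ContDiff ℝ 3 η)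
    (hφ : ∀ x ∈ Icc (0 : ℝ) L, φ x = η x)
    (hψ : ∀ x ∈ Icc (0 : ℝ) L, ψ x = deriv (deriv η) x) :
    HasSum (fun n => (boundaryWeight L n : ℂ) * inner ℂ (contVec L (cosMap L n)) (H10.grad L φ))
      (deriv η 0) := by
  have h1 : ContDiff ℝ 2 (deriv η) := ((contDiff_succ_iff_deriv (n := 2)).1 hη).2.2
  have h2 : ContDiff ℝ 1 (deriv (deriv η)) := ((contDiff_succ_iff_deriv (n := 1)).1 h1).2.2
  have h3 : Continuous (deriv (deriv (deriv η))) := h2.continuous_deriv le_rfl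
  obtain ⟨hφ1, hφ2, hφ3⟩ := grad_eq_contVec hL (hη.of_le (by norm_num)) φ hφ
  obtain ⟨hψ1, hψ2, hψ3⟩ := grad_eq_contVec hL h2 ψ hψ
  set F : ℝ → ℂ := fun x => -((L : ℂ) - x) ^ 2 / 2 with hF
  have hd1 : ∀ x : ℝ, HasDerivAt F ((L : ℂ) - x) x := by
    intro x
    have := ((((hasDerivAt_id x).ofReal_comp).const_sub (L : ℂ)).pow 2).neg.div_const 2
    convert! this using 1
    push_cast
    simp only [id]
    ring
  have hd2 : ∀ x : ℝ, HasDerivAt (fun x : ℝ => (L : ℂ) - x) (-1) x := by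
    intro x
    simpa using ((hasDerivAt_id x).ofReal_comp).const_sub (L : ℂ)
  have hF1 : deriv F = fun x : ℝ => (L : ℂ) - x := funext fun x => (hd1 x).deriv
  have hF2 : deriv (deriv F) = fun _ : ℝ => (-1 : ℂ) := by
    rw [hF1]
    exact funext fun x => (hd2 x).deriv
  have hFc : ContDiff ℝ 2 F := by
    have : ContDiff ℝ 2 fun x : ℝ => (x : ℂ) := Complex.ofRealCLM.contDiff
    fun_prop
  have hcont : Continuous F := hFc.continuous
  have hinner : inner ℂ (contVec L ⟨F, hcont⟩) (H10.grad L ψ) = L * deriv η 0 := by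
    rw [hψ1, inner_contVec_contVec hL.le]
    have hd : ∀ x : ℝ, HasDerivAt (fun x : ℝ => F x * deriv (deriv η) x -
        ((L : ℂ) - x) * deriv η x - η x) (F x * deriv (deriv (deriv η)) x) x := by
      intro x
      have d1 := (hη.differentiable three_ne_zero x).hasDerivAt
      have d2 := (h1.differentiable two_ne_zero x).hasDerivAt
      have d3 := (h2.differentiable one_ne_zero x).hasDerivAt
      convert! (((hd1 x).mul d3).sub ((hd2 x).mul d2)).sub d1 using 1
      ring
    have hI := intervalIntegral.integral_eq_sub_of_hasDerivAt (a := 0) (b := L) (fun x _ => hd x)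
      ((hcont.mul h3).intervalIntegrable _ _)
    have e : ∀ x : ℝ, (starRingEnd ℂ) (F x) = F x := by
      intro x
      have h2c : (starRingEnd ℂ) 2 = 2 := by exact_mod_cast Complex.conj_ofReal 2
      simp [hF, h2c]
    simp only [ContinuousMap.coe_mk, e]
    rw [hI, hψ2, hφ2, hφ3, hF]
    simp
  have hpar := (cosBasis hL).hasSum_inner_mul_inner (contVec L ⟨F, hcont⟩) (H10.grad L ψ)
  rw [hinner] at hpar
  have hLc : (L : ℂ) ≠ 0 := by exact_mod_cast hL.ne'
  have hpar2 := hpar.mul_left ((L : ℂ)⁻¹)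
  rw [← mul_assoc, inv_mul_cancel₀ hLc, one_mul] at hpar2
  convert! hpar2 using 2 with n
  rw [cosBasis_apply, inner_cosMap_grad_deriv2 hL hη hφ hψ, ← inner_conj_symm (contVec L ⟨F, hcont⟩),
    inner_cosMap_contVec hL]
  -- For n = 0 both terms vanish, as μ₀ = 0 and the weight is 0.
  rcases Nat.eq_zero_or_pos n with rfl | hn
  · rw [freq_zero]
    simp [boundaryWeight]
  · have hI := integral_deriv2_mul_cos hFc hL n
    rw [hF2, hF1] at hI
    have hz : ∫ x in (0 : ℝ)..L, (-1 : ℂ) * (Real.cos (n * Real.pi / L * x) : ℂ) = 0 := by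
      rw [intervalIntegral.integral_const_mul, intervalIntegral.integral_ofReal]
      have := integral_cos_int hL (k := n) (by omega)
      rw [Int.cast_natCast] at this
      rw [this]
      simp
    rw [hz] at hI
    have hfr : (freq L n : ℂ) ≠ 0 := by
      have : freq L n ≠ 0 := by
        have := Real.pi_pos
        have : (0 : ℝ) < n := by exact_mod_cast hn
        rw [freq]
        positivity
      exact_mod_cast this
    have hv : ∫ x in (0 : ℝ)..L, F x * (Real.cos (n * Real.pi / L * x) : ℂ) = -L / freq L n := by
      rw [eq_div_iff hfr]
      simp only [sub_self, mul_zero, Complex.ofReal_zero, sub_zero] at hI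
      linear_combination hI
    simp only [ContinuousMap.coe_mk]
    rw [hv]
    simp only [map_mul, map_div₀, map_neg, Complex.conj_ofReal]
    rw [boundaryWeight, cosNorm, if_neg hn.ne', if_neg hn.ne']
    field_simp

end TestFunction

/-! ### The weak solution and the control -/

/-- The equation of a single mode. -/
theorem mode_equation {f : ℝ → ℂ} {T : ℝ} (hT : 0 ≤ T) (hf : IntervalIntegrable f volume 0 T)
    (μ : ℝ) (b w : ℂ) :
    Complex.exp (-(μ * T * Complex.I)) *
        (b + Complex.I * w * ∫ r in (0 : ℝ)..T, Complex.exp (μ * r * Complex.I) * f r) =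
      b - Complex.I * μ * (∫ s in (0 : ℝ)..T, Complex.exp (-(μ * s * Complex.I)) *
        (b + Complex.I * w * ∫ r in (0 : ℝ)..s, Complex.exp (μ * r * Complex.I) * f r)) +
      Complex.I * w * ∫ s in (0 : ℝ)..T, f s := by
  set E : ℝ → ℂ := fun s => Complex.exp (-(μ * s * Complex.I)) with hE
  set g : ℝ → ℂ := fun r => Complex.exp (μ * r * Complex.I) * f r with hg
  have hgi : IntervalIntegrable g volume 0 T := hf.continuousOn_mul (by fun_prop)
  have hEc : ContDiff ℝ 1 E := by
    have : ContDiff ℝ 1 fun x : ℝ => (x : ℂ) := Complex.ofRealCLM.contDiff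
    fun_prop
  have hEd : ∀ t : ℝ, HasDerivAt E (-(Complex.I * μ) * E t) t := by
    intro t
    have h1 : HasDerivAt (fun s : ℝ => -((μ : ℂ) * s * Complex.I)) (-(μ * Complex.I)) t := by
      simpa using! ((((hasDerivAt_id t).ofReal_comp).const_mul (μ : ℂ)).mul_const Complex.I).neg
    convert! h1.cexp using 1
    ring
  have hEcont : Continuous E := hEc.continuous
  have h1 := mul_integral_eq_integral hT hgi hEc (E' := fun t => -(Complex.I * μ) * E t)
    (by fun_prop) hEd
  have h2 : ∫ s in (0 : ℝ)..T, E s * g s = ∫ s in (0 : ℝ)..T, f s := by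
    refine intervalIntegral.integral_congr fun s _ => ?_
    simp only [hE, hg]
    rw [← mul_assoc, ← Complex.exp_add, neg_add_cancel, Complex.exp_zero, one_mul]
  have h3 := intervalIntegral.integral_eq_sub_of_hasDerivAt (a := 0) (b := T)
    (fun t _ => hEd t) (by apply Continuous.intervalIntegrable; fun_prop)
  have hE0 : E 0 = 1 := by simp [hE]
  rw [hE0, intervalIntegral.integral_const_mul] at h3
  have hq : ContinuousOn (fun s => ∫ r in (0 : ℝ)..s, g r) (uIcc 0 T) :=
    intervalIntegral.continuousOn_primitive_interval' hgi left_mem_uIcc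
  have h4 : ∫ s in (0 : ℝ)..T, E s * (b + Complex.I * w * ∫ r in (0 : ℝ)..s, g r) =
      b * (∫ s in (0 : ℝ)..T, E s) + Complex.I * w * ∫ s in (0 : ℝ)..T,
        E s * ∫ r in (0 : ℝ)..s, g r := by
    rw [← intervalIntegral.integral_const_mul, ← intervalIntegral.integral_const_mul,
      ← intervalIntegral.integral_add]
    · refine intervalIntegral.integral_congr fun s _ => ?_
      ring
    · exact (hEcont.const_mul b).intervalIntegrable _ _
    · exact (continuousOn_const.mul (hEcont.continuousOn.mul hq)).intervalIntegrable
  simp only [mul_assoc (-(Complex.I * (μ : ℂ)))] at h1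
  rw [h2, intervalIntegral.integral_const_mul] at h1
  change E T * (b + Complex.I * w * ∫ r in (0 : ℝ)..T, g r) = b - Complex.I * μ *
    (∫ s in (0 : ℝ)..T, E s * (b + Complex.I * w * ∫ r in (0 : ℝ)..s, g r)) + _
  rw [h4]
  linear_combination Complex.I * w * h1 - b * h3

section Solution

variable {T L : ℝ}

/-- The conjugate of the `n`-th coefficient of the solution, in the rotating frame. -/
def modeCoeff (x₀ : L2 L) (u : L2 T) (n : ℕ) (t : ℝ) : ℂ :=
  (starRingEnd ℂ) (inner ℂ (contVec L (cosMap L n)) x₀) + Complex.I * boundaryWeight L n *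
    ∫ r in (0 : ℝ)..t, Complex.exp (freq L n * r * Complex.I) * u r

/-- Since the boundary weights are bounded, Bessel's inequality shows that an L² control keeps the
state in ℓ², that is in H⁻¹, with increments governed by its own energy. -/
theorem sum_norm_sq_modeCoeff_sub_le (hL : 0 < L) (hTP : T ≤ 2 * L ^ 2 / Real.pi)
    (x₀ : L2 L) (u : L2 T) {t t' : ℝ} (ht : 0 ≤ t) (htt : t ≤ t') (ht' : t' ≤ T) (s : Finset ℕ) :
    ∑ n ∈ s, ‖modeCoeff x₀ u n t - modeCoeff x₀ u n t'‖ ^ 2 ≤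
      4 * L / Real.pi * ∫ r in t..t', ‖u r‖ ^ 2 := by
  have h1 : ∀ n, ‖modeCoeff x₀ u n t - modeCoeff x₀ u n t'‖ ^ 2 ≤
      2 / L * ‖∫ r in t..t', Complex.exp (freq L n * r * Complex.I) * u r‖ ^ 2 := by
    intro n
    have hi : ∀ x, 0 ≤ x → x ≤ T → IntervalIntegrable
        (fun r : ℝ => Complex.exp (freq L n * r * Complex.I) * u r) volume 0 x := fun x h0 hx =>
      (L2.intervalIntegrable h0 hx u).continuousOn_mul (by fun_prop)
    rw [← intervalIntegral.integral_interval_sub_left (hi t' (ht.trans htt) ht')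
      (hi t ht (htt.trans ht')), norm_sub_rev, modeCoeff, modeCoeff, add_sub_add_left_eq_sub,
      ← mul_sub, norm_mul, mul_pow]
    gcongr
    rw [norm_mul, Complex.norm_I, one_mul, Complex.norm_real, Real.norm_eq_abs, sq_abs,
      boundaryWeight]
    split_ifs
    · rw [zero_pow two_ne_zero]
      positivity
    · rw [Real.sq_sqrt (by positivity)]
  calc _ ≤ ∑ n ∈ s, 2 / L * ‖∫ r in t..t', Complex.exp (freq L n * r * Complex.I) * u r‖ ^ 2 :=
        Finset.sum_le_sum fun n _ => h1 n
    _ = 2 / L * ∑ n ∈ s, ‖∫ r in t..t', Complex.exp (freq L n * r * Complex.I) * u r‖ ^ 2 := by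
        rw [Finset.mul_sum]
    _ ≤ 2 / L * (2 * L ^ 2 / Real.pi * ∫ r in t..t', ‖u r‖ ^ 2) := by
        gcongr
        exact sum_norm_sq_integral_exp_le hL hTP ht htt ht' u s
    _ = _ := by
        field_simp
        ring

/-- Functionals are represented antilinearly by L², so the coefficients of the curve are the
conjugates of those given by Duhamel's formula. -/
theorem exists_curve_modeCoeff (hL : 0 < L) (hT : 0 ≤ T) (hTP : T ≤ 2 * L ^ 2 / Real.pi)
    (x₀ : L2 L) (u : L2 T) :
    ∃ x : ℝ → L2 L, ContinuousOn x (Icc 0 T) ∧ ∀ t ∈ Icc 0 T, ∀ n,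
      inner ℂ (contVec L (cosMap L n)) (x t) =
        Complex.exp (freq L n * t * Complex.I) * (starRingEnd ℂ) (modeCoeff x₀ u n t) := by
  have hu := intervalIntegrable_norm_sq hT u
  have hsub : ∀ t ∈ Icc 0 T, IntervalIntegrable (fun r => ‖u r‖ ^ 2) volume 0 t := by
    intro t ht
    refine hu.mono_set ?_
    rw [uIcc_of_le ht.1, uIcc_of_le hT]
    exact Icc_subset_Icc_right ht.2
  set M : ℝ → ℝ := fun t => 4 * L / Real.pi * ∫ r in (0 : ℝ)..t, ‖u r‖ ^ 2 with hM
  have hMc : ContinuousOn M (Icc 0 T) := by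
    have := intervalIntegral.continuousOn_primitive_interval' hu left_mem_uIcc
    rw [uIcc_of_le hT] at this
    exact continuousOn_const.mul this
  have hle : ∀ t ∈ Icc 0 T, ∀ t' ∈ Icc 0 T, t ≤ t' → ∀ s : Finset ℕ,
      ∑ n ∈ s, ‖modeCoeff x₀ u n t - modeCoeff x₀ u n t'‖ ^ 2 ≤ |M t' - M t| := by
    intro t ht t' ht' htt s
    refine (sum_norm_sq_modeCoeff_sub_le hL hTP x₀ u ht.1 htt ht'.2 s).trans
      (le_trans (le_of_eq ?_) (le_abs_self _))
    simp only [hM]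
    rw [← mul_sub, intervalIntegral.integral_interval_sub_left (hsub t' ht') (hsub t ht)]
  have hp0 : Summable fun n => ‖(starRingEnd ℂ) (modeCoeff x₀ u n 0)‖ ^ 2 := by
    have h1 := (hasSum_norm_sq_inner (cosBasis hL) x₀).summable
    simpa [cosBasis_apply, modeCoeff] using h1
  have hp : ∀ t ∈ Icc 0 T, ∀ t' ∈ Icc 0 T, ∀ s : Finset ℕ, ∑ n ∈ s,
      ‖(starRingEnd ℂ) (modeCoeff x₀ u n t) - (starRingEnd ℂ) (modeCoeff x₀ u n t')‖ ^ 2 ≤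
        |M t - M t'| := by
    intro t ht t' ht' s
    simp only [← map_sub, RCLike.norm_conj]
    rcases le_total t t' with h | h
    · rw [abs_sub_comm]
      exact hle t ht t' ht' h s
    · simp only [norm_sub_rev (modeCoeff x₀ u _ t)]
      exact hle t' ht' t ht h s
  obtain ⟨x, hx1, hx2⟩ := exists_continuousOn_curve (cosBasis hL) (T := T)
    (e := fun t n => Complex.exp (freq L n * t * Complex.I))
    (p := fun t n => (starRingEnd ℂ) (modeCoeff x₀ u n t)) (M := M)
    (fun t n => by exact_mod_cast Complex.norm_exp_ofReal_mul_I (freq L n * t))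
    (fun n => by fun_prop) hMc hp0 hp
  exact ⟨x, hx1, fun t ht n => by rw [← cosBasis_apply hL, hx2 t ht n]⟩

theorem hasSum_ofL2 (hL : 0 < L) (x : L2 L) (φ : H10 L) :
    HasSum (fun n => (starRingEnd ℂ) (inner ℂ (contVec L (cosMap L n)) x) *
      inner ℂ (contVec L (cosMap L n)) (H10.grad L φ)) (ofL2 L x φ) := by
  rw [ofL2_apply]
  convert! (cosBasis hL).hasSum_inner_mul_inner x (H10.grad L φ) using 2 with n
  rw [cosBasis_apply, inner_conj_symm]

/-- All the terms of the weak formulation, η'(0) included, are expanded in cosines, and each mode is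
an instance of `mode_equation`. -/
theorem exists_isSolution (hL : 0 < L) (hT : 0 ≤ T) (hTP : T ≤ 2 * L ^ 2 / Real.pi)
    (x₀ : L2 L) (u : L2 T) :
    ∃ x : ℝ → L2 L, IsSolution T L (ofL2 L x₀) u (fun t => ofL2 L (x t)) ∧ ∀ n,
      inner ℂ (contVec L (cosMap L n)) (x T) =
        Complex.exp (freq L n * T * Complex.I) * (starRingEnd ℂ) (modeCoeff x₀ u n T) := by
  obtain ⟨x, hx1, hx2⟩ := exists_curve_modeCoeff hL hT hTP x₀ u
  refine ⟨x, ⟨(continuous_ofL2 L).comp_continuousOn hx1, ?_, ?_⟩, hx2 T ⟨hT, le_rfl⟩⟩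
  · have : x 0 = x₀ := by
      rw [← sub_eq_zero]
      refine eq_zero_of_inner_cosMap_eq_zero hL _ fun n => ?_
      rw [inner_sub_right, hx2 0 ⟨le_rfl, hT⟩, modeCoeff]
      simp
    change ofL2 L (x 0) = _
    rw [this]
  · intro η hη φ ψ hφ hψ t ht
    have hxi : IntervalIntegrable x volume 0 t := by
      refine (hx1.mono ?_).intervalIntegrable
      rw [uIcc_of_le ht.1]
      exact Icc_subset_Icc_right ht.2
    have hX : ∀ v : L2 L, ∫ s in (0 : ℝ)..t, inner ℂ v (x s) =
        inner ℂ v (∫ s in (0 : ℝ)..t, x s) := fun v =>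
      (innerSL ℂ v).intervalIntegral_comp_comm hxi
    have hy : ∫ s in (0 : ℝ)..t, ofL2 L (x s) ψ = ofL2 L (∫ s in (0 : ℝ)..t, x s) ψ := by
      simp only [ofL2_apply]
      rw [← inner_conj_symm, ← hX, intervalIntegral.integral_of_le ht.1,
        intervalIntegral.integral_of_le ht.1, ← integral_conj]
      simp only [inner_conj_symm]
    rw [hy]
    have h1 := hasSum_ofL2 hL (x t) φ
    have h2 := hasSum_ofL2 hL x₀ φ
    have h3 := hasSum_ofL2 hL (∫ s in (0 : ℝ)..t, x s) ψ
    have h4 := hasSum_boundaryWeight hL hη hφ hψ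
    have h5 := (h2.add (h3.mul_left Complex.I)).add
      ((h4.mul_left Complex.I).mul_right (∫ s in (0 : ℝ)..t, u s))
    refine h1.unique ?_
    convert! h5 using 2 with n
    rw [inner_cosMap_grad_deriv2 hL hη hφ hψ, hx2 t ht, ← hX]
    have e1 : ∀ s ∈ Icc 0 T, (starRingEnd ℂ) (inner ℂ (contVec L (cosMap L n)) (x s)) =
        Complex.exp (-(freq L n * s * Complex.I)) * modeCoeff x₀ u n s := by
      intro s hs
      rw [hx2 s hs, map_mul, Complex.conj_conj, ← Complex.exp_conj]
      simp
    have e2 : (starRingEnd ℂ) (∫ s in (0 : ℝ)..t, inner ℂ (contVec L (cosMap L n)) (x s)) =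
        ∫ s in (0 : ℝ)..t, Complex.exp (-(freq L n * s * Complex.I)) * modeCoeff x₀ u n s := by
      rw [intervalIntegral.integral_of_le ht.1, ← integral_conj,
        ← intervalIntegral.integral_of_le ht.1]
      refine intervalIntegral.integral_congr fun s hs => ?_
      rw [uIcc_of_le ht.1] at hs
      exact e1 s ⟨hs.1, hs.2.trans ht.2⟩
    rw [← hx2 t ht, e1 t ht, e2]
    have h6 := mode_equation ht.1 (L2.intervalIntegrable ht.1 ht.2 u) (freq L n)
      ((starRingEnd ℂ) (inner ℂ (contVec L (cosMap L n)) x₀)) (boundaryWeight L n)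
    simp only [modeCoeff]
    rw [h6]
    ring

theorem ofL2_eq_zero (hL : 0 < L) (x : L2 L)
    (hx : ∀ n, 1 ≤ n → inner ℂ (contVec L (cosMap L n)) x = 0) : ofL2 L x = 0 := by
  refine ContinuousLinearMap.ext fun φ => ?_
  refine (hasSum_ofL2 hL x φ).unique ?_
  convert! hasSum_zero using 2 with n
  rcases Nat.eq_zero_or_pos n with rfl | hn
  · rw [inner_cosMap_zero_grad hL, mul_zero]
  · rw [hx n hn, map_zero, zero_mul]

/-- Observability of the exponentials implies null controllability, with the corresponding
cost. -/
theorem exists_drivesToZero (hL : 0 < L) (hT : 0 ≤ T) (hTP : T ≤ 2 * L ^ 2 / Real.pi) {C : ℝ}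
    (hC : 0 ≤ C)
    (hobs : ∀ s : Finset ℕ, (∀ m ∈ s, 1 ≤ m) → ∀ a : ℕ → ℂ, ∑ m ∈ s, ‖a m‖ ^ 2 ≤
      C ^ 2 * ∫ t in (0 : ℝ)..T, ‖∑ m ∈ s, a m * Complex.exp (-(freq L m * t * Complex.I))‖ ^ 2)
    (y₀ : HNegOne L) :
    ∃ u : L2 T, DrivesToZero T L y₀ u ∧ ‖u‖ ≤ C * √(L / 2) * ‖y₀‖ := by
  obtain ⟨x₀, hx₀, hn₀⟩ := exists_inner_eq_of_isometry (gradIsometry L) y₀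
  have hy₀ : y₀ = ofL2 L x₀ := ContinuousLinearMap.ext fun φ => (hx₀ φ).symm
  -- The index n stands for the mode n + 1, since the mode 0 plays no role.
  set E : ℕ → C(ℝ, ℂ) := fun n => ⟨fun t => Complex.exp (-(freq L (n + 1) * t * Complex.I)),
    by fun_prop⟩ with hE
  -- The moments cancel the initial coefficients at time T, because √(2/L) √(L/2) = 1 and i² = -1.
  set β : ℕ → ℂ := fun n => Complex.I * √(L / 2) *
    (starRingEnd ℂ) (inner ℂ (contVec L (cosMap L (n + 1))) x₀) with hβ
  have hE' : ∀ (s : Finset ℕ) (a : ℕ → ℂ), ∑ m ∈ s, ‖a m‖ ^ 2 ≤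
      C ^ 2 * ‖∑ m ∈ s, a m • contVec T (E m)‖ ^ 2 := by
    intro s a
    have h1 := hobs (s.map (addRightEmbedding 1)) (by simp) fun m => a (m - 1)
    simp only [Finset.sum_map, addRightEmbedding_apply, Nat.add_sub_cancel] at h1
    refine h1.trans_eq ?_
    congr 1
    have e2 : ∑ m ∈ s, a m • contVec T (E m) = contVec T (∑ m ∈ s, a m • E m) := by
      rw [map_sum]
      simp only [map_smul]
    rw [e2, norm_sq_contVec hT]
    refine intervalIntegral.integral_congr fun t _ => ?_
    simp [hE, ContinuousMap.coe_sum]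
  have hβ' : ∀ s : Finset ℕ, ∑ m ∈ s, ‖β m‖ ^ 2 ≤ (√(L / 2) * ‖y₀‖) ^ 2 := by
    intro s
    have h1 := sum_le_hasSum (s.map (addRightEmbedding 1)) (fun _ _ => by positivity)
      (hasSum_norm_sq_inner (cosBasis hL) x₀)
    rw [Finset.sum_map] at h1
    simp only [addRightEmbedding_apply, cosBasis_apply] at h1
    calc ∑ m ∈ s, ‖β m‖ ^ 2 = √(L / 2) ^ 2 *
          ∑ m ∈ s, ‖inner ℂ (contVec L (cosMap L (m + 1))) x₀‖ ^ 2 := by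
          rw [Finset.mul_sum]
          refine Finset.sum_congr rfl fun m _ => ?_
          simp only [hβ]
          rw [norm_mul, norm_mul, Complex.norm_I, one_mul, RCLike.norm_conj, mul_pow,
            Complex.norm_real, Real.norm_of_nonneg (Real.sqrt_nonneg _)]
      _ ≤ √(L / 2) ^ 2 * ‖x₀‖ ^ 2 := by gcongr
      _ ≤ √(L / 2) ^ 2 * ‖y₀‖ ^ 2 := by gcongr
      _ = _ := by ring
  obtain ⟨u, hu, hun⟩ := exists_inner_eq_of_bounded_below (fun n => contVec T (E n)) hC
    (B := √(L / 2) * ‖y₀‖) (by positivity) β hE' hβ'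
  refine ⟨u, ?_, by rwa [mul_assoc]⟩
  obtain ⟨x, hx, hxT⟩ := exists_isSolution hL hT hTP x₀ u
  rw [hy₀]
  refine ⟨_, hx, ofL2_eq_zero hL _ fun n hn => ?_⟩
  obtain ⟨m, rfl⟩ := Nat.exists_eq_add_of_le' hn
  have h1 := hu m
  rw [inner_contVec hT] at h1
  have e : ∀ t : ℝ, (starRingEnd ℂ) (E m t) * u t =
      Complex.exp (freq L (m + 1) * t * Complex.I) * u t := by
    intro t
    simp only [hE, ContinuousMap.coe_mk]
    rw [← Complex.exp_conj]
    simp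
  simp only [e] at h1
  rw [hxT, modeCoeff, h1]
  have hw : (boundaryWeight L (m + 1) : ℂ) * (√(L / 2) : ℝ) = 1 := by
    rw [boundaryWeight, if_neg (by omega), ← Complex.ofReal_mul, ← Real.sqrt_mul (by positivity),
      div_mul_div_comm, mul_comm, div_self (by positivity), Real.sqrt_one, Complex.ofReal_one]
  have h0 : ∀ z : ℂ, z + Complex.I * (boundaryWeight L (m + 1) : ℂ) *
      (Complex.I * (√(L / 2) : ℝ) * z) = 0 := by
    intro z
    linear_combination z * Complex.I ^ 2 * hw + z * Complex.I_sq
  simp only [hβ]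
  rw [h0, map_zero, mul_zero]

end Solution

/-! ### The control cost and its limit -/

theorem exists_controlCost_le {L : ℝ} (hL : 0 < L) :
    ∃ K : ℝ, 0 < K ∧ ∀ᶠ T in 𝓝[>] (0 : ℝ),
      controlCost T L ≤ ENNReal.ofReal (K * Real.exp (56 / 100 * L ^ 2 / T)) := by
  obtain ⟨K, hK, hobs⟩ := exists_observability_freq hL
  have hpi := Real.pi_pos
  refine ⟨√K * √(L / 2), by positivity, ?_⟩
  -- T is small enough for the observability estimate and, in `h2`, for Bessel's inequality.
  have h1 : ∀ᶠ T in 𝓝[>] (0 : ℝ), T < L ^ 2 / Real.pi ^ 2 :=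
    nhdsWithin_le_nhds (eventually_lt_nhds (by positivity))
  have h2 : ∀ᶠ T in 𝓝[>] (0 : ℝ), T < 2 * L ^ 2 / Real.pi :=
    nhdsWithin_le_nhds (eventually_lt_nhds (by positivity))
  filter_upwards [self_mem_nhdsWithin, h1, h2] with T hT hT1 hT2
  have hT' : 0 < T := hT
  -- The observability constant is C², so its exponent 1.12 is halved.
  set C : ℝ := √K * Real.exp (56 / 100 * L ^ 2 / T) with hC
  have hCsq : C ^ 2 = K * Real.exp (112 / 100 * L ^ 2 / T) := by
    rw [hC, mul_pow, Real.sq_sqrt hK.le, ← Real.exp_nat_mul]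
    congr 2
    push_cast
    ring
  have hT3 : T * (Real.pi / L) ^ 2 ≤ 1 := by
    rw [lt_div_iff₀ (by positivity)] at hT1
    rw [div_pow, mul_div_assoc', div_le_one (by positivity)]
    exact hT1.le
  have hdr := exists_drivesToZero hL hT'.le hT2.le (C := C) (by positivity)
    (by rw [hCsq]; exact hobs T hT' hT3)
  refine (iInf₂_le (C * √(L / 2)).toNNReal fun y₀ => ?_).trans (le_of_eq ?_)
  · obtain ⟨u, hu, hn⟩ := hdr y₀
    exact ⟨u, hu, by rwa [Real.coe_toNNReal _ (by positivity)]⟩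
  · rw [ENNReal.ofReal, hC]
    congr 2
    ring

/-- The prefactor K contributes T log K, which tends to 0; the strict inequality leaves room for it.
-/
theorem betaPlus_le {L : ℝ} (hL : 0 < L) {c : ℝ} (hc : 56 / 100 * L ^ 2 < c) :
    betaPlus L ≤ (c : EReal) := by
  obtain ⟨K, hK, hev⟩ := exists_controlCost_le hL
  refine limsup_le_of_le (by isBoundedDefault) ?_
  have hlim : Tendsto (fun T : ℝ => T * Real.log K + 56 / 100 * L ^ 2) (𝓝[>] 0)
      (𝓝 (56 / 100 * L ^ 2)) := by
    have : Continuous fun T : ℝ => T * Real.log K + 56 / 100 * L ^ 2 := by fun_prop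
    have h := this.tendsto 0
    rw [zero_mul, zero_add] at h
    exact h.mono_left nhdsWithin_le_nhds
  filter_upwards [hev, self_mem_nhdsWithin, hlim.eventually_le_const hc] with T h1 hT h2
  have hT' : 0 < T := hT
  have h3 := ENNReal.log_monotone h1
  rw [ENNReal.log_ofReal_of_pos (by positivity), Real.log_mul hK.ne' (Real.exp_ne_zero _),
    Real.log_exp] at h3
  calc (T : EReal) * ENNReal.log (controlCost T L)
      ≤ (T : EReal) * ((Real.log K + 56 / 100 * L ^ 2 / T : ℝ) : EReal) :=
        mul_le_mul_of_nonneg_left h3 (by exact_mod_cast hT'.le)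
    _ = ((T * Real.log K + 56 / 100 * L ^ 2 : ℝ) : EReal) := by
        rw [← EReal.coe_mul]
        congr 1
        field_simp
    _ ≤ _ := by exact_mod_cast h2

theorem lt_rpow_one_div_four {a b : ℝ} (hb : 0 ≤ b) (h : a ^ 4 < b) :
    a < b ^ ((1 : ℝ) / 4) := by
  have h1 : (b ^ ((1 : ℝ) / 4)) ^ 4 = b := by
    rw [← Real.rpow_natCast, ← Real.rpow_mul hb]
    norm_num
  exact lt_of_pow_lt_pow_left₀ 4 (by positivity) (by rwa [h1])

theorem rpow_one_div_four_lt {a b : ℝ} (ha : 0 ≤ a) (hb : 0 ≤ b) (h : b < a ^ 4) :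
    b ^ ((1 : ℝ) / 4) < a := by
  have h1 : (b ^ ((1 : ℝ) / 4)) ^ 4 = b := by
    rw [← Real.rpow_natCast, ← Real.rpow_mul hb]
    norm_num
  exact lt_of_pow_lt_pow_left₀ 4 ha (by rwa [h1])

end SchrodingerControl
end

theorem mainTheorem2 (L : ℝ) (hL : 0 < L) :
    SchrodingerControl.betaPlus L ≤ (((27 : ℝ) ^ ((1 : ℝ) / 4) / 4 * L ^ 2 : ℝ) : EReal) ∧
      (27 : ℝ) ^ ((1 : ℝ) / 4) / 4 * L ^ 2 < 0.56987677 * L ^ 2 := by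
  have hL2 : 0 < L ^ 2 := by positivity
  constructor
  · refine SchrodingerControl.betaPlus_le hL (mul_lt_mul_of_pos_right ?_ hL2)
    -- 2.27⁴ < 27 and 2.27/4 = 0.5675 > 0.56.
    have := SchrodingerControl.lt_rpow_one_div_four (a := 2.27) (b := 27) (by norm_num)
      (by norm_num)
    linarith
  · refine mul_lt_mul_of_pos_right ?_ hL2
    have := SchrodingerControl.rpow_one_div_four_lt (a := 4 * 0.56987677) (b := 27) (by norm_num)
      (by norm_num) (by norm_num)
    linarith
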